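/- Let $\mathfrak X$ be a countably infinite alphabet containing pairwise distinct letters $x,y,t,z_i,t_i,y_i,z_i',t_i'$ ($i\ge 1$), let $\mathfrak X^*$ be the free monoid over $\mathfrak X$, and let $S_m$ be the symmetric group on $\{1,\dots,m\}$ (with $i\pi$ the image of $i$ under $\pi$). For $n\ge 1$, $\pi_1\in S_{4n+1}$, $\pi_2\in S_{n+1}$, $\pi_3,\pi_4\in S_{2n+1}$ and $\tau\in S_{2n}$ put \[ \mathbf h_n:=\Bigl(\prod_{i=1}^n z_i't_i'\Bigr)\,xyt\,\Bigl(\prod_{i=n+1}^{2n} z_i't_i'\Bigr)\,x , \] \[ \begin{aligned} \mathbf c_n^{(1)}[\pi_1,\tau]&:=\mathbf h_n\Bigl(\prod_{i=1}^{2n} z_{(2i-1)\pi_1}\,y_i^2\,z_{(2i)\pi_1}\,z_{i\tau}'\Bigr)z_{(4n+1)\pi_1}\,y\,\Bigl(\prod_{i=1}^{4n+1} t_iz_i\Bigr),\\ \mathbf c_n^{(2)}[\pi_2,\tau]&:=\mathbf h_n\Bigl(\prod_{i=1}^{n} z_{i\pi_2}\,z_{(2i-1)\tau}'\,y_i^2\,z_{(2i)\tau}'\Bigr)z_{(n+1)\pi_2}\,y\,\Bigl(\prod_{i=1}^{n+1}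 t_iz_i\Bigr),\\ \mathbf c_n^{(3)}[\pi_3,\tau]&:=\mathbf h_n\Bigl(\prod_{i=1}^{2n} z_{i\pi_3}\,z_{i\tau}'\,y_i^2\Bigr)z_{(2n+1)\pi_3}\,y\,\Bigl(\prod_{i=1}^{2n+1} t_iz_i\Bigr),\\ \mathbf c_n^{(4)}[\pi_4,\tau]&:=\mathbf h_n\Bigl(\prod_{i=1}^{2n} z_{i\pi_4}\,y_i^2\,z_{i\tau}'\Bigr)z_{(2n+1)\pi_4}\,y\,\Bigl(\prod_{i=1}^{2n+1} t_iz_i\Bigr). \end{aligned} \] A variety of monoids is a class of monoids defined by a set of identities $\mathbf u\approx\mathbf v$ with $\mathbf u,\mathbf v\in\mathfrak X^*$; its subvarieties form a lattice under inclusion. For a congruence $\alpha$ on $\mathfrak X^*$ and a set $W$ of $\alpha$-classes, let $W^{\le}$ be the set of all factors in $\mathfrak X^*/\alpha$ of elements of $W$, let $M_\alpha(W)$ be the Rees quotient of the monoid $\mathfrak X^*/\alpha$ over the ideal $(\mathfrak X^*/\alpha)\setminus W^{\le}$, and let $\mathbf M_\alpha(W)$ be the variety of monoids generated by $M_\alpha(W)$.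 When $\alpha$ is equality we write $M(W)$, and $M(\mathbf w)$ for $M(\{\mathbf w\})$. An island of a word is a maximal factor that is a power of a single letter. Write $\mathbf u\mathrel{\gamma}\mathbf v$ if $\mathbf u$ and $\mathbf v$ have the same set of letters occurring exactly once and $\mathbf u$ is obtained from $\mathbf v$ by changing the (positive) exponents of its islands. Write $\mathbf u\mathrel{\gamma'}\mathbf v$ if $\mathbf u\mathrel{\gamma}\mathbf v$ and the monoid $M(xyx)$ satisfies the identity $\mathbf u\approx\mathbf v$. Let $[\mathbf w]^{\gamma'}$ denote the $\gamma'$-class of $\mathbf w$. Proposition. For all $n\ge1$, $\pi_1\in S_{4n+1}$, $\pi_2\in S_{n+1}$, $\pi_3,\pi_4\in S_{2n+1}$ and $\tau\in S_{2n}$, none of the subvariety lattices of the four varieties \[ \mathbf M_{\gamma'}\bigl(\{[\mathbf c_n^{(1)}[\pi_1,\tau]]^{\gamma'}\}\bigr),\quad \mathbf M_{\gamma'}\bigl(\{[\mathbf c_n^{(2)}[\pi_2,\tau]]^{\gamma'}\}\bigr),\quad \mathbf M_{\gamma'}\bigl(\{[\mathbf c_n^{(3)}[\pi_3,\tau]]^{\gamma'}\}\bigr),\quad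 \mathbf M_{\gamma'}\bigl(\{[\mathbf c_n^{(4)}[\pi_4,\tau]]^{\gamma'}\}\bigr) \] is modular. -/

import Mathlib

namespace MonVar

/-! ### Words and identities -/

/-- A countably infinite alphabet, with the letters
`x, y, t` and `zᵢ, tᵢ, yᵢ, zᵢ', tᵢ'` (`i = 0, 1, 2, …`), all distinct. -/
inductive Letter : Type
  | x : Letter
  | y : Letter
  | t : Letter
  | zs (i : ℕ) : Letter
  | ts (i : ℕ) : Letter
  | ys (i : ℕ) : Letter
  | zp (i : ℕ) : Letter
  | tp (i : ℕ) : Letter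
  deriving DecidableEq

theorem Letter.infinite : Infinite Letter :=
  Infinite.of_injective Letter.zs fun i j h => by injection h

theorem Letter.countable : Countable Letter := by
  let f : Letter → ℕ × ℕ := fun a => match a with
    | .x => (0, 0) | .y => (1, 0) | .t => (2, 0) | .zs i => (3, i) | .ts i => (4, i)
    | .ys i => (5, i) | .zp i => (6, i) | .tp i => (7, i)
  have hf : Function.Injective f := by
    intro a b h
    cases a <;> cases b <;> simp_all [f]
  exact hf.countable

/-- Words are the elements of the free monoid over the alphabet. -/
abbrev Word : Type := FreeMonoid Letter

/-- The pair `(u, v)` stands for the identity `u ≈ v`. -/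
abbrev Identity : Type := Word × Word

/-- The monoid `M` satisfies the identity `e`. -/
def Satisfies (M : Type*) [Monoid M] (e : Identity) : Prop :=
  ∀ φ : Letter → M, FreeMonoid.lift φ e.1 = FreeMonoid.lift φ e.2

/-! ### Varieties of monoids -/

/-- The class of all monoids satisfying each identity in `S`. -/
def models (S : Set Identity) : Set MonCat.{0} :=
  {M | ∀ e ∈ S, Satisfies M e}

/-- A variety of monoids: a class of monoids that is defined by some set of identities. -/
structure MonoidVariety where
  carrier : Set MonCat.{0}
  equational : ∃ S : Set Identity, carrier = models S

namespace MonoidVariety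

theorem carrier_injective : Function.Injective carrier := by
  rintro ⟨C, _⟩ ⟨D, _⟩ h
  cases h
  rfl

/-- Varieties are ordered by inclusion. -/
instance : PartialOrder MonoidVariety := PartialOrder.lift carrier carrier_injective

theorem le_def (V W : MonoidVariety) : V ≤ W ↔ V.carrier ⊆ W.carrier := Iff.rfl

/-- The intersection of a family of varieties. -/
instance : InfSet MonoidVariety where
  sInf F :=
    { carrier := {M | ∀ V ∈ F, M ∈ V.carrier}
      equational := by
        refine ⟨{e | ∃ V ∈ F, ∀ M ∈ V.carrier, Satisfies M e}, ?_⟩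
        ext M
        constructor
        · rintro h e ⟨V, hV, he⟩
          exact he M (h V hV)
        · intro h V hV
          obtain ⟨S, hS⟩ := V.equational
          rw [hS]
          intro e he
          refine h e ⟨V, hV, fun N hN => ?_⟩
          rw [hS] at hN
          exact hN e he }

theorem isGLB_sInf (F : Set MonoidVariety) : IsGLB F (sInf F) :=
  ⟨fun _ hV _ hM => hM _ hV, fun _ hW _ hM V hV => hW hV hM⟩

/-- The lattice of all varieties of monoids: meet is intersection, and the join of two varieties
is the least variety containing both. -/
noncomputable instance : CompleteLattice MonoidVariety :=
  completeLatticeOfInf MonoidVariety isGLB_sInf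

/-- The variety generated by the monoid `M`: the class of all monoids that satisfy every identity
of `M`. -/
def generatedBy (M : Type) [Monoid M] : MonoidVariety where
  carrier := models {e | Satisfies M e}
  equational := ⟨_, rfl⟩

theorem isLeast_generatedBy (M : Type) [Monoid M] :
    IsLeast {V : MonoidVariety | MonCat.of M ∈ V.carrier} (generatedBy M) := by
  refine ⟨fun e he => he, ?_⟩
  intro V hV N hN
  obtain ⟨S, hS⟩ := V.equational
  have hM : MonCat.of M ∈ V.carrier := hV
  rw [hS] at hM ⊢
  exact fun e he => hN e (hM e he)

/-- The fully invariant congruence of `V` on the free monoid: `u` and `v` are related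
if and only if `V` satisfies `u ≈ v`. -/
def FIC (V : MonoidVariety) : Con Word where
  r u v := ∀ M ∈ V.carrier, Satisfies M (u, v)
  iseqv :=
    { refl := fun _ _ _ _ => rfl
      symm := fun h M hM φ => (h M hM φ).symm
      trans := fun h k M hM φ => (h M hM φ).trans (k M hM φ) }
  mul' := by
    intro a b c d h k M hM φ
    have h1 := h M hM φ
    have h2 := k M hM φ
    simp only [map_mul] at h1 h2 ⊢
    rw [h1, h2]

end MonoidVariety

/-! ### Rees quotients -/

/-- `W^≤`: the set of all factors of elements of `W`. -/
def factors {S : Type} [Monoid S] (W : Set S) : Set S :=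
  {v | ∃ u ∈ W, ∃ p s : S, u = p * v * s}

/-- The Rees congruence of the ideal `S \ W^≤`, which collapses this ideal to one element and
identifies nothing else. -/
def reesCon {S : Type} [Monoid S] (W : Set S) : Con S where
  r a b := a = b ∨ (a ∉ factors W ∧ b ∉ factors W)
  iseqv :=
    { refl := fun _ => Or.inl rfl
      symm := by
        rintro a b (h | ⟨h, k⟩)
        · exact Or.inl h.symm
        · exact Or.inr ⟨k, h⟩
      trans := by
        rintro a b c (rfl | ⟨h, k⟩) (rfl | ⟨h', k'⟩)
        · exact Or.inl rfl
        · exact Or.inr ⟨h', k'⟩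
        · exact Or.inr ⟨h, k⟩
        · exact Or.inr ⟨h, k'⟩ }
  mul' := by
    have hl : ∀ a b : S, a ∉ factors W → a * b ∉ factors W := by
      rintro a b h ⟨u, hu, p, s, rfl⟩
      exact h ⟨_, hu, p, b * s, by simp only [mul_assoc]⟩
    have hr : ∀ a b : S, b ∉ factors W → a * b ∉ factors W := by
      rintro a b h ⟨u, hu, p, s, rfl⟩
      exact h ⟨_, hu, p * a, s, by simp only [mul_assoc]⟩
    rintro a b c d (rfl | ⟨h, k⟩) (rfl | ⟨h', k'⟩)
    · exact Or.inl rfl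
    · exact Or.inr ⟨hr _ _ h', hr _ _ k'⟩
    · exact Or.inr ⟨hl _ _ h, hl _ _ k⟩
    · exact Or.inr ⟨hl _ _ h, hl _ _ k⟩

/-- The Rees quotient of the monoid `S` over the ideal `S \ W^≤`. For `S = Word` this is `M(W)`. -/
abbrev ReesQuotient {S : Type} [Monoid S] (W : Set S) : Type := (reesCon W).Quotient

/-- `M_α(W)` for a congruence `α` on the free monoid and a set `W` of `α`-classes. -/
abbrev MAlpha (α : Con Word) (W : Set α.Quotient) : Type := ReesQuotient W

/-! ### The congruences `γ` and `γ'` -/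

/-- The set of letters that occur exactly once in `w`. -/
def simpleLetters (w : Word) : Set Letter :=
  {a | w.toList.count a = 1}

/-- The sequence of the letters that form the successive islands of `w`
(an island is a maximal factor that is a power of a letter). -/
def islands (w : Word) : List Letter :=
  w.toList.destutter (· ≠ ·)

/-- Prepend a letter, unless the list already begins with it. -/
def glue (a : Letter) (l : List Letter) : List Letter :=
  if l.head? = some a then l else a :: l

theorem destutter_cons_eq_glue (a : Letter) (l : List Letter) :
    (a :: l).destutter (· ≠ ·) = glue a (l.destutter (· ≠ ·)) := by
  cases l with
  | nil => simp [glue]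
  | cons b l =>
    rw [List.destutter_cons_cons]
    have hb : ∀ m : List Letter, ((b :: m).destutter (· ≠ ·)).head? = some b := by
      intro m
      induction m with
      | nil => simp
      | cons c m ih =>
        rw [List.destutter_cons_cons]
        split_ifs with h
        · rfl
        · simp only [ne_eq, not_not] at h
          subst h
          exact ih
    by_cases h : a = b
    · subst h
      simp [glue, hb]
      rfl
    · have : ¬ b = a := fun e => h e.symm
      simp [glue, hb, h, this]
      rfl

theorem destutter_eq_foldr (l : List Letter) :
    l.destutter (· ≠ ·) = l.foldr glue [] := by
  induction l with
  | nil => rfl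
  | cons a l ih => rw [destutter_cons_eq_glue, ih, List.foldr_cons]

theorem glue_glue (a : Letter) (l : List Letter) : glue a (glue a l) = glue a l := by
  unfold glue
  split_ifs <;> simp_all

theorem foldr_glue_destutter (l m : List Letter) :
    (l.destutter (· ≠ ·)).foldr glue m = l.foldr glue m := by
  induction l with
  | nil => rfl
  | cons a l ih =>
    rw [destutter_cons_eq_glue, List.foldr_cons, ← ih]
    generalize l.destutter (· ≠ ·) = k
    cases k with
    | nil => simp [glue]
    | cons b k =>
      by_cases h : b = a
      · subst h
        have e : glue b (b :: k) = b :: k := by simp [glue]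
        rw [e, List.foldr_cons, glue_glue]
      · simp [glue, h]

theorem islands_mul (u v : Word) :
    islands (u * v) = (islands u).foldr glue (islands v) := by
  unfold islands
  rw [foldr_glue_destutter, FreeMonoid.toList_mul, destutter_eq_foldr, List.foldr_append,
    ← destutter_eq_foldr]

theorem mem_islands_iff (w : Word) (a : Letter) : a ∈ islands w ↔ a ∈ w.toList := by
  unfold islands
  rw [destutter_eq_foldr]
  induction w.toList with
  | nil => simp
  | cons b l ih =>
    rw [List.foldr_cons, List.mem_cons, ← ih]
    generalize l.foldr glue [] = k
    unfold glue
    split_ifs with h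
    · constructor
      · exact Or.inr
      · rintro (rfl | h')
        · exact List.mem_of_mem_head? h
        · exact h'
    · simp

/-- The congruence `γ`: two words are related if and only if they have the same simple letters
and one is obtained from the other by changing the exponents of the islands
(keeping them positive). -/
def gamma : Con Word where
  r u v := simpleLetters u = simpleLetters v ∧ islands u = islands v
  iseqv :=
    { refl := fun _ => ⟨rfl, rfl⟩
      symm := fun h => ⟨h.1.symm, h.2.symm⟩
      trans := fun h k => ⟨h.1.trans k.1, h.2.trans k.2⟩ }
  mul' := by
    rintro u u' v v' ⟨h1, h2⟩ ⟨k1, k2⟩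
    refine ⟨?_, by rw [islands_mul, islands_mul, h2, k2]⟩
    ext a
    have e1 : u.toList.count a = 1 ↔ u'.toList.count a = 1 := Set.ext_iff.1 h1 a
    have e2 : v.toList.count a = 1 ↔ v'.toList.count a = 1 := Set.ext_iff.1 k1 a
    have e3 : 0 < u.toList.count a ↔ 0 < u'.toList.count a := by
      rw [List.count_pos_iff, List.count_pos_iff, ← mem_islands_iff, ← mem_islands_iff, h2]
    have e4 : 0 < v.toList.count a ↔ 0 < v'.toList.count a := by
      rw [List.count_pos_iff, List.count_pos_iff, ← mem_islands_iff, ← mem_islands_iff, k2]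
    simp only [simpleLetters, Set.mem_ofPred_eq, FreeMonoid.toList_mul, List.count_append]
    omega

/-- A letter, as a word of length one. -/
abbrev ltr (a : Letter) : Word := FreeMonoid.of a

open Letter

/-- The monoid `M(xyx)`. -/
abbrev Mxyx : Type := ReesQuotient ({ltr x * ltr y * ltr x} : Set Word)

/-- The congruence `γ' = γ ∧ FIC(𝐌(xyx))`. -/
noncomputable def gamma' : Con Word :=
  gamma ⊓ (MonoidVariety.generatedBy Mxyx).FIC

/-- The variety `𝐌_{γ'}([w]^{γ'})`, generated by the monoid `M_{γ'}([w]^{γ'})`. -/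
noncomputable def varGamma' (w : Word) : MonoidVariety :=
  MonoidVariety.generatedBy (MAlpha gamma' {(w : gamma'.Quotient)})

/-! ### The words `c_n^{(i)}[π, τ]`

All indices are shifted by one: permutations act on `Fin m = {0, …, m - 1}`. -/

/-- `(z₁' t₁' ⋯ zₙ' tₙ') x y t (zₙ₊₁' tₙ₊₁' ⋯ z₂ₙ' t₂ₙ') x`, the common prefix of the words. -/
def cHead (n : ℕ) : Word :=
  (List.ofFn fun i : Fin n => ltr (zp i) * ltr (tp i)).prod *
    (ltr x * ltr y * ltr t) *
    (List.ofFn fun i : Fin n => ltr (zp (n + i)) * ltr (tp (n + i))).prod *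
    ltr x

/-- `t₁ z₁ ⋯ t_m z_m`, the common form of the suffixes of the words. -/
def cTail (m : ℕ) : Word :=
  (List.ofFn fun i : Fin m => ltr (ts i) * ltr (zs i)).prod

def c1 (n : ℕ) (π : Equiv.Perm (Fin (4 * n + 1))) (τ : Equiv.Perm (Fin (2 * n))) : Word :=
  cHead n *
    (List.ofFn fun i : Fin (2 * n) =>
      ltr (zs (π ⟨2 * i, by omega⟩)) * ltr (ys i) ^ 2 * ltr (zs (π ⟨2 * i + 1, by omega⟩)) *
        ltr (zp (τ i))).prod *
    (ltr (zs (π (Fin.last (4 * n)))) * ltr y) *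
    cTail (4 * n + 1)

def c2 (n : ℕ) (π : Equiv.Perm (Fin (n + 1))) (τ : Equiv.Perm (Fin (2 * n))) : Word :=
  cHead n *
    (List.ofFn fun i : Fin n =>
      ltr (zs (π i.castSucc)) * ltr (zp (τ ⟨2 * i, by omega⟩)) * ltr (ys i) ^ 2 *
        ltr (zp (τ ⟨2 * i + 1, by omega⟩))).prod *
    (ltr (zs (π (Fin.last n))) * ltr y) *
    cTail (n + 1)

def c3 (n : ℕ) (π : Equiv.Perm (Fin (2 * n + 1))) (τ : Equiv.Perm (Fin (2 * n))) : Word :=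
  cHead n *
    (List.ofFn fun i : Fin (2 * n) =>
      ltr (zs (π i.castSucc)) * ltr (zp (τ i)) * ltr (ys i) ^ 2).prod *
    (ltr (zs (π (Fin.last (2 * n)))) * ltr y) *
    cTail (2 * n + 1)

def c4 (n : ℕ) (π : Equiv.Perm (Fin (2 * n + 1))) (τ : Equiv.Perm (Fin (2 * n))) : Word :=
  cHead n *
    (List.ofFn fun i : Fin (2 * n) =>
      ltr (zs (π i.castSucc)) * ltr (ys i) ^ 2 * ltr (zp (τ i))).prod *
    (ltr (zs (π (Fin.last (2 * n)))) * ltr y) *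
    cTail (2 * n + 1)

end MonVar

/-!
Two copies of a word `c` from the theorem, a left and a right one in disjoint alphabets, are
interlocked into one word. Swapping the first factor `x y` of either copy yields four words
`u₀₀, u₀₁, u₁₀, u₁₁`, and the subvarieties given by `{u₀₀ ≈ u₁₀, u₀₁ ≈ u₁₁}`, by
`{u₀₀ ≈ u₀₁, u₁₀ ≈ u₁₁}` and by `u₀₀ ≈ u₁₀` violate the modular law. The monoids that prove this are
syntactic monoids of languages of words `v` such that the generating monoid satisfies, up to further
applications of the two swaps, the identity between the interlocked word and `v`.

The key point is that a substitution which maps the interlocked word into a factor of such a word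
either makes the images of a swapped pair commute or fixes the pair. If it fixes the left pair, then
it fixes the right one as well: the letters `z_j` of the left copy, which lie between its second `x`
and its second `y`, have to be covered by too few letters otherwise. Hence the left pair cannot be
swapped independently of the right one.
-/

namespace MonVar

open Letter

section Syntactic

variable {Γ Δ : Type*}

/-- Satisfaction of an identity `a ≈ b` over an arbitrary alphabet `Γ`. -/
def SatisfiesOver (M : Type*) [Monoid M] (a b : FreeMonoid Γ) : Prop :=
  ∀ φ : Γ → M, FreeMonoid.lift φ a = FreeMonoid.lift φ b

theorem SatisfiesOver.symm {M : Type*} [Monoid M] {a b : FreeMonoid Γ}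
    (h : SatisfiesOver M a b) : SatisfiesOver M b a :=
  fun φ => (h φ).symm

theorem SatisfiesOver.mul_lift_mul {M : Type*} [Monoid M] {a b : FreeMonoid Δ}
    (h : SatisfiesOver M a b) (φ : Δ → FreeMonoid Γ) (p s : FreeMonoid Γ) :
    SatisfiesOver M (p * FreeMonoid.lift φ a * s) (p * FreeMonoid.lift φ b * s) := by
  intro θ
  simp only [map_mul, FreeMonoid.hom_map_lift, h _]

theorem satisfies_map_iff {f : Γ → Letter} (hf : Function.Injective f) (M : Type*) [Monoid M]
    (a b : FreeMonoid Γ) :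
    Satisfies M (FreeMonoid.map f a, FreeMonoid.map f b) ↔ SatisfiesOver M a b := by
  have lift_map : ∀ (φ : Letter → M) (c : FreeMonoid Γ),
      FreeMonoid.lift φ (FreeMonoid.map f c) = FreeMonoid.lift (φ ∘ f) c := by
    intro φ c
    simp only [FreeMonoid.lift_apply, FreeMonoid.toList_map, List.map_map]
  simp only [Satisfies, lift_map]
  refine ⟨fun h φ => ?_, fun h φ => h _⟩
  simpa only [Function.extend_comp hf] using h (Function.extend f φ 1)

/-- The language `K` is closed under all applications of the identity `a ≈ b`, in both
directions. -/
def ClosedUnder (K : Set (FreeMonoid Γ)) (a b : FreeMonoid Δ) : Prop :=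
  ∀ (φ : Δ → FreeMonoid Γ) (p s : FreeMonoid Γ),
    p * FreeMonoid.lift φ a * s ∈ K ↔ p * FreeMonoid.lift φ b * s ∈ K

theorem ClosedUnder.inter {K L : Set (FreeMonoid Γ)} {a b : FreeMonoid Δ}
    (hK : ClosedUnder K a b) (hL : ClosedUnder L a b) : ClosedUnder (K ∩ L) a b :=
  fun φ p s => and_congr (hK φ p s) (hL φ p s)

theorem ClosedUnder.mem_iff {K : Set (FreeMonoid Γ)} {a b : FreeMonoid Γ}
    (h : ClosedUnder K a b) : a ∈ K ↔ b ∈ K := by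
  have lift_of : ∀ c : FreeMonoid Γ, FreeMonoid.lift FreeMonoid.of c = c :=
    DFunLike.congr_fun (FreeMonoid.lift_restrict (MonoidHom.id (FreeMonoid Γ)))
  simpa only [lift_of, one_mul, mul_one] using h FreeMonoid.of 1 1

/-- The syntactic congruence of a language: two words are related if and only if they have the
same contexts in the language. -/
def syntacticCon (K : Set (FreeMonoid Γ)) : Con (FreeMonoid Γ) where
  r a b := ∀ p s, p * a * s ∈ K ↔ p * b * s ∈ K
  iseqv :=
    { refl := fun _ _ _ => Iff.rfl
      symm := fun h p s => (h p s).symm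
      trans := fun h k p s => (h p s).trans (k p s) }
  mul' := by
    intro a b c d hab hcd p s
    have hleft := hab p (c * s)
    have hright := hcd (p * b) s
    simp only [mul_assoc] at hleft hright ⊢
    exact hleft.trans hright

theorem satisfiesOver_syntacticCon_iff (K : Set (FreeMonoid Γ)) (a b : FreeMonoid Δ) :
    SatisfiesOver (syntacticCon K).Quotient a b ↔ ClosedUnder K a b := by
  have lift_coe : ∀ (φ : Δ → FreeMonoid Γ) (c : FreeMonoid Δ),
      FreeMonoid.lift (fun g => ((φ g : FreeMonoid Γ) : (syntacticCon K).Quotient)) c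
        = ((FreeMonoid.lift φ c : FreeMonoid Γ) : (syntacticCon K).Quotient) :=
    fun φ c => (FreeMonoid.hom_map_lift (syntacticCon K).mk' φ c).symm
  constructor
  · intro h φ
    have hφ := h fun g => ((φ g : FreeMonoid Γ) : (syntacticCon K).Quotient)
    rwa [lift_coe, lift_coe, Con.eq] at hφ
  · intro h φ
    choose ψ hψ using fun g => Quot.exists_rep (φ g)
    obtain rfl : (fun g => ((ψ g : FreeMonoid Γ) : (syntacticCon K).Quotient)) = φ := funext hψ
    rw [lift_coe, lift_coe, Con.eq]
    exact h ψ

theorem closedUnder_map_iff {f : Γ → Letter} (hf : Function.Injective f) {K : Set (FreeMonoid Δ)}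
    {a b : FreeMonoid Γ} :
    ClosedUnder K (FreeMonoid.map f a) (FreeMonoid.map f b) ↔ ClosedUnder K a b :=
  (satisfiesOver_syntacticCon_iff K _ _).symm.trans
    ((satisfies_map_iff hf _ a b).trans (satisfiesOver_syntacticCon_iff K a b))

/-- The language `K` is a union of classes of the equational theory of `M`. -/
def IsSaturated (M : Type*) [Monoid M] (K : Set (FreeMonoid Γ)) : Prop :=
  ∀ a b : FreeMonoid Γ, SatisfiesOver M a b → a ∈ K → b ∈ K

theorem IsSaturated.inter {M : Type*} [Monoid M] {K L : Set (FreeMonoid Γ)}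
    (hK : IsSaturated M K) (hL : IsSaturated M L) : IsSaturated M (K ∩ L) :=
  fun a b h hab => ⟨hK a b h hab.1, hL a b h hab.2⟩

theorem IsSaturated.closedUnder {M : Type*} [Monoid M] {K : Set (FreeMonoid Γ)}
    (hK : IsSaturated M K) {a b : FreeMonoid Δ} (h : SatisfiesOver M a b) : ClosedUnder K a b :=
  fun φ p s => ⟨hK _ _ (h.mul_lift_mul φ p s), hK _ _ (h.mul_lift_mul φ p s).symm⟩

end Syntactic

theorem exists_injective_letter (Γ : Type*) [Countable Γ] :
    ∃ f : Γ → Letter, Function.Injective f :=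
  have ⟨g, hg⟩ := exists_injective_nat Γ
  ⟨fun a => Letter.zs (g a), fun _ _ h => hg (Letter.zs.inj h)⟩

namespace MonoidVariety

/-- The variety defined by a set of identities. -/
def ofIdentities (S : Set Identity) : MonoidVariety := ⟨models S, S, rfl⟩

theorem mem_inf_iff {V W : MonoidVariety} {M : MonCat.{0}} :
    M ∈ (V ⊓ W).carrier ↔ M ∈ V.carrier ∧ M ∈ W.carrier := by
  refine ⟨fun h => ⟨h V (Or.inl rfl), h W (Or.inr rfl)⟩, ?_⟩
  rintro ⟨hV, hW⟩ U (rfl | rfl)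
  exacts [hV, hW]

theorem mem_of_forall_satisfies {V : MonoidVariety} {M : MonCat.{0}}
    (h : ∀ e : Identity, (∀ N ∈ V.carrier, Satisfies N e) → Satisfies M e) : M ∈ V.carrier := by
  obtain ⟨_, S, rfl⟩ := V
  exact fun e he => h e fun N hN => hN e he

theorem syntactic_mem_generatedBy_inf {Γ M : Type} [Monoid M] {K : Set (FreeMonoid Γ)}
    (hK : IsSaturated M K) {S : Set Identity} (hS : ∀ e ∈ S, ClosedUnder K e.1 e.2) :
    MonCat.of (syntacticCon K).Quotient ∈ (generatedBy M ⊓ ofIdentities S).carrier :=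
  mem_inf_iff.2 ⟨fun _ he => (satisfiesOver_syntacticCon_iff K _ _).2 (hK.closedUnder he),
    fun e he => (satisfiesOver_syntacticCon_iff K _ _).2 (hS e he)⟩

theorem syntactic_inter_mem_sup {Γ : Type} {K L : Set (FreeMonoid Γ)} {V W : MonoidVariety}
    (hK : MonCat.of (syntacticCon K).Quotient ∈ V.carrier)
    (hL : MonCat.of (syntacticCon L).Quotient ∈ W.carrier) :
    MonCat.of (syntacticCon (K ∩ L)).Quotient ∈ (V ⊔ W).carrier := by
  have hV : V ≤ V ⊔ W := le_sup_left
  have hW : W ≤ V ⊔ W := le_sup_right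
  refine mem_of_forall_satisfies fun e he => (satisfiesOver_syntacticCon_iff _ _ _).2 ?_
  exact ((satisfiesOver_syntacticCon_iff _ _ _).1 (he _ (hV hK))).inter
    ((satisfiesOver_syntacticCon_iff _ _ _).1 (he _ (hW hL)))

end MonoidVariety

theorem sup_inf_le_of_isModularLattice_Iic {α : Type*} [Lattice α] {v a b c : α}
    (h : IsModularLattice (Set.Iic v)) (ha : a ≤ v) (hb : b ≤ v) (hc : c ≤ v) (hac : a ≤ c) :
    (a ⊔ b) ⊓ c ≤ a ⊔ b ⊓ c :=
  @IsModularLattice.sup_inf_le_assoc_of_le (Set.Iic v) _ h ⟨a, ha⟩ ⟨b, hb⟩ ⟨c, hc⟩ hac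

open MonoidVariety

/-- The pentagon is spanned by the subvarieties given by `u₀₀ ≈ u₁₀, u₀₁ ≈ u₁₁`, by
`u₀₀ ≈ u₀₁, u₁₀ ≈ u₁₁`, and by `u₀₀ ≈ u₁₀`. The syntactic monoid of `K ∩ L` lies in the join of
the first two and in the third, but does not satisfy `u₀₁ ≈ u₁₁`. -/
theorem not_isModularLattice_of_languages {Γ M : Type} [Countable Γ] [Monoid M]
    {K L : Set (FreeMonoid Γ)} {u₀₀ u₀₁ u₁₀ u₁₁ : FreeMonoid Γ}
    (hK : IsSaturated M K) (hL : IsSaturated M L)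
    (hK₀ : ClosedUnder K u₀₀ u₁₀) (hK₁ : ClosedUnder K u₀₁ u₁₁)
    (hL₀ : ClosedUnder L u₀₀ u₀₁) (hL₁ : ClosedUnder L u₁₀ u₁₁)
    (hKL : ClosedUnder (K ∩ L) u₀₀ u₁₀) (hmem : u₀₁ ∈ K ∩ L) (hnotMem : u₁₁ ∉ K ∩ L) :
    ¬ IsModularLattice (Set.Iic (generatedBy M)) := by
  intro hmod
  obtain ⟨f, hf⟩ := exists_injective_letter Γ
  let encode (a b : FreeMonoid Γ) : Identity := (FreeMonoid.map f a, FreeMonoid.map f b)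
  let A := generatedBy M ⊓ ofIdentities {encode u₀₀ u₁₀, encode u₀₁ u₁₁}
  let B := generatedBy M ⊓ ofIdentities {encode u₀₀ u₀₁, encode u₁₀ u₁₁}
  let C := generatedBy M ⊓ ofIdentities {encode u₀₀ u₁₀}
  have hA : MonCat.of (syntacticCon K).Quotient ∈ A.carrier := by
    refine syntactic_mem_generatedBy_inf hK ?_
    rintro e (rfl | rfl)
    exacts [(closedUnder_map_iff hf).2 hK₀, (closedUnder_map_iff hf).2 hK₁]
  have hB : MonCat.of (syntacticCon L).Quotient ∈ B.carrier := by
    refine syntactic_mem_generatedBy_inf hL ?_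
    rintro e (rfl | rfl)
    exacts [(closedUnder_map_iff hf).2 hL₀, (closedUnder_map_iff hf).2 hL₁]
  have hC : MonCat.of (syntacticCon (K ∩ L)).Quotient ∈ C.carrier := by
    refine syntactic_mem_generatedBy_inf (hK.inter hL) ?_
    rintro e rfl
    exact (closedUnder_map_iff hf).2 hKL
  have hAC : A ≤ C := inf_le_inf_left _ fun N hN e he => hN e (Or.inl he)
  have hmodular : (A ⊔ B) ⊓ C ≤ A ⊔ B ⊓ C :=
    sup_inf_le_of_isModularLattice_Iic hmod inf_le_left inf_le_left inf_le_left hAC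
  have hA_le : A ≤ ofIdentities {encode u₀₁ u₁₁} :=
    inf_le_right.trans fun N hN e he => hN e (Or.inr he)
  have hBC_le : B ⊓ C ≤ ofIdentities {encode u₀₁ u₁₁} := by
    rintro N hN e rfl φ
    have hNB := mem_inf_iff.1 (mem_inf_iff.1 hN).1
    have hNC := mem_inf_iff.1 (mem_inf_iff.1 hN).2
    exact (hNB.2 _ (Or.inl rfl) φ).symm.trans ((hNC.2 _ rfl φ).trans (hNB.2 _ (Or.inr rfl) φ))
  have hsat := hmodular.trans (sup_le hA_le hBC_le)
    (mem_inf_iff.2 ⟨syntactic_inter_mem_sup hA hB, hC⟩) _ rfl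
  exact hnotMem (((closedUnder_map_iff hf).1
    ((satisfiesOver_syntacticCon_iff (K ∩ L) _ _).1 hsat)).mem_iff.1 hmem)

section Projections

variable {α β : Type*} [DecidableEq α]

/-- The projection of a list onto two letters: all other letters are deleted. -/
def pairProj (p q : α) (v : List α) : List α := v.filter fun g => g = p ∨ g = q

theorem pairProj_append (p q : α) (v w : List α) :
    pairProj p q (v ++ w) = pairProj p q v ++ pairProj p q w := List.filter_append ..

@[simp] theorem pairProj_nil (p q : α) : pairProj p q [] = [] := rfl

theorem pairProj_cons (p q a : α) (v : List α) :
    pairProj p q (a :: v) = if a = p ∨ a = q then a :: pairProj p q v else pairProj p q v := by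
  simp only [pairProj, List.filter_cons, decide_eq_true_eq]

theorem pairProj_comm (p q : α) (v : List α) : pairProj p q v = pairProj q p v := by
  simp only [pairProj, or_comm]

theorem pairProj_flatMap (p q : α) (ψ : β → List α) (v : List β) :
    pairProj p q (v.flatMap ψ) = v.flatMap fun g => pairProj p q (ψ g) := List.filter_flatMap

theorem mem_pairProj {p q g : α} {v : List α} :
    g ∈ pairProj p q v ↔ g ∈ v ∧ (g = p ∨ g = q) := by
  simp only [pairProj, List.mem_filter, decide_eq_true_eq]

theorem count_pairProj_left (p q : α) (v : List α) : (pairProj p q v).count p = v.count p :=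
  List.count_filter (by simp)

theorem count_pairProj_right (p q : α) (v : List α) : (pairProj p q v).count q = v.count q :=
  List.count_filter (by simp)

theorem pairProj_eq_replicate_left {p q : α} {v : List α} (hq : q ∉ v) :
    pairProj p q v = List.replicate (v.count p) p := by
  rw [← List.filter_beq]
  refine List.filter_congr fun g hg => ?_
  have hgq : g ≠ q := ne_of_mem_of_not_mem hg hq
  rw [Bool.eq_iff_iff]
  simp only [hgq, or_false, decide_eq_true_eq, beq_iff_eq]

theorem pairProj_eq_replicate_right {p q : α} {v : List α} (hp : p ∉ v) :
    pairProj p q v = List.replicate (v.count q) q := by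
  rw [pairProj_comm, pairProj_eq_replicate_left hp]

theorem pairProj_eq_nil {p q : α} {v : List α} (hp : p ∉ v) (hq : q ∉ v) :
    pairProj p q v = [] := by
  rw [pairProj_eq_replicate_left hq, List.count_eq_zero.2 hp, List.replicate_zero]

theorem eq_of_pairProj_eq : ∀ {v w : List α}, (∀ p q, pairProj p q v = pairProj p q w) → v = w
  | [], [], _ => rfl
  | [], b :: w, h => by simpa [pairProj_cons] using h b b
  | a :: v, [], h => by simpa [pairProj_cons] using h a a
  | a :: v, b :: w, h => by
    obtain rfl : a = b := by
      have hab := h a b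
      simp only [pairProj_cons, true_or, or_true, if_true, List.cons.injEq] at hab
      exact hab.1
    congr 1
    refine eq_of_pairProj_eq fun p q => ?_
    have hpq := h p q
    simp only [pairProj_cons] at hpq
    split_ifs at hpq
    · exact (List.cons.inj hpq).2
    · exact hpq

theorem flatMap_ite_eq_map_pairProj (p q : α) (s s' : β) (v : List α) :
    (v.flatMap fun g => if g = p then [s] else if g = q then [s'] else []) =
      (pairProj p q v).map fun g => if g = p then s else s' := by
  induction v with
  | nil => rfl
  | cons a v ih =>
    rw [List.flatMap_cons, ih, pairProj_cons]
    split_ifs with hp hpq <;> simp_all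

theorem pairProj_eq_of_flatMap_ite_eq {p q : α} {s s' : β} (hs : s ≠ s') {v w : List α}
    (h : (v.flatMap fun g => if g = p then [s] else if g = q then [s'] else []) =
      (w.flatMap fun g => if g = p then [s] else if g = q then [s'] else [])) :
    pairProj p q v = pairProj p q w := by
  classical
  have decode : ∀ u : List α, (((pairProj p q u).map fun g => if g = p then s else s').map
      fun b => if b = s then p else q) = pairProj p q u := by
    intro u
    rw [List.map_map]
    refine (List.map_congr_left fun g hg => ?_).trans (List.map_id' _)
    obtain ⟨-, rfl | rfl⟩ := mem_pairProj.1 hg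
    · simp
    · by_cases hgp : g = p <;> simp [hgp, hs.symm]
  rw [flatMap_ite_eq_map_pairProj, flatMap_ite_eq_map_pairProj] at h
  rw [← decode v, h, decode w]

theorem exists_count_eq_count_take {p q : α} {v W L R : List α} (h : pairProj p q v = W)
    (hv : v = L ++ R) :
    ∃ i ≤ W.length, L.count p = (W.take i).count p ∧ L.count q = (W.take i).count q := by
  subst hv h
  rw [pairProj_append]
  exact ⟨(pairProj p q L).length, by simp, by rw [List.take_left, count_pairProj_left],
    by rw [List.take_left, count_pairProj_right]⟩

theorem count_prefix_of_aabb {p q : α} (hpq : p ≠ q) {v L R : List α}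
    (h : pairProj p q v = [p, p, q, q]) (hv : v = L ++ R) :
    (L.count p = 2 ∨ L.count q = 0) ∧ L.count p ≤ 2 ∧ L.count q ≤ 2 := by
  obtain ⟨i, hi, hp, hq⟩ := exists_count_eq_count_take h hv
  have hqp := hpq.symm
  simp only [List.length_cons, List.length_nil] at hi
  interval_cases i <;> simp_all

theorem count_prefix_of_abab {p q : α} (hpq : p ≠ q) {v L R : List α}
    (h : pairProj p q v = [p, q, p, q]) (hv : v = L ++ R) :
    L.count q ≤ L.count p ∧ L.count p ≤ L.count q + 1 ∧ L.count p ≤ 2 := by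
  obtain ⟨i, hi, hp, hq⟩ := exists_count_eq_count_take h hv
  have hqp := hpq.symm
  simp only [List.length_cons, List.length_nil] at hi
  interval_cases i <;> simp_all

theorem count_prefix_of_abba {p q : α} (hpq : p ≠ q) {v L R : List α}
    (h : pairProj p q v = [p, q, q, p]) (hv : v = L ++ R) :
    (L.count p = 0 → L.count q = 0) ∧ (L.count p = 2 → L.count q = 2) ∧ L.count p ≤ 2 ∧
      L.count q ≤ 2 := by
  obtain ⟨i, hi, hp, hq⟩ := exists_count_eq_count_take h hv
  have hqp := hpq.symm
  simp only [List.length_cons, List.length_nil] at hi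
  interval_cases i <;> simp_all

end Projections

section Positions

variable {α β : Type*} [DecidableEq α] [DecidableEq β]

/-- The position of the occurrences of a letter relative to a separator: all of them after it,
one on each side of it, or all of them before it. -/
inductive Position : Type
  | after : Position
  | straddle : Position
  | before : Position

/-- The occurrences of `p` in two lists `L` and `R`, taken to be the parts of a word before and
after a separator, are in the given position. -/
def OnSides (L R : List α) (p : α) : Position → Prop
  | .after => p ∉ L
  | .straddle => L.count p = 1 ∧ R.count p = 1
  | .before => p ∉ R

/-- The letter `p` is in the given position relative to each occurrence of `σ` in `v`. It is used
for letters `σ` that occur once. -/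
def LiesAt (v : List α) (σ p : α) (r : Position) : Prop :=
  ∀ L R, v = L ++ σ :: R → OnSides L R p r

theorem onSides_pairProj_iff {L R : List α} {σ p : α} {r : Position} :
    OnSides (pairProj σ p L) (pairProj σ p R) p r ↔ OnSides L R p r := by
  cases r <;> simp [OnSides, mem_pairProj, count_pairProj_right]

theorem onSides_map_iff {f : α → β} (hf : Function.Injective f) {L R : List α} {p : α}
    {r : Position} : OnSides (L.map f) (R.map f) (f p) r ↔ OnSides L R p r := by
  cases r <;> simp [OnSides, hf.eq_iff, List.count_map_of_injective _ _ hf]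

theorem eq_of_append_cons_eq {L R L' R' : List α} {σ : α}
    (h : L ++ σ :: R = L' ++ σ :: R') (hσ : (L ++ σ :: R).count σ = 1) : L = L' ∧ R = R' := by
  have hL : σ ∉ L := fun hm => by
    have := List.count_pos_iff.2 hm
    simp only [List.count_append, List.count_cons_self] at hσ
    omega
  have hR : σ ∉ R := fun hm => by
    have := List.count_pos_iff.2 hm
    simp only [List.count_append, List.count_cons_self] at hσ
    omega
  obtain ⟨hLL', -, hRR'⟩ := (List.append_cons_inj_of_notMem hL hR).1 h
  exact ⟨hLL', hRR'⟩

theorem OnSides.liesAt {L R : List α} {σ p : α} {r : Position} (h : OnSides L R p r)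
    (hσ : (L ++ σ :: R).count σ = 1) : LiesAt (L ++ σ :: R) σ p r := by
  intro L' R' hsplit
  obtain ⟨rfl, rfl⟩ := eq_of_append_cons_eq hsplit hσ
  exact h

theorem LiesAt.of_pairProj {v W : List α} {σ p : α} {r : Position} (h : pairProj σ p v = W)
    (hW : LiesAt W σ p r) : LiesAt v σ p r := by
  rintro L R rfl
  refine onSides_pairProj_iff.1 (hW (pairProj σ p L) (pairProj σ p R) ?_)
  rw [← h, pairProj_append, pairProj_cons, if_pos (Or.inl rfl)]

theorem LiesAt.pairProj {v : List α} {σ p : α} {r : Position} (h : LiesAt v σ p r)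
    (hσ : v.count σ = 1) : LiesAt (pairProj σ p v) σ p r := by
  obtain ⟨L, R, rfl⟩ := List.append_of_mem (List.count_pos_iff.1 (by omega : 0 < v.count σ))
  have hproj : MonVar.pairProj σ p (L ++ σ :: R) =
      MonVar.pairProj σ p L ++ σ :: MonVar.pairProj σ p R := by
    rw [pairProj_append, pairProj_cons, if_pos (Or.inl rfl)]
  rw [← count_pairProj_left σ p, hproj] at hσ
  rw [hproj]
  exact (onSides_pairProj_iff.2 (h L R rfl)).liesAt hσ

theorem LiesAt.map {f : α → β} (hf : Function.Injective f) {v : List α} {σ p : α}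
    {r : Position} (h : LiesAt v σ p r) : LiesAt (v.map f) (f σ) (f p) r := by
  intro L R hsplit
  obtain ⟨L, R, rfl, rfl, hR⟩ := List.map_eq_append_iff.1 hsplit
  obtain ⟨τ, R, rfl, hτ, rfl⟩ := List.map_eq_cons_iff.1 hR
  obtain rfl := hf hτ
  exact (onSides_map_iff hf).2 (h L R rfl)

theorem liesAt_straddle_of_pairProj {v : List α} {σ p : α} (hne : p ≠ σ)
    (h : pairProj p σ v = [p, σ, p]) : LiesAt v σ p .straddle := by
  rw [pairProj_comm] at h
  refine .of_pairProj h (OnSides.liesAt (L := [p]) (R := [p]) ?_ ?_)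
  · simp [OnSides]
  · simp [hne]

theorem liesAt_before_of_pairProj {v : List α} {σ p : α} (hne : p ≠ σ)
    (h : pairProj p σ v = [p, p, σ]) : LiesAt v σ p .before := by
  rw [pairProj_comm] at h
  refine .of_pairProj h (OnSides.liesAt (L := [p, p]) (R := []) ?_ ?_)
  · simp [OnSides]
  · simp [hne]

theorem liesAt_after_of_pairProj {v : List α} {σ p : α} (hne : p ≠ σ)
    (h : pairProj p σ v = [σ, p, p]) : LiesAt v σ p .after := by
  rw [pairProj_comm] at h
  refine .of_pairProj h (OnSides.liesAt (L := []) (R := [p, p]) ?_ ?_)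
  · simp [OnSides]
  · simp [hne]

theorem LiesAt.pairProj_eq_of_straddle {v : List α} {σ p : α}
    (hσ : v.count σ = 1) (h : LiesAt v σ p .straddle) : MonVar.pairProj p σ v = [p, σ, p] := by
  obtain ⟨L, R, rfl⟩ := List.append_of_mem (List.count_pos_iff.1 (by omega : 0 < v.count σ))
  obtain ⟨hL, hR⟩ := h L R rfl
  simp only [List.count_append, List.count_cons_self] at hσ
  have hσL : σ ∉ L := List.count_eq_zero.1 (by omega)
  have hσR : σ ∉ R := List.count_eq_zero.1 (by omega)
  rw [pairProj_append, pairProj_cons, if_pos (Or.inr rfl), pairProj_eq_replicate_left hσL,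
    pairProj_eq_replicate_left hσR, hL, hR]
  rfl

end Positions

section Linked

variable {α : Type*}

/-- Two letters are linked if both occur in each of two disjoint factors without letters from
`S`. -/
def Linked (S : α → Prop) (v : List α) (p q : α) : Prop :=
  ∃ v₀ A v₁ B v₂, v = v₀ ++ (A ++ (v₁ ++ (B ++ v₂))) ∧ (p ∈ A ∧ q ∈ A ∧ p ∈ B ∧ q ∈ B) ∧
    (∀ g ∈ A, ¬ S g) ∧ ∀ g ∈ B, ¬ S g

theorem Linked.symm {S : α → Prop} {v : List α} {p q : α} (h : Linked S v p q) :
    Linked S v q p := by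
  obtain ⟨v₀, A, v₁, B, v₂, e, ⟨hpA, hqA, hpB, hqB⟩, hS⟩ := h
  exact ⟨v₀, A, v₁, B, v₂, e, ⟨hqA, hpA, hqB, hpB⟩, hS⟩

theorem Linked.mem_left {S : α → Prop} {v : List α} {p q : α} (h : Linked S v p q) : p ∈ v := by
  obtain ⟨v₀, A, v₁, B, v₂, rfl, ⟨hp, -, -, -⟩, -, -⟩ := h
  simp [hp]

variable [DecidableEq α]

theorem two_le_count_append {L R : List α} {p : α} (hL : p ∈ L) (hR : p ∈ R) :
    2 ≤ (L ++ R).count p := by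
  have := List.count_pos_iff.2 hL
  have := List.count_pos_iff.2 hR
  rw [List.count_append]
  omega

theorem OnSides.eq_after {L R : List α} {p : α} {r : Position} (h : OnSides L R p r)
    (hR : 2 ≤ R.count p) : r = .after := by
  cases r with
  | after => rfl
  | straddle => exact absurd h.2 (by omega)
  | before => exact absurd (List.count_pos_iff.1 (by omega)) h

theorem OnSides.eq_before {L R : List α} {p : α} {r : Position} (h : OnSides L R p r)
    (hL : 2 ≤ L.count p) : r = .before := by
  cases r with
  | after => exact absurd (List.count_pos_iff.1 (by omega)) h
  | straddle => exact absurd h.1 (by omega)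
  | before => rfl

theorem OnSides.eq_straddle {L R : List α} {p : α} {r : Position} (h : OnSides L R p r)
    (hL : p ∈ L) (hR : p ∈ R) : r = .straddle := by
  cases r with
  | after => exact absurd hL h
  | straddle => rfl
  | before => exact absurd hR h

theorem Linked.position_eq {S : α → Prop} {v : List α} {p q σ : α} (h : Linked S v p q)
    (hS : S σ) (hσ : σ ∈ v) {r r' : Position} (hp : LiesAt v σ p r) (hq : LiesAt v σ q r') :
    r = r' := by
  obtain ⟨v₀, A, v₁, B, v₂, rfl, ⟨hpA, hqA, hpB, hqB⟩, hA, hB⟩ := h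
  simp only [List.mem_append] at hσ
  rcases hσ with hσ | hσ | hσ | hσ | hσ
  · obtain ⟨L, R, rfl⟩ := List.append_of_mem hσ
    have hsplit : L ++ σ :: R ++ (A ++ (v₁ ++ (B ++ v₂))) =
        L ++ σ :: ((R ++ A) ++ (v₁ ++ B ++ v₂)) := by simp
    rw [(hp _ _ hsplit).eq_after (two_le_count_append (by simp [hpA]) (by simp [hpB])),
      (hq _ _ hsplit).eq_after (two_le_count_append (by simp [hqA]) (by simp [hqB]))]
  · exact absurd hS (hA _ hσ)
  · obtain ⟨L, R, rfl⟩ := List.append_of_mem hσ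
    have hsplit : v₀ ++ (A ++ (L ++ σ :: R ++ (B ++ v₂))) =
        (v₀ ++ A ++ L) ++ σ :: (R ++ (B ++ v₂)) := by simp
    rw [(hp _ _ hsplit).eq_straddle (by simp [hpA]) (by simp [hpB]),
      (hq _ _ hsplit).eq_straddle (by simp [hqA]) (by simp [hqB])]
  · exact absurd hS (hB _ hσ)
  · obtain ⟨L, R, rfl⟩ := List.append_of_mem hσ
    have hsplit : v₀ ++ (A ++ (v₁ ++ (B ++ (L ++ σ :: R)))) =
        ((v₀ ++ A) ++ (v₁ ++ B ++ L)) ++ σ :: R := by simp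
    rw [(hp _ _ hsplit).eq_before (two_le_count_append (by simp [hpA]) (by simp [hpB])),
      (hq _ _ hsplit).eq_before (two_le_count_append (by simp [hqA]) (by simp [hqB]))]

theorem not_linked_of_pairProj {S : α → Prop} {v : List α} {p q : α} (hpq : p ≠ q) {a b : ℕ}
    (h : pairProj p q v = List.replicate a p ++ List.replicate b q) : ¬ Linked S v p q := by
  rintro ⟨v₀, A, v₁, B, v₂, rfl, ⟨-, hqA, hpB, -⟩, -, -⟩
  have hsplit : pairProj p q (v₀ ++ A) ++ pairProj p q (v₁ ++ (B ++ v₂)) =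
      List.replicate a p ++ List.replicate b q := by
    rw [← h, ← pairProj_append, List.append_assoc]
  have hq : q ∈ pairProj p q (v₀ ++ A) := mem_pairProj.2 ⟨by simp [hqA], Or.inr rfl⟩
  have hp : p ∈ pairProj p q (v₁ ++ (B ++ v₂)) := mem_pairProj.2 ⟨by simp [hpB], Or.inl rfl⟩
  rcases List.append_eq_append_iff.1 hsplit with ⟨w, hw, -⟩ | ⟨w, -, hw⟩
  · exact hpq (List.eq_of_mem_replicate (n := a) (by rw [hw]; simp [hq])).symm
  · exact hpq (List.eq_of_mem_replicate (n := b) (by rw [hw]; simp [hp]))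

theorem liesAt_before_of_pairProj_eq_append {v W : List α} {σ p q : α} (hσ : σ ≠ q) (hpq : p ≠ q)
    (h : pairProj q p v = W ++ [q]) (hq : LiesAt v σ q .before) : LiesAt v σ p .before := by
  rintro L R rfl hp
  have hqR : q ∉ σ :: R := by
    simp only [List.mem_cons, not_or]
    exact ⟨hσ.symm, hq L R rfl⟩
  obtain ⟨k, hk⟩ := Nat.exists_eq_succ_of_ne_zero
    (List.count_pos_iff.2 (List.mem_cons_of_mem σ hp)).ne'
  rw [pairProj_append, pairProj_eq_replicate_right hqR, hk, List.replicate_succ',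
    ← List.append_assoc] at h
  exact hpq (List.singleton_inj.1 (List.append_inj_right' h rfl))

/-- Some letter from `S` that occurs in `v` tells `p` and `q` apart by their positions. -/
def IsSeparated (S : α → Prop) (v : List α) (p q : α) : Prop :=
  ∃ σ r r', S σ ∧ σ ∈ v ∧ LiesAt v σ p r ∧ LiesAt v σ q r' ∧ r ≠ r'

theorem IsSeparated.symm {S : α → Prop} {v : List α} {p q : α} (h : IsSeparated S v p q) :
    IsSeparated S v q p := by
  obtain ⟨σ, r, r', hS, hσ, hp, hq, hr⟩ := h
  exact ⟨σ, r', r, hS, hσ, hq, hp, hr.symm⟩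

theorem IsSeparated.not_linked {S : α → Prop} {v : List α} {p q : α} (h : IsSeparated S v p q) :
    ¬ Linked S v p q := by
  obtain ⟨σ, r, r', hS, hσ, hp, hq, hr⟩ := h
  exact fun hl => hr (hl.position_eq hS hσ hp hq)

end Linked

section Expand

variable {α : Type*}

/-- The list in which each letter is replaced by its power with the given exponent. -/
def expand (e : α → ℕ) (L : List α) : List α := L.flatMap fun l => List.replicate (e l) l

@[simp] theorem expand_nil (e : α → ℕ) : expand e [] = [] := rfl

theorem expand_cons (e : α → ℕ) (a : α) (L : List α) :
    expand e (a :: L) = List.replicate (e a) a ++ expand e L := rfl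

theorem expand_append (e : α → ℕ) (L R : List α) :
    expand e (L ++ R) = expand e L ++ expand e R := List.flatMap_append

theorem mem_of_mem_expand {e : α → ℕ} {l : α} {L : List α} (h : l ∈ expand e L) : l ∈ L := by
  obtain ⟨a, ha, hl⟩ := List.mem_flatMap.1 h
  rwa [List.eq_of_mem_replicate hl]

theorem expand_congr {e e' : α → ℕ} {L : List α} (h : ∀ a ∈ L, e a = e' a) :
    expand e L = expand e' L :=
  List.flatMap_congr fun a ha => by rw [h a ha]

theorem expand_eq_self {e : α → ℕ} {L : List α} (h : ∀ a ∈ L, e a = 1) : expand e L = L :=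
  (expand_congr h).trans (List.flatMap_singleton' L)

theorem count_expand [DecidableEq α] (e : α → ℕ) (a : α) (L : List α) :
    (expand e L).count a = e a * L.count a := by
  induction L with
  | nil => simp
  | cons b L ih =>
    rw [expand_cons, List.count_append, ih, List.count_replicate, List.count_cons]
    by_cases h : b = a
    · subst h
      simp only [beq_self_eq_true, if_true]
      ring
    · simp [h]

end Expand

section Islands

theorem foldr_glue_replicate_succ (k : ℕ) (a : Letter) (m : List Letter) :
    (List.replicate (k + 1) a).foldr glue m = glue a m := by
  induction k with
  | zero => rfl
  | succ k ih => rw [List.replicate_succ, List.foldr_cons, ih, glue_glue]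

theorem foldr_glue_expand (e : Letter → ℕ) (he : ∀ a, 1 ≤ e a) (L : List Letter) :
    (expand e L).foldr glue [] = L.foldr glue [] := by
  induction L with
  | nil => rfl
  | cons a L ih =>
    obtain ⟨k, hk⟩ := Nat.exists_eq_add_of_le' (he a)
    rw [expand_cons, List.foldr_append, ih, hk, foldr_glue_replicate_succ, List.foldr_cons]

theorem count_foldr_glue_le (v : List Letter) (a : Letter) :
    (v.foldr glue []).count a ≤ v.count a := by
  rw [← destutter_eq_foldr]
  exact (List.destutter_sublist _ v).count_le a

theorem mem_foldr_glue (v : List Letter) (a : Letter) : a ∈ v.foldr glue [] ↔ a ∈ v := by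
  simpa only [islands, destutter_eq_foldr, FreeMonoid.toList_ofList] using
    mem_islands_iff (FreeMonoid.ofList v) a

theorem exists_eq_replicate_append_of_foldr_glue_eq_cons {v L : List Letter} {b : Letter}
    (h : v.foldr glue [] = b :: L) :
    ∃ j v', v = List.replicate (j + 1) b ++ v' ∧ v'.foldr glue [] = L := by
  induction v with
  | nil => simp at h
  | cons c v ih =>
    rw [List.foldr_cons, glue] at h
    split_ifs at h with hc
    · obtain ⟨j, v', rfl, hv'⟩ := ih h
      obtain rfl : b = c := by simpa only [h, List.head?_cons, Option.some.injEq] using hc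
      exact ⟨j + 1, v', rfl, hv'⟩
    · obtain ⟨rfl, hL⟩ := List.cons.inj h
      exact ⟨0, v, rfl, hL⟩

theorem eq_expand_of_foldr_glue_eq {L : List Letter} {e : Letter → ℕ} : ∀ {v : List Letter},
    v.foldr glue [] = L →
    (∀ a ∈ v, (e a = 1 ∧ v.count a = L.count a) ∨ (e a = v.count a ∧ L.count a = 1)) →
    v = expand e L := by
  induction L with
  | nil =>
    intro v hv _
    refine List.eq_nil_iff_forall_not_mem.2 fun a ha => ?_
    simp [← mem_foldr_glue, hv] at ha
  | cons b L ih =>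
    intro v hv h
    obtain ⟨j, v', rfl, hv'⟩ := exists_eq_replicate_append_of_foldr_glue_eq_cons hv
    have hle := count_foldr_glue_le v' b
    rw [hv'] at hle
    have hb := h b (by simp)
    simp only [List.count_append, List.count_replicate_self, List.count_cons_self] at hb
    have hmem : b ∈ v' → b ∈ L := fun hm => by rwa [← hv', mem_foldr_glue]
    have hcount : L.count b = 0 → v'.count b = 0 := by
      simp only [List.count_eq_zero]
      exact mt hmem
    have hexp : e b = j + 1 := by omega
    rw [expand_cons, hexp, ← ih hv' fun a ha => ?_]
    by_cases hab : a = b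
    · subst hab
      have := List.count_pos_iff.2 ha
      exact Or.inl ⟨by omega, by omega⟩
    · simpa [List.count_append, List.count_replicate, List.count_cons, Ne.symm hab] using
        h a (by simp [ha])

end Islands

section Interleave

variable {α : Type*} {f g : ℕ → α}

/-- The list `f a, g a, f (a + 1), g (a + 1), …, f (a + k - 1), g (a + k - 1)`. -/
def interleave (f g : ℕ → α) (a k : ℕ) : List α :=
  (List.range' a k).flatMap fun i => [f i, g i]

theorem interleave_succ (f g : ℕ → α) (a k : ℕ) :
    interleave f g a (k + 1) = f a :: g a :: interleave f g (a + 1) k := by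
  simp [interleave, List.range'_succ]

theorem interleave_add (f g : ℕ → α) (a j k : ℕ) :
    interleave f g a (j + k) = interleave f g a j ++ interleave f g (a + j) k := by
  rw [interleave, ← List.range'_append_1, List.flatMap_append]
  rfl

theorem mem_interleave {a k : ℕ} {l : α} :
    l ∈ interleave f g a k ↔ ∃ i, (a ≤ i ∧ i < a + k) ∧ (l = f i ∨ l = g i) := by
  simp [interleave, List.mem_flatMap, List.mem_range'_1]

theorem nodup_interleave (hf : Function.Injective f) (hg : Function.Injective g)
    (hfg : ∀ i j, f i ≠ g j) (a k : ℕ) : (interleave f g a k).Nodup := by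
  refine List.nodup_flatMap.2 ⟨fun i _ => by simp [hfg], ?_⟩
  refine List.Nodup.pairwise_of_forall_ne List.nodup_range' fun i _ j _ hij => ?_
  simp [hfg, Ne.symm, hf.ne hij.symm, hg.ne hij.symm]

end Interleave

section Shape

/-- `z'_a t'_a ⋯ z'_{a+k-1} t'_{a+k-1}`. -/
def primedBlock (a k : ℕ) : List Letter := interleave zp tp a k

/-- `t_0 z_0 ⋯ t_{k-1} z_{k-1}`. -/
def tailWord (k : ℕ) : List Letter := interleave ts zs 0 k

/-- The letters that occur once in the words. -/
def isSimple : Letter → Bool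
  | t => true
  | ts _ => true
  | tp _ => true
  | _ => false

/-- The letters that occur in the words as squares. -/
def isSquared : Letter → Bool
  | ys _ => true
  | _ => false

/-- The exponents that the letters may have in the words `γ'`-equivalent to the given one. -/
structure IsAdmissible (e : Letter → ℕ) : Prop where
  two_le : ∀ i, 2 ≤ e (ys i)
  eq_one : ∀ l, isSquared l = false → e l = 1

/-- The possible parts of the words between the second occurrence of `x` and that of `y`, with
each square `y_i ^ 2` replaced by the letter `y_i`. -/
structure IsCore (n m : ℕ) (C : List Letter) : Prop where
  pos : 1 ≤ n
  nodup : C.Nodup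
  zs_mem : ∀ j, zs j ∈ C ↔ j < m
  zp_mem : ∀ i, zp i ∈ C ↔ i < 2 * n
  x_notMem : x ∉ C
  y_notMem : y ∉ C
  isSimple_notMem : ∀ l, isSimple l = true → l ∉ C
  head : ∃ j C', C = zs j :: C'
  last : ∃ j C', C = C' ++ [zs j]

/-- The word with the given core, and with the factor `X` in place of the first `xy`. -/
def shape (n m : ℕ) (C X : List Letter) : List Letter :=
  primedBlock 0 n ++ (X ++ (t :: (primedBlock n n ++ (x :: (C ++ (y :: tailWord m))))))

theorem mem_primedBlock {a k : ℕ} {l : Letter} :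
    l ∈ primedBlock a k ↔ ∃ i, (a ≤ i ∧ i < a + k) ∧ (l = zp i ∨ l = tp i) := mem_interleave

theorem mem_tailWord {k : ℕ} {l : Letter} :
    l ∈ tailWord k ↔ ∃ i < k, l = ts i ∨ l = zs i := by
  simp [tailWord, mem_interleave]

theorem zp_mem_primedBlock {a k i : ℕ} : zp i ∈ primedBlock a k ↔ a ≤ i ∧ i < a + k := by
  simp [mem_primedBlock]

theorem tp_mem_primedBlock {a k i : ℕ} : tp i ∈ primedBlock a k ↔ a ≤ i ∧ i < a + k := by
  simp [mem_primedBlock]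

theorem zs_mem_tailWord {k i : ℕ} : zs i ∈ tailWord k ↔ i < k := by simp [mem_tailWord]

theorem ts_mem_tailWord {k i : ℕ} : ts i ∈ tailWord k ↔ i < k := by simp [mem_tailWord]

section NotMem

variable {a k i : ℕ}

@[simp] theorem x_notMem_primedBlock : x ∉ primedBlock a k := by simp [mem_primedBlock]
@[simp] theorem y_notMem_primedBlock : y ∉ primedBlock a k := by simp [mem_primedBlock]
@[simp] theorem t_notMem_primedBlock : t ∉ primedBlock a k := by simp [mem_primedBlock]
@[simp] theorem zs_notMem_primedBlock : zs i ∉ primedBlock a k := by simp [mem_primedBlock]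
@[simp] theorem ts_notMem_primedBlock : ts i ∉ primedBlock a k := by simp [mem_primedBlock]
@[simp] theorem ys_notMem_primedBlock : ys i ∉ primedBlock a k := by simp [mem_primedBlock]
@[simp] theorem x_notMem_tailWord : x ∉ tailWord k := by simp [mem_tailWord]
@[simp] theorem y_notMem_tailWord : y ∉ tailWord k := by simp [mem_tailWord]
@[simp] theorem t_notMem_tailWord : t ∉ tailWord k := by simp [mem_tailWord]
@[simp] theorem zp_notMem_tailWord : zp i ∉ tailWord k := by simp [mem_tailWord]
@[simp] theorem tp_notMem_tailWord : tp i ∉ tailWord k := by simp [mem_tailWord]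
@[simp] theorem ys_notMem_tailWord : ys i ∉ tailWord k := by simp [mem_tailWord]

end NotMem

theorem nodup_primedBlock (a k : ℕ) : (primedBlock a k).Nodup :=
  nodup_interleave (fun _ _ => zp.inj) (fun _ _ => tp.inj) (by simp) a k

theorem nodup_tailWord (k : ℕ) : (tailWord k).Nodup :=
  nodup_interleave (fun _ _ => ts.inj) (fun _ _ => zs.inj) (by simp) 0 k

theorem count_primedBlock (a k : ℕ) (l : Letter) :
    (primedBlock a k).count l = if l ∈ primedBlock a k then 1 else 0 :=
  (nodup_primedBlock a k).count

theorem count_tailWord (k : ℕ) (l : Letter) :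
    (tailWord k).count l = if l ∈ tailWord k then 1 else 0 := (nodup_tailWord k).count

theorem exists_primedBlock_eq {a i k : ℕ} (hi : i < k) : ∃ R,
    primedBlock a k = primedBlock a i ++ zp (a + i) :: tp (a + i) :: R := by
  obtain ⟨j, rfl⟩ := Nat.exists_eq_add_of_lt hi
  exact ⟨_, by rw [primedBlock, add_assoc, interleave_add, interleave_succ]; rfl⟩

theorem exists_tailWord_eq {j m : ℕ} (hj : j < m) : ∃ R,
    tailWord m = tailWord j ++ ts j :: zs j :: R := by
  obtain ⟨k, rfl⟩ := Nat.exists_eq_add_of_lt hj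
  refine ⟨interleave ts zs (j + 1) k, ?_⟩
  rw [tailWord, add_assoc, interleave_add, interleave_succ, zero_add]
  rfl

theorem isSquared_eq_false_of_isSimple {l : Letter} (hl : isSimple l = true) :
    isSquared l = false := by
  cases l <;> first | rfl | cases hl

theorem exists_eq_ys_of_isSquared {l : Letter} (hl : isSquared l ≠ false) : ∃ i, l = ys i := by
  cases l <;> first | exact ⟨_, rfl⟩ | exact absurd rfl hl

end Shape

namespace IsAdmissible

variable {e : Letter → ℕ} (he : IsAdmissible e)
include he

theorem one_le (l : Letter) : 1 ≤ e l := by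
  by_cases hl : isSquared l = false
  · exact (he.eq_one l hl).ge
  · obtain ⟨i, rfl⟩ := exists_eq_ys_of_isSquared hl
    exact one_le_two.trans (he.two_le i)

theorem expand_primedBlock (a k : ℕ) : expand e (primedBlock a k) = primedBlock a k :=
  expand_eq_self fun l hl => by
    obtain ⟨i, -, rfl | rfl⟩ := mem_primedBlock.1 hl <;> exact he.eq_one _ rfl

theorem expand_tailWord (k : ℕ) : expand e (tailWord k) = tailWord k :=
  expand_eq_self fun l hl => by
    obtain ⟨i, -, rfl | rfl⟩ := mem_tailWord.1 hl <;> exact he.eq_one _ rfl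

theorem expand_shape {n m : ℕ} {C X : List Letter} (hX : ∀ l ∈ X, isSquared l = false) :
    expand e (shape n m C X) = shape n m (expand e C) X := by
  have hXe : expand e X = X := expand_eq_self fun l hl => he.eq_one _ (hX l hl)
  simp [shape, expand_append, expand_cons, he.expand_primedBlock, he.expand_tailWord, hXe,
    he.eq_one t rfl, he.eq_one x rfl, he.eq_one y rfl]

theorem expand_shape_xy {n m : ℕ} {C : List Letter} :
    expand e (shape n m C [x, y]) = shape n m (expand e C) [x, y] :=
  he.expand_shape (by simp [isSquared])

end IsAdmissible

namespace IsCore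

variable {n m : ℕ} {C : List Letter} (hC : IsCore n m C)
include hC

theorem m_pos : 0 < m := by
  obtain ⟨j, C', rfl⟩ := hC.head
  exact Nat.zero_lt_of_lt ((hC.zs_mem j).1 (by simp))

theorem count (l : Letter) : C.count l = if l ∈ C then 1 else 0 := hC.nodup.count

theorem count_shape (l : Letter) : (shape n m C [x, y]).count l =
    match l with
    | x => 2
    | y => 2
    | t => 1
    | zs j => if j < m then 2 else 0
    | zp i => if i < 2 * n then 2 else 0
    | ts j => if j < m then 1 else 0
    | tp i => if i < 2 * n then 1 else 0
    | ys i => if ys i ∈ C then 1 else 0 := by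
  have hx := hC.x_notMem
  have hy := hC.y_notMem
  have ht : t ∉ C := hC.isSimple_notMem _ rfl
  have hts : ∀ i, ts i ∉ C := fun i => hC.isSimple_notMem _ rfl
  have htp : ∀ i, tp i ∉ C := fun i => hC.isSimple_notMem _ rfl
  cases l <;>
    simp [shape, count_primedBlock, count_tailWord, hC.count, hx, hy, ht, hts, htp,
      zp_mem_primedBlock, tp_mem_primedBlock, zs_mem_tailWord, ts_mem_tailWord, hC.zs_mem,
      hC.zp_mem]
  all_goals split_ifs <;> omega

theorem count_shape_of_isSimple {σ : Letter} (hσ : isSimple σ = true)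
    (hmem : σ ∈ shape n m C [x, y]) : (shape n m C [x, y]).count σ = 1 := by
  have hpos := List.count_pos_iff.2 hmem
  rw [hC.count_shape] at hpos ⊢
  cases σ <;> simp_all [isSimple, Nat.pos_iff_ne_zero]

/-- Adjacent letters are compared within three duplicate-free factors, which overlap in `y` and
in `x`, and which are followed by `t` and by the first letter of the tail. -/
theorem isChain_shape : (shape n m C [x, y]).IsChain (· ≠ ·) := by
  obtain ⟨j, C', rfl⟩ := hC.head
  obtain ⟨R, hR⟩ := exists_tailWord_eq hC.m_pos
  have hR' : tailWord m = ts 0 :: zs 0 :: R := hR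
  have hnodup := hC.nodup
  have hy := hC.y_notMem
  have hshape : shape n m (zs j :: C') [x, y] =
      (primedBlock 0 n ++ [x]) ++ y :: t :: (primedBlock n n ++ x :: zs j ::
        (C' ++ y :: ts 0 :: zs 0 :: R)) := by
    simp [shape, hR']
  have htail := nodup_tailWord m
  rw [hR'] at htail
  have hfirst : (primedBlock 0 n ++ [x] ++ [y]).Nodup := by
    simp [List.nodup_middle, nodup_primedBlock]
  have hsecond : (t :: primedBlock n n ++ [x]).Nodup := by
    simp [List.nodup_middle, nodup_primedBlock]
  have hthird : (zs j :: C' ++ [y]).Nodup :=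
    hnodup.append (List.nodup_singleton y) (by simpa using hy)
  rw [hshape, List.isChain_append_cons_cons, ← List.cons_append, List.isChain_append_cons_cons,
    ← List.cons_append, List.isChain_append_cons_cons]
  exact ⟨hfirst.isChain, by simp, hsecond.isChain, by simp, hthird.isChain, by simp,
    htail.isChain⟩

theorem foldr_glue_shape : (shape n m C [x, y]).foldr glue [] = shape n m C [x, y] := by
  rw [← destutter_eq_foldr]
  exact List.destutter_of_isChain _ _ hC.isChain_shape

theorem foldr_glue_expand_shape {e : Letter → ℕ} (he : IsAdmissible e) :
    (expand e (shape n m C [x, y])).foldr glue [] = shape n m C [x, y] := by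
  rw [foldr_glue_expand e he.one_le, hC.foldr_glue_shape]

section LiesAt

variable {e : Letter → ℕ} (he : IsAdmissible e)
include he

theorem count_expand_of_isSimple {σ : Letter} (hσ : isSimple σ = true)
    (hmem : σ ∈ shape n m C [x, y]) : (expand e (shape n m C [x, y])).count σ = 1 := by
  rw [count_expand, he.eq_one σ (isSquared_eq_false_of_isSimple hσ), one_mul,
    hC.count_shape_of_isSimple hσ hmem]

theorem liesAt_expand {L R : List Letter} {σ p : Letter} {r : Position}
    (hs : shape n m C [x, y] = L ++ σ :: R) (hσ : isSimple σ = true)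
    (h : OnSides (expand e L) (expand e R) p r) :
    LiesAt (expand e (shape n m C [x, y])) σ p r := by
  have hcount := hC.count_expand_of_isSimple he hσ (by simp [hs])
  have hexpand : expand e (shape n m C [x, y]) = expand e L ++ σ :: expand e R := by
    rw [hs, expand_append, expand_cons, he.eq_one σ (isSquared_eq_false_of_isSimple hσ),
      List.replicate_one, List.singleton_append]
  rw [hexpand] at hcount ⊢
  exact h.liesAt hcount

theorem liesAt_after_of_notMem {L R : List Letter} {σ p : Letter}
    (hs : shape n m C [x, y] = L ++ σ :: R) (hσ : isSimple σ = true) (hp : p ∉ L) :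
    LiesAt (expand e (shape n m C [x, y])) σ p .after :=
  hC.liesAt_expand he hs hσ fun h => hp (mem_of_mem_expand h)

theorem liesAt_before_of_notMem {L R : List Letter} {σ p : Letter}
    (hs : shape n m C [x, y] = L ++ σ :: R) (hσ : isSimple σ = true) (hp : p ∉ R) :
    LiesAt (expand e (shape n m C [x, y])) σ p .before :=
  hC.liesAt_expand he hs hσ fun h => hp (mem_of_mem_expand h)

theorem liesAt_straddle_of_count {L R : List Letter} {σ p : Letter}
    (hs : shape n m C [x, y] = L ++ σ :: R) (hσ : isSimple σ = true) (hp : isSquared p = false)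
    (hne : p ≠ σ) (hL : L.count p = 1) (htwo : (shape n m C [x, y]).count p = 2) :
    LiesAt (expand e (shape n m C [x, y])) σ p .straddle := by
  rw [hs, List.count_append, List.count_cons_of_ne hne.symm, hL] at htwo
  refine hC.liesAt_expand he hs hσ ⟨?_, ?_⟩ <;> rw [count_expand, he.eq_one p hp] <;> omega

omit hC he in
theorem exists_shape_eq_append_ts {j : ℕ} (hj : j < m) : ∃ R, shape n m C [x, y] =
    (primedBlock 0 n ++ ([x, y] ++ (t :: (primedBlock n n ++ (x :: (C ++ (y :: tailWord j))))))) ++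
      ts j :: zs j :: R ∧ tailWord m = tailWord j ++ ts j :: zs j :: R := by
  obtain ⟨R, hR⟩ := exists_tailWord_eq hj
  exact ⟨R, by simp [shape, hR], hR⟩

theorem liesAt_ts_before {j : ℕ} (hj : j < m) {p : Letter} (hp : isSimple p = false)
    (hz : ∀ i, p ≠ zs i) : LiesAt (expand e (shape n m C [x, y])) (ts j) p .before := by
  obtain ⟨R, hR, htail⟩ := exists_shape_eq_append_ts (n := n) (C := C) hj
  have hpm : p ∉ tailWord m := fun h => by
    obtain ⟨i, -, rfl | rfl⟩ := mem_tailWord.1 h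
    · cases hp
    · exact hz i rfl
  exact hC.liesAt_before_of_notMem he hR rfl fun h => hpm (by simp [htail, List.mem_cons.1 h])

theorem liesAt_ts_zs {i j : ℕ} (hj : j < m) (hi : i < m) :
    LiesAt (expand e (shape n m C [x, y])) (ts j) (zs i)
      (if i < j then .before else .straddle) := by
  obtain ⟨R, hR, htail⟩ := exists_shape_eq_append_ts (n := n) (C := C) hj
  split_ifs with hij
  · refine hC.liesAt_before_of_notMem he hR rfl fun h => ?_
    have hnodup := nodup_tailWord m
    rw [htail, List.nodup_append] at hnodup
    exact hnodup.2.2 _ (zs_mem_tailWord.2 hij) _ (List.mem_cons_of_mem _ h) rfl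
  · refine hC.liesAt_straddle_of_count he hR rfl rfl (by simp) ?_ (by simp [hC.count_shape, hi])
    simp [count_tailWord, count_primedBlock, zs_mem_tailWord, hij, hC.count, hC.zs_mem, hi]

omit hC he in
theorem shape_eq_append_t : shape n m C [x, y] = (primedBlock 0 n ++ [x, y]) ++ t ::
    (primedBlock n n ++ (x :: (C ++ (y :: tailWord m)))) := by
  simp [shape]

theorem liesAt_t_straddle {p : Letter} (hp : p = x ∨ p = y ∨ ∃ i < n, p = zp i) :
    LiesAt (expand e (shape n m C [x, y])) t p .straddle := by
  obtain rfl | rfl | ⟨i, hi, rfl⟩ := hp <;>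
    refine hC.liesAt_straddle_of_count he shape_eq_append_t rfl rfl (by simp) ?_ ?_
  · simp [count_primedBlock]
  · simp [hC.count_shape]
  · simp [count_primedBlock]
  · simp [hC.count_shape]
  · simp [count_primedBlock, zp_mem_primedBlock, hi]
  · simp only [hC.count_shape, if_pos (show i < 2 * n by omega)]

theorem liesAt_t_after {p : Letter} (hp : isSimple p = false) (hx : p ≠ x) (hy : p ≠ y)
    (hz : ∀ i < n, p ≠ zp i) : LiesAt (expand e (shape n m C [x, y])) t p .after := by
  refine hC.liesAt_after_of_notMem he shape_eq_append_t rfl fun h => ?_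
  simp only [List.mem_append, List.mem_cons, List.not_mem_nil, hx, hy, or_false] at h
  obtain ⟨i, hi, rfl | rfl⟩ := mem_primedBlock.1 h
  · exact hz i (by omega) rfl
  · cases hp

omit hC he in
theorem exists_shape_eq_append_tp {i : ℕ} (hi : i < 2 * n) : ∃ L R,
    shape n m C [x, y] = L ++ tp i :: R ∧ ∀ p, isSimple p = false →
      L.count p = match p with
        | zp j => if j ≤ i then 1 else 0
        | x => if n ≤ i then 1 else 0
        | y => if n ≤ i then 1 else 0
        | _ => 0 := by
  by_cases hin : i < n
  · obtain ⟨R, hR⟩ := exists_primedBlock_eq (a := 0) hin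
    rw [zero_add] at hR
    refine ⟨primedBlock 0 i ++ [zp i], R ++ ([x, y] ++ (t :: (primedBlock n n ++
      (x :: (C ++ (y :: tailWord m)))))), by simp [shape, hR], fun p hp => ?_⟩
    cases p with
    | zp j =>
      simp only [List.count_append, List.count_singleton, count_primedBlock, zp_mem_primedBlock,
        beq_iff_eq, zp.injEq]
      split_ifs <;> omega
    | _ => revert hp; simp [isSimple, count_primedBlock, Nat.not_le.2 hin]
  · obtain ⟨k, rfl⟩ := Nat.exists_eq_add_of_le (Nat.le_of_not_lt hin)
    obtain ⟨R, hR⟩ := exists_primedBlock_eq (a := n) (show k < n by omega)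
    refine ⟨primedBlock 0 n ++ ([x, y, t] ++ (primedBlock n k ++ [zp (n + k)])),
      R ++ (x :: (C ++ (y :: tailWord m))), by simp [shape, hR], fun p hp => ?_⟩
    cases p with
    | zp j =>
      simp only [List.count_append, List.count_cons, List.count_nil, count_primedBlock,
        zp_mem_primedBlock, beq_iff_eq, zp.injEq, reduceCtorEq, if_false]
      split_ifs <;> omega
    | _ => revert hp; simp [isSimple, count_primedBlock]

theorem liesAt_tp_last_straddle {p : Letter} (hp : p = x ∨ p = y ∨ ∃ i < 2 * n, p = zp i) :
    LiesAt (expand e (shape n m C [x, y])) (tp (2 * n - 1)) p .straddle := by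
  have hn := hC.pos
  obtain ⟨L, R, hs, hL⟩ := exists_shape_eq_append_tp (n := n) (m := m) (C := C)
    (show 2 * n - 1 < 2 * n by omega)
  obtain rfl | rfl | ⟨i, hi, rfl⟩ := hp <;>
    refine hC.liesAt_straddle_of_count he hs rfl rfl (by simp) ((hL _ rfl).trans ?_) ?_
  · exact if_pos (by omega)
  · simp only [hC.count_shape]
  · exact if_pos (by omega)
  · simp only [hC.count_shape]
  · exact if_pos (by omega)
  · simp only [hC.count_shape, if_pos hi]

theorem liesAt_tp_last_after {p : Letter} (hp : isSimple p = false) (hx : p ≠ x) (hy : p ≠ y)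
    (hz : ∀ i < 2 * n, p ≠ zp i) :
    LiesAt (expand e (shape n m C [x, y])) (tp (2 * n - 1)) p .after := by
  have hn := hC.pos
  obtain ⟨L, R, hs, hL⟩ := exists_shape_eq_append_tp (n := n) (m := m) (C := C)
    (show 2 * n - 1 < 2 * n by omega)
  refine hC.liesAt_after_of_notMem he hs rfl (List.count_eq_zero.1 ((hL p hp).trans ?_))
  cases p with
  | zp i => exact if_neg fun hi => hz i (by omega) rfl
  | x => exact absurd rfl hx
  | y => exact absurd rfl hy
  | _ => rfl

theorem liesAt_tp_zp_straddle {i : ℕ} (hi : i < 2 * n) :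
    LiesAt (expand e (shape n m C [x, y])) (tp i) (zp i) .straddle := by
  obtain ⟨L, R, hs, hL⟩ := exists_shape_eq_append_tp (m := m) (C := C) hi
  exact hC.liesAt_straddle_of_count he hs rfl rfl (by simp) ((hL _ rfl).trans (if_pos le_rfl))
    (by simp only [hC.count_shape, if_pos hi])

theorem liesAt_tp_zp_after {i j : ℕ} (hi : i < 2 * n) (hij : i < j) :
    LiesAt (expand e (shape n m C [x, y])) (tp i) (zp j) .after := by
  obtain ⟨L, R, hs, hL⟩ := exists_shape_eq_append_tp (m := m) (C := C) hi
  exact hC.liesAt_after_of_notMem he hs rfl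
    (List.count_eq_zero.1 ((hL _ rfl).trans (if_neg (Nat.not_le.2 hij))))

theorem liesAt_tp_after_of_lt {i : ℕ} (hi : i < n) {p : Letter} (hp : p = x ∨ p = y) :
    LiesAt (expand e (shape n m C [x, y])) (tp i) p .after := by
  obtain ⟨L, R, hs, hL⟩ := exists_shape_eq_append_tp (n := n) (m := m) (C := C)
    (show i < 2 * n by omega)
  refine hC.liesAt_after_of_notMem he hs rfl (List.count_eq_zero.1 ?_)
  obtain rfl | rfl := hp <;> exact (hL _ rfl).trans (if_neg (Nat.not_le.2 hi))

end LiesAt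

section Projection

variable {e : Letter → ℕ} (he : IsAdmissible e)
include he

theorem count_expand_core {l : Letter} (hl : l ∈ C) (h : isSquared l = false) :
    (expand e C).count l = 1 := by
  rw [count_expand, he.eq_one _ h, hC.count, if_pos hl]

omit he in
theorem x_notMem_expand : x ∉ expand e C := fun h => hC.x_notMem (mem_of_mem_expand h)

omit he in
theorem y_notMem_expand : y ∉ expand e C := fun h => hC.y_notMem (mem_of_mem_expand h)

theorem pairProj_x_zs {j : ℕ} (hj : j < m) :
    pairProj x (zs j) (expand e (shape n m C [x, y])) = [x, x, zs j, zs j] := by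
  rw [he.expand_shape_xy, shape]
  simp [pairProj_append, pairProj_cons, pairProj_eq_replicate_right, hC.x_notMem_expand,
    count_primedBlock, count_tailWord, hC.count_expand_core he ((hC.zs_mem j).2 hj) rfl,
    zs_mem_tailWord, hj]

theorem pairProj_y_zs {j : ℕ} (hj : j < m) :
    pairProj y (zs j) (expand e (shape n m C [x, y])) = [y, zs j, y, zs j] := by
  rw [he.expand_shape_xy, shape]
  simp [pairProj_append, pairProj_cons, pairProj_eq_replicate_right, hC.y_notMem_expand,
    count_primedBlock, count_tailWord, hC.count_expand_core he ((hC.zs_mem j).2 hj) rfl,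
    zs_mem_tailWord, hj]

theorem pairProj_x_y : pairProj x y (expand e (shape n m C [x, y])) = [x, y, x, y] := by
  rw [he.expand_shape_xy, shape]
  simp [pairProj_append, pairProj_cons, pairProj_eq_nil, hC.x_notMem_expand, hC.y_notMem_expand]

omit hC he in
theorem count_primedBlock_zp_eq_ite {i : ℕ} (hi : i < 2 * n) :
    (primedBlock 0 n).count (zp i) = (if i < n then 1 else 0) ∧
      (primedBlock n n).count (zp i) = (if i < n then 0 else 1) := by
  simp only [count_primedBlock, zp_mem_primedBlock]
  split_ifs <;> omega

theorem pairProj_x_zp {i : ℕ} (hi : i < 2 * n) :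
    pairProj x (zp i) (expand e (shape n m C [x, y])) =
      if i < n then [zp i, x, x, zp i] else [x, zp i, x, zp i] := by
  rw [he.expand_shape_xy, shape]
  obtain ⟨hfirst, hsecond⟩ := count_primedBlock_zp_eq_ite hi
  split_ifs at hfirst hsecond ⊢ <;>
    simp [pairProj_append, pairProj_cons, pairProj_eq_replicate_right, hC.x_notMem_expand, hfirst,
      hsecond, count_tailWord, hC.count_expand_core he ((hC.zp_mem i).2 hi) rfl]

theorem pairProj_y_zp {i : ℕ} (hi : i < 2 * n) :
    pairProj y (zp i) (expand e (shape n m C [x, y])) =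
      if i < n then [zp i, y, zp i, y] else [y, zp i, zp i, y] := by
  rw [he.expand_shape_xy, shape]
  obtain ⟨hfirst, hsecond⟩ := count_primedBlock_zp_eq_ite hi
  split_ifs at hfirst hsecond ⊢ <;>
    simp [pairProj_append, pairProj_cons, pairProj_eq_replicate_right, hC.y_notMem_expand, hfirst,
      hsecond, count_tailWord, hC.count_expand_core he ((hC.zp_mem i).2 hi) rfl]

theorem pairProj_ys_ys {i j : ℕ} (hij : i ≠ j) :
    ∃ a b, pairProj (ys i) (ys j) (expand e (shape n m C [x, y])) =
        List.replicate a (ys i) ++ List.replicate b (ys j) ∨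
      pairProj (ys i) (ys j) (expand e (shape n m C [x, y])) =
        List.replicate b (ys j) ++ List.replicate a (ys i) := by
  have hcore : pairProj (ys i) (ys j) (expand e (shape n m C [x, y])) =
      pairProj (ys i) (ys j) (expand e C) := by
    rw [he.expand_shape_xy, shape]
    simp [pairProj_append, pairProj_cons, pairProj_eq_nil]
  have hne : ys j ≠ ys i := fun h => hij (ys.inj h).symm
  rw [hcore]
  by_cases hi : ys i ∈ C
  · obtain ⟨A, B, rfl⟩ := List.append_of_mem hi
    have hcount := List.nodup_iff_count_le_one.1 hC.nodup
    have hci := hcount (ys i)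
    have hcj := hcount (ys j)
    simp only [List.count_append, List.count_cons_self, List.count_cons_of_ne hne.symm] at hci hcj
    have hA : ys i ∉ expand e A := fun h => List.count_eq_zero.1 (by omega) (mem_of_mem_expand h)
    have hB : ys i ∉ expand e B := fun h => List.count_eq_zero.1 (by omega) (mem_of_mem_expand h)
    rw [expand_append, expand_cons, pairProj_append, pairProj_append,
      pairProj_eq_replicate_right hA, pairProj_eq_replicate_right hB,
      pairProj_eq_replicate_left fun h => hne (List.eq_of_mem_replicate h),
      List.count_replicate_self, count_expand, count_expand]
    rcases Nat.eq_zero_or_pos (A.count (ys j)) with hAj | hAj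
    · exact ⟨e (ys i), e (ys j) * B.count (ys j), Or.inl (by simp [hAj])⟩
    · have hBj : B.count (ys j) = 0 := by omega
      exact ⟨e (ys i), e (ys j) * A.count (ys j), Or.inr (by simp [hBj])⟩
  · refine ⟨0, (expand e C).count (ys j), Or.inl ?_⟩
    rw [pairProj_eq_replicate_right fun h => hi (mem_of_mem_expand h)]
    rfl

end Projection

end IsCore

theorem pow_notMem_factors_xyx {k : ℕ} (hk : 2 ≤ k) {p : Word} (hp : p ≠ 1) :
    p ^ k ∉ factors ({ltr x * ltr y * ltr x} : Set Word) := by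
  rintro ⟨u, rfl, q, s, h⟩
  obtain ⟨j, rfl⟩ := Nat.exists_eq_add_of_le hk
  have hinfix : p.toList ++ p.toList <:+: [x, y, x] := by
    refine ⟨q.toList, (p ^ j).toList ++ s.toList, ?_⟩
    simpa [pow_add, pow_two] using (congrArg FreeMonoid.toList h).symm
  have hlength : p.toList.length = 1 := by
    have hle := hinfix.length_le
    have hpos := List.length_pos_iff.2 fun h : p.toList = [] => hp h
    simp only [List.length_append, List.length_cons, List.length_nil] at hle
    omega
  obtain ⟨a, ha⟩ := List.length_eq_one_iff.1 hlength
  have hchain : [x, y, x].IsChain (· ≠ ·) := by simp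
  simpa [ha] using hchain.infix hinfix

theorem mxyx_pow_eq {k l : ℕ} (hk : 2 ≤ k) (hl : 2 ≤ l) (a : Mxyx) : a ^ k = a ^ l := by
  induction a using Con.induction_on with
  | H p =>
    obtain rfl | hp := eq_or_ne p 1
    · simp
    · change Con.mk' _ p ^ k = Con.mk' _ p ^ l
      rw [← map_pow, ← map_pow]
      exact (Con.eq _).2 (.inr ⟨pow_notMem_factors_xyx hk hp, pow_notMem_factors_xyx hl hp⟩)

theorem lift_ofList_expand {M : Type*} [Monoid M] (φ : Letter → M) (e : Letter → ℕ)
    (L : List Letter) : FreeMonoid.lift φ (FreeMonoid.ofList (expand e L)) =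
      (L.map fun l => φ l ^ e l).prod := by
  rw [FreeMonoid.lift_ofList]
  induction L with
  | nil => rfl
  | cons a L ih => simp [expand_cons, ih]

theorem satisfies_mxyx_expand {e e' : Letter → ℕ} (he : IsAdmissible e) (he' : IsAdmissible e')
    (L : List Letter) :
    Satisfies Mxyx (FreeMonoid.ofList (expand e L), FreeMonoid.ofList (expand e' L)) := by
  intro φ
  rw [lift_ofList_expand, lift_ofList_expand]
  congr 1
  refine List.map_congr_left fun l _ => ?_
  by_cases hl : isSquared l = false
  · rw [he.eq_one l hl, he'.eq_one l hl]
  · obtain ⟨i, rfl⟩ := exists_eq_ys_of_isSquared hl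
    exact mxyx_pow_eq (he.two_le i) (he'.two_le i) _

/-- The substitution `p ↦ x`, `σ ↦ y`, erasing the other letters, turns `u` into `xyx`, which is
alone in its class. -/
theorem count_eq_two_of_satisfies_mxyx {u v : List Letter} {p σ : Letter} (hne : p ≠ σ)
    (h : Satisfies Mxyx (FreeMonoid.ofList v, FreeMonoid.ofList u))
    (hu : pairProj p σ u = [p, σ, p]) : v.count p = 2 := by
  let code : Letter → List Letter := fun g => if g = p then [x] else if g = σ then [y] else []
  have hlift (w : List Letter) : FreeMonoid.lift
      (fun g => ((FreeMonoid.ofList (code g) : Word) : Mxyx)) (FreeMonoid.ofList w) =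
      ((FreeMonoid.ofList (w.flatMap code) : Word) : Mxyx) := by
    rw [FreeMonoid.lift_ofList]
    induction w with
    | nil => rfl
    | cons a w ih => simp [ih]
  have hcode := h fun g => ((FreeMonoid.ofList (code g) : Word) : Mxyx)
  have hcode_u : u.flatMap code = [x, y, x] := by
    rw [flatMap_ite_eq_map_pairProj, hu]
    simp [hne.symm]
  have hcode_v : v.flatMap code = [x, y, x] := by
    simp only [hlift, hcode_u] at hcode
    exact ((Con.eq _).1 hcode).resolve_right fun h => h.2 ⟨_, rfl, 1, 1, by simp; rfl⟩
  have hproj : pairProj p σ v = pairProj p σ u :=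
    pairProj_eq_of_flatMap_ite_eq (s := x) (s' := y) (by simp) (hcode_v.trans hcode_u.symm)
  rw [← count_pairProj_left p σ, hproj, hu]
  simp [hne.symm]

namespace IsCore

variable {n m : ℕ} {C : List Letter} (hC : IsCore n m C)
include hC

theorem exists_liesAt_straddle {p : Letter} {e : Letter → ℕ} (he : IsAdmissible e)
    (hp : (shape n m C [x, y]).count p = 2) :
    ∃ σ, p ≠ σ ∧ (expand e (shape n m C [x, y])).count σ = 1 ∧
      LiesAt (expand e (shape n m C [x, y])) σ p .straddle := by
  have hn := hC.pos
  have hts : ts 0 ∈ shape n m C [x, y] :=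
    List.count_pos_iff.1 (by simp [hC.count_shape, hC.m_pos])
  have htp : tp (2 * n - 1) ∈ shape n m C [x, y] :=
    List.count_pos_iff.1 (by simp only [hC.count_shape]; rw [if_pos (by omega)]; simp)
  rw [hC.count_shape] at hp
  by_cases hz : ∃ j, p = zs j
  · obtain ⟨j, rfl⟩ := hz
    have hj : j < m := by simpa using hp
    exact ⟨ts 0, by simp, hC.count_expand_of_isSimple he rfl hts,
      by simpa using hC.liesAt_ts_zs he hC.m_pos hj⟩
  · have hp' : p = x ∨ p = y ∨ ∃ i < 2 * n, p = zp i := by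
      cases p with
      | zs j => exact absurd ⟨j, rfl⟩ hz
      | _ => simp_all <;> split_ifs at hp <;> omega
    exact ⟨tp (2 * n - 1), by obtain rfl | rfl | ⟨i, -, rfl⟩ := hp' <;> simp,
      hC.count_expand_of_isSimple he rfl htp, hC.liesAt_tp_last_straddle he hp'⟩

theorem count_shape_of_isSquared {l : Letter} (hl : isSquared l ≠ false)
    (hmem : l ∈ shape n m C [x, y]) : (shape n m C [x, y]).count l = 1 := by
  obtain ⟨i, rfl⟩ := exists_eq_ys_of_isSquared hl
  have hpos := List.count_pos_iff.2 hmem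
  rw [hC.count_shape] at hpos ⊢
  simp only at hpos ⊢
  split_ifs at hpos ⊢ <;> simp_all

theorem count_eq_of_satisfies_mxyx {e' : Letter → ℕ} (he' : IsAdmissible e') {v : List Letter}
    (hsat : Satisfies Mxyx
      (FreeMonoid.ofList v, FreeMonoid.ofList (expand e' (shape n m C [x, y]))))
    (hsimple : ∀ l, v.count l = 1 ↔ (expand e' (shape n m C [x, y])).count l = 1)
    {l : Letter} (hl : isSquared l = false) (hmem : l ∈ shape n m C [x, y]) :
    v.count l = (shape n m C [x, y]).count l := by
  have hle : (shape n m C [x, y]).count l = 1 ∨ (shape n m C [x, y]).count l = 2 := by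
    have hpos := List.count_pos_iff.2 hmem
    rw [hC.count_shape] at hpos ⊢
    cases l <;> simp_all [isSquared] <;> split_ifs at * <;> simp_all
  obtain h | h := hle
  · rw [h, hsimple, count_expand, h, he'.eq_one l hl]
  · obtain ⟨σ, hne, hσ, hstraddle⟩ := hC.exists_liesAt_straddle he' h
    rw [h]
    exact count_eq_two_of_satisfies_mxyx hne hsat (hstraddle.pairProj_eq_of_straddle hσ)

theorem exists_eq_expand_of_gamma' {e' : Letter → ℕ} (he' : IsAdmissible e') {v : List Letter}
    (h : gamma' (FreeMonoid.ofList v) (FreeMonoid.ofList (expand e' (shape n m C [x, y])))) :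
    ∃ e, IsAdmissible e ∧ v = expand e (shape n m C [x, y]) := by
  obtain ⟨⟨hsimple, hislands⟩, hFIC⟩ := h
  have hsat := hFIC (MonCat.of Mxyx) (MonoidVariety.isLeast_generatedBy Mxyx).1
  have hsimple' (l : Letter) : v.count l = 1 ↔ (expand e' (shape n m C [x, y])).count l = 1 :=
    Set.ext_iff.1 hsimple l
  have hglue : v.foldr glue [] = shape n m C [x, y] := by
    rw [islands, islands, destutter_eq_foldr, destutter_eq_foldr] at hislands
    exact hislands.trans (hC.foldr_glue_expand_shape he')
  have hmem (l : Letter) : l ∈ v ↔ l ∈ shape n m C [x, y] := by rw [← hglue, mem_foldr_glue]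
  let e : Letter → ℕ := fun l => if isSquared l = true ∧ l ∈ v then v.count l else e' l
  have heq_one (l : Letter) (hl : isSquared l = false) : e l = 1 := by
    simp [e, hl, he'.eq_one l hl]
  refine ⟨e, ⟨fun i => ?_, heq_one⟩, eq_expand_of_foldr_glue_eq hglue fun l hl => ?_⟩
  · by_cases hi : ys i ∈ v
    · have hpos := List.count_pos_iff.2 hi
      have hne : v.count (ys i) ≠ 1 := by
        rw [Ne, hsimple', count_expand]
        exact fun h => (he'.two_le i).not_gt (by simp [Nat.eq_one_of_mul_eq_one_right h])
      simp only [e, isSquared, hi, and_self, if_true]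
      omega
    · simpa [e, hi] using he'.two_le i
  · by_cases hsq : isSquared l = false
    · exact .inl ⟨heq_one l hsq,
        hC.count_eq_of_satisfies_mxyx he' hsat hsimple' hsq ((hmem l).1 hl)⟩
    · exact .inr ⟨by simp [e, hsq, hl], hC.count_shape_of_isSquared hsq ((hmem l).1 hl)⟩

theorem gamma'_expand_expand {e e' : Letter → ℕ} (he : IsAdmissible e) (he' : IsAdmissible e') :
    gamma' (FreeMonoid.ofList (expand e (shape n m C [x, y])))
      (FreeMonoid.ofList (expand e' (shape n m C [x, y]))) := by
  refine ⟨⟨Set.ext fun l => ?_, ?_⟩, fun M hM => hM _ (satisfies_mxyx_expand he he' _)⟩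
  · change (expand e _).count l = 1 ↔ (expand e' _).count l = 1
    rw [count_expand, count_expand, mul_eq_one, mul_eq_one]
    by_cases hl : isSquared l = false
    · rw [he.eq_one l hl, he'.eq_one l hl]
    · obtain ⟨i, rfl⟩ := exists_eq_ys_of_isSquared hl
      have := he.two_le i
      have := he'.two_le i
      omega
  · rw [islands, islands, destutter_eq_foldr, destutter_eq_foldr]
    exact (hC.foldr_glue_expand_shape he).trans (hC.foldr_glue_expand_shape he').symm

theorem gamma'_iff {e' : Letter → ℕ} (he' : IsAdmissible e') (v : List Letter) :
    gamma' (FreeMonoid.ofList v) (FreeMonoid.ofList (expand e' (shape n m C [x, y]))) ↔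
      ∃ e, IsAdmissible e ∧ v = expand e (shape n m C [x, y]) := by
  refine ⟨hC.exists_eq_expand_of_gamma' he', ?_⟩
  rintro ⟨e, he, rfl⟩
  exact hC.gamma'_expand_expand he he'

end IsCore

/-- The alphabet of the interlocked words: two copies of the letters, and two additional letters
`cc` and `dd`, which link the two copies. -/
inductive DoubleLetter : Type
  | left (l : Letter) : DoubleLetter
  | right (l : Letter) : DoubleLetter
  | cc : DoubleLetter
  | dd : DoubleLetter
  deriving DecidableEq

namespace DoubleLetter

instance : Countable DoubleLetter := by
  have := Letter.countable
  let f : DoubleLetter → Option Letter × Bool := fun a => match a with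
    | .left l => (some l, true)
    | .right l => (some l, false)
    | .cc => (none, true)
    | .dd => (none, false)
  have hf : Function.Injective f := by
    intro a b h
    cases a <;> cases b <;> simp_all [f]
  exact hf.countable

theorem left_injective : Function.Injective left := fun _ _ h => by injection h

theorem right_injective : Function.Injective right := fun _ _ h => by injection h

end DoubleLetter

open DoubleLetter

section Keep

variable {α β : Type*} [DecidableEq α]

/-- The projection of a list onto a set of letters. -/
def keep (S v : List α) : List α := v.filter fun g => g ∈ S

@[simp] theorem keep_nil (S : List α) : keep S [] = [] := rfl

theorem keep_append (S v w : List α) : keep S (v ++ w) = keep S v ++ keep S w :=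
  List.filter_append ..

theorem keep_cons (S : List α) (a : α) (v : List α) :
    keep S (a :: v) = if a ∈ S then a :: keep S v else keep S v := by
  simp [keep, List.filter_cons]

theorem mem_keep {S v : List α} {g : α} : g ∈ keep S v ↔ g ∈ v ∧ g ∈ S := by simp [keep]

theorem keep_eq_nil {S v : List α} (h : ∀ g ∈ S, g ∉ v) : keep S v = [] :=
  List.eq_nil_iff_forall_not_mem.2 fun g hg => h g (mem_keep.1 hg).2 (mem_keep.1 hg).1

theorem keep_eq_keep_singleton {S v : List α} {g : α} (hv : v.count g = 1)
    (h : ∀ a ∈ S, a ≠ g → a ∉ v) : keep S v = keep S [g] := by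
  by_cases hg : g ∈ S
  · have hall : ∀ b ∈ keep S v, b = g := fun b hb => by
      by_contra hne
      exact h b (mem_keep.1 hb).2 hne (mem_keep.1 hb).1
    have hcount : (keep S v).count g = 1 := by
      rw [keep, List.count_filter (by simpa using hg), hv]
    rw [List.eq_replicate_of_mem hall, ← List.count_eq_length.2 fun b hb => (hall b hb).symm,
      hcount, keep_cons, if_pos hg]
    rfl
  · rw [keep_cons, if_neg hg, keep_nil]
    exact keep_eq_nil fun a ha => h a ha fun e => hg (e ▸ ha)

theorem flatMap_eq_flatMap_keep {S v : List α} {f : α → List β} (h : ∀ g, g ∉ S → f g = []) :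
    v.flatMap f = (keep S v).flatMap f := by
  induction v with
  | nil => rfl
  | cons a v ih =>
    rw [keep_cons, List.flatMap_cons, ih]
    split_ifs with ha
    · rfl
    · rw [h a ha, List.nil_append]

theorem pairProj_keep {S v : List α} {p q : α} (hp : p ∈ S) (hq : q ∈ S) :
    pairProj p q (keep S v) = pairProj p q v := by
  rw [pairProj, keep, List.filter_filter, pairProj]
  refine List.filter_congr fun g _ => ?_
  by_cases hgp : g = p
  · simp [hgp, hp]
  · by_cases hgq : g = q <;> simp [hgp, hgq, hq]

end Keep

theorem flatMap_eq_self {α : Type*} {f : α → List α} {L : List α} (h : ∀ l ∈ L, f l = [l]) :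
    L.flatMap f = L :=
  (List.flatMap_congr h).trans (List.flatMap_singleton' L)

theorem pairProj_expand_congr {α : Type*} [DecidableEq α] {e e' : α → ℕ} {p q : α} {L : List α}
    (hp : e p = e' p) (hq : e q = e' q) :
    pairProj p q (expand e L) = pairProj p q (expand e' L) := by
  rw [expand, expand, pairProj_flatMap, pairProj_flatMap]
  refine List.flatMap_congr fun a _ => ?_
  simp only [pairProj, List.filter_replicate]
  by_cases ha : a = p ∨ a = q
  · obtain rfl | rfl := ha <;> simp [hp, hq]
  · simp [ha]

section Interlock

variable {n m : ℕ} {C : List Letter}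

/-- The least admissible exponents. -/
def stdExponent (l : Letter) : ℕ := if isSquared l = true then 2 else 1

theorem isAdmissible_stdExponent : IsAdmissible stdExponent where
  two_le i := by simp [stdExponent, isSquared]
  eq_one l hl := by simp [stdExponent, hl]

/-- The `γ'`-class of the word with core `C`, by `IsCore.gamma'_iff`. -/
def shapeClass (n m : ℕ) (C : List Letter) : Set (List Letter) :=
  {v | ∃ e, IsAdmissible e ∧ v = expand e (shape n m C [x, y])}

/-- Two interlocked copies of the word. The lists `X` and `Y` stand for the first occurrences of
`x` and `y` in the left and in the right copy. -/
def interlock (n m : ℕ) (C : List Letter) (X Y : List DoubleLetter) : List DoubleLetter :=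
  (primedBlock 0 n).map left ++ (X ++ (left t :: ((primedBlock 0 n).map right ++ (cc ::
  ((primedBlock n n).map left ++ (left x :: (Y ++ ((expand stdExponent C).map left ++
  (left y :: right t :: ((primedBlock n n).map right ++ (right x :: dd :: cc ::
  ((expand stdExponent C).map right ++ (right y :: ((tailWord m).map right ++
  ((tailWord m).map left ++ [dd])))))))))))))))

/-- The interlocked word in which both copies are in the standard order. -/
abbrev interlockedWord (n m : ℕ) (C : List Letter) : List DoubleLetter :=
  interlock n m C [left x, left y] [right x, right y]

/-- The words `v` to which the class allows to pass from the interlocked word `w`: whenever an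
image of `w` under a substitution that makes both swapped pairs commute is a factor of a word of
the class, replacing it with the image of `v` yields a word of the class. -/
def entailedWords (n m : ℕ) (C : List Letter) : Set (List DoubleLetter) :=
  {v | ∀ (ψ : DoubleLetter → List Letter) (pre post : List Letter),
    ψ (left x) ++ ψ (left y) = ψ (left y) ++ ψ (left x) →
    ψ (right x) ++ ψ (right y) = ψ (right y) ++ ψ (right x) →
    pre ++ ((interlockedWord n m C).flatMap ψ ++ post) ∈ shapeClass n m C →
    pre ++ (v.flatMap ψ ++ post) ∈ shapeClass n m C}

/-- The substitution that keeps the left copy and erases the other letters. -/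
def leftPart : DoubleLetter → List Letter
  | left l => [l]
  | _ => []

/-- The substitution that keeps the right copy and erases the other letters. -/
def rightPart : DoubleLetter → List Letter
  | right l => [l]
  | _ => []

theorem leftPart_interlock (X Y : List DoubleLetter) (hY : Y.flatMap leftPart = []) :
    (interlock n m C X Y).flatMap leftPart =
      shape n m (expand stdExponent C) (X.flatMap leftPart) := by
  have hleft (L : List Letter) : (L.map left).flatMap leftPart = L := by
    rw [List.flatMap_map]
    exact flatMap_eq_self fun _ _ => rfl
  have hright (L : List Letter) : (L.map right).flatMap leftPart = [] := by
    rw [List.flatMap_map]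
    exact List.flatMap_eq_nil_iff.2 fun _ _ => rfl
  simp [interlock, shape, List.flatMap_append, List.flatMap_cons, hleft, hright, hY, leftPart]

theorem rightPart_interlock (X Y : List DoubleLetter) (hX : X.flatMap rightPart = []) :
    (interlock n m C X Y).flatMap rightPart =
      shape n m (expand stdExponent C) (Y.flatMap rightPart) := by
  have hright (L : List Letter) : (L.map right).flatMap rightPart = L := by
    rw [List.flatMap_map]
    exact flatMap_eq_self fun _ _ => rfl
  have hleft (L : List Letter) : (L.map left).flatMap rightPart = [] := by
    rw [List.flatMap_map]
    exact List.flatMap_eq_nil_iff.2 fun _ _ => rfl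
  simp [interlock, shape, List.flatMap_append, List.flatMap_cons, hleft, hright, hX, rightPart]

end Interlock

section Erase

variable {n m : ℕ} {C : List Letter}

/-- A substitution that erases `y`, and leaves the words of `shape_flatMap_dropY` unchanged,
because the letter after each occurrence of `y` reproduces it. -/
def dropY (l : Letter) : List Letter :=
  if l = y then [] else if l = t then [y, t] else if l = ts 0 then [y, ts 0] else [l]

/-- A substitution that erases `x`, and leaves the words of `shape_flatMap_dropX` unchanged,
because the letter before each occurrence of `x` reproduces it. -/
def dropX (n : ℕ) (l : Letter) : List Letter :=
  if l = x then [] else if l = tp (n - 1) then [tp (n - 1), x]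
  else if l = tp (2 * n - 1) then [tp (2 * n - 1), x] else [l]

theorem pairProj_dropY {p q : Letter} (hp : p ≠ y) (hq : q ≠ y) (l : Letter) :
    pairProj p q (dropY l) = pairProj p q [l] := by
  unfold dropY
  split_ifs <;> simp_all [pairProj_cons, hp.symm, hq.symm]

theorem pairProj_dropX {p q : Letter} (hp : p ≠ x) (hq : q ≠ x) (l : Letter) :
    pairProj p q (dropX n l) = pairProj p q [l] := by
  unfold dropX
  split_ifs <;> simp_all [pairProj_cons, hp.symm, hq.symm]

theorem exists_tailWord_eq_ts_zero_cons (hm : 0 < m) :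
    ∃ T, tailWord m = ts 0 :: T ∧ ts 0 ∉ T := by
  obtain ⟨R, hR⟩ := exists_tailWord_eq hm
  have hT : tailWord m = ts 0 :: zs 0 :: R := hR
  have hnodup := nodup_tailWord m
  rw [hT, List.nodup_cons] at hnodup
  exact ⟨_, hT, hnodup.1⟩

namespace IsCore

variable (hC : IsCore n m C)
include hC

theorem isSimple_notMem_expand {e : Letter → ℕ} {l : Letter} (hl : isSimple l = true) :
    l ∉ expand e C := fun h => hC.isSimple_notMem l hl (mem_of_mem_expand h)

theorem shape_flatMap_dropY {e : Letter → ℕ} :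
    (shape n m (expand e C) [x, y]).flatMap dropY = shape n m (expand e C) [x, y] := by
  obtain ⟨T, hT, hT₀⟩ := exists_tailWord_eq_ts_zero_cons hC.m_pos
  have hfix {L : List Letter} (hy : y ∉ L) (ht : t ∉ L) (hts : ts 0 ∉ L) : L.flatMap dropY = L :=
    flatMap_eq_self fun l hl => by
      simp [dropY, ne_of_mem_of_not_mem hl hy, ne_of_mem_of_not_mem hl ht,
        ne_of_mem_of_not_mem hl hts]
  have hprimed (a k : ℕ) : (primedBlock a k).flatMap dropY = primedBlock a k :=
    hfix (by simp) (by simp) (by simp)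
  have hcore : (expand e C).flatMap dropY = expand e C :=
    hfix hC.y_notMem_expand (hC.isSimple_notMem_expand rfl) (hC.isSimple_notMem_expand rfl)
  have htail : T.flatMap dropY = T := by
    have hy : y ∉ tailWord m := y_notMem_tailWord
    have ht : t ∉ tailWord m := t_notMem_tailWord
    rw [hT] at hy ht
    exact hfix (List.not_mem_of_not_mem_cons hy) (List.not_mem_of_not_mem_cons ht) hT₀
  rw [shape, hT]
  simp [List.flatMap_append, List.flatMap_cons, hprimed, hcore, htail, dropY]

theorem shape_flatMap_dropX {e : Letter → ℕ} :
    (shape n m (expand e C) [x, y]).flatMap (dropX n) = shape n m (expand e C) [x, y] := by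
  obtain ⟨k, rfl⟩ := Nat.exists_eq_add_of_le' hC.pos
  have hfix {L : List Letter} (hx : x ∉ L) (hmid : tp k ∉ L) (hlast : tp (k + 1 + k) ∉ L) :
      L.flatMap (dropX (k + 1)) = L :=
    flatMap_eq_self fun l hl => by
      simp [dropX, ne_of_mem_of_not_mem hl hx, ne_of_mem_of_not_mem hl hmid,
        show 2 * (k + 1) - 1 = k + 1 + k by omega, ne_of_mem_of_not_mem hl hlast]
  have hfirst : (primedBlock 0 k).flatMap (dropX (k + 1)) = primedBlock 0 k :=
    hfix (by simp) (by simp [tp_mem_primedBlock]) (by simp [tp_mem_primedBlock])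
  have hsecond : (primedBlock (k + 1) k).flatMap (dropX (k + 1)) = primedBlock (k + 1) k :=
    hfix (by simp) (by simp [tp_mem_primedBlock]) (by simp [tp_mem_primedBlock])
  have hcore : (expand e C).flatMap (dropX (k + 1)) = expand e C :=
    hfix hC.x_notMem_expand (hC.isSimple_notMem_expand rfl) (hC.isSimple_notMem_expand rfl)
  have htail : (tailWord m).flatMap (dropX (k + 1)) = tailWord m :=
    hfix (by simp) (by simp) (by simp)
  have hsucc (a : ℕ) : primedBlock a (k + 1) = primedBlock a k ++ [zp (a + k), tp (a + k)] :=
    interleave_add zp tp a k 1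
  simp [shape, hsucc, List.flatMap_append, List.flatMap_cons, hfirst, hsecond, hcore, htail,
    dropX, show 2 * (k + 1) - 1 = k + 1 + k by omega]

end IsCore

end Erase

section EmbeddedCopy

variable {n m : ℕ} {C : List Letter}

/-- The substitution `π` recovers from the interlocked word the copy of the word that is written in
the letters `ι l`. Both pairs of swapped letters are either erased by `π` or belong to this copy. -/
structure IsEmbeddedCopy (n m : ℕ) (C : List Letter) (ι : Letter → DoubleLetter)
    (π : DoubleLetter → List Letter) : Prop where
  apply_eq : ∀ l, π (ι l) = [l]
  eq_or_eq_nil : ∀ g, (∃ l, g = ι l) ∨ π g = []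
  flatMap_eq : (interlockedWord n m C).flatMap π = shape n m (expand stdExponent C) [x, y]
  eq_left_or : ι = left ∨ π (left x) = [] ∧ π (left y) = []
  eq_right_or : ι = right ∨ π (right x) = [] ∧ π (right y) = []

theorem isEmbeddedCopy_left : IsEmbeddedCopy n m C left leftPart where
  apply_eq _ := rfl
  eq_or_eq_nil g := by cases g <;> simp [leftPart]
  flatMap_eq := leftPart_interlock _ _ rfl
  eq_left_or := .inl rfl
  eq_right_or := .inr ⟨rfl, rfl⟩

theorem isEmbeddedCopy_right : IsEmbeddedCopy n m C right rightPart where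
  apply_eq _ := rfl
  eq_or_eq_nil g := by cases g <;> simp [rightPart]
  flatMap_eq := rightPart_interlock _ _ rfl
  eq_left_or := .inr ⟨rfl, rfl⟩
  eq_right_or := .inl rfl

namespace IsEmbeddedCopy

variable {ι : Letter → DoubleLetter} {π : DoubleLetter → List Letter}

theorem injective (hι : IsEmbeddedCopy n m C ι π) : Function.Injective ι := fun a b h => by
  have hπ := congrArg π h
  rw [hι.apply_eq, hι.apply_eq] at hπ
  exact List.singleton_inj.1 hπ

theorem pairProj_eq_map (hι : IsEmbeddedCopy n m C ι π) {f : Letter → List Letter} {p q : Letter}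
    (hf : ∀ l, pairProj p q (f l) = pairProj p q [l]) (w : List DoubleLetter) :
    pairProj (ι p) (ι q) w = (pairProj p q (w.flatMap fun g => (π g).flatMap f)).map ι := by
  rw [pairProj_flatMap]
  induction w with
  | nil => rfl
  | cons g w ih =>
    rw [pairProj_cons, List.flatMap_cons, List.map_append, ← ih]
    rcases hι.eq_or_eq_nil g with ⟨l, rfl⟩ | hg
    · rw [hι.apply_eq, List.flatMap_singleton, hf, pairProj_cons]
      simp only [hι.injective.eq_iff]
      split_ifs <;> simp
    · rw [hg, if_neg]
      · simp
      · rintro (rfl | rfl) <;> simp [hι.apply_eq] at hg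

theorem exists_pairProj_eq_of_erase (hι : IsEmbeddedCopy n m C ι π) {v : List DoubleLetter}
    (hv : v ∈ entailedWords n m C) {f : Letter → List Letter} (hf : f x = [] ∨ f y = [])
    (hshape : (shape n m (expand stdExponent C) [x, y]).flatMap f =
      shape n m (expand stdExponent C) [x, y]) :
    ∃ e, IsAdmissible e ∧ ∀ p q, (∀ l, pairProj p q (f l) = pairProj p q [l]) →
      pairProj (ι p) (ι q) v = (pairProj p q (expand e (shape n m C [x, y]))).map ι := by
  have hcomm (j : Letter → DoubleLetter) (hj : ι = j ∨ π (j x) = [] ∧ π (j y) = []) :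
      (π (j x)).flatMap f ++ (π (j y)).flatMap f = (π (j y)).flatMap f ++ (π (j x)).flatMap f := by
    rcases hj with rfl | ⟨hx, hy⟩
    · rcases hf with hf | hf <;> simp [hι.apply_eq, hf]
    · simp [hx, hy]
  obtain ⟨e, he, hve⟩ := hv (fun g => (π g).flatMap f) [] [] (hcomm left hι.eq_left_or)
    (hcomm right hι.eq_right_or) ⟨stdExponent, isAdmissible_stdExponent, by
      rw [List.nil_append, List.append_nil, ← List.flatMap_assoc, hι.flatMap_eq, hshape,
        isAdmissible_stdExponent.expand_shape_xy]⟩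
  rw [List.nil_append, List.append_nil] at hve
  exact ⟨e, he, fun p q hpq => by rw [hι.pairProj_eq_map hpq, hve]⟩

theorem exists_pairProj_eq_expand (hι : IsEmbeddedCopy n m C ι π) (hC : IsCore n m C)
    {v : List DoubleLetter} (hv : v ∈ entailedWords n m C) :
    ∃ e, IsAdmissible e ∧ ∀ p q, ¬ (p = x ∧ q = y) → ¬ (p = y ∧ q = x) →
      pairProj (ι p) (ι q) v = (pairProj p q (expand e (shape n m C [x, y]))).map ι := by
  obtain ⟨e, he, hdropY⟩ :=
    hι.exists_pairProj_eq_of_erase hv (f := dropY) (.inr rfl) hC.shape_flatMap_dropY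
  obtain ⟨e', he', hdropX⟩ :=
    hι.exists_pairProj_eq_of_erase hv (f := dropX n) (.inl rfl) hC.shape_flatMap_dropX
  have hexpand : expand e (shape n m C [x, y]) = expand e' (shape n m C [x, y]) := by
    refine expand_congr fun l hl => ?_
    cases hsq : isSquared l with
    | false => rw [he.eq_one l hsq, he'.eq_one l hsq]
    | true =>
      have hlx : l ≠ x := by rintro rfl; cases hsq
      have hly : l ≠ y := by rintro rfl; cases hsq
      have hcount := congrArg (List.count (ι l)) ((hdropY l l (pairProj_dropY hly hly)).symm.trans
        (hdropX l l (pairProj_dropX hlx hlx)))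
      rw [List.count_map_of_injective _ _ hι.injective,
        List.count_map_of_injective _ _ hι.injective, count_pairProj_left, count_pairProj_left,
        count_expand, count_expand] at hcount
      exact Nat.eq_of_mul_eq_mul_right (List.count_pos_iff.2 hl) hcount
  refine ⟨e, he, fun p q hxy hyx => ?_⟩
  by_cases hy : p = y ∨ q = y
  · have hpx : p ≠ x := by
      rintro rfl
      exact hxy ⟨rfl, hy.resolve_left (by simp)⟩
    have hqx : q ≠ x := by
      rintro rfl
      exact hyx ⟨hy.resolve_right (by simp), rfl⟩
    rw [hexpand]
    exact hdropX p q (pairProj_dropX hpx hqx)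
  · rw [not_or] at hy
    exact hdropY p q (pairProj_dropY hy.1 hy.2)

end IsEmbeddedCopy

end EmbeddedCopy

section EntailedWords

variable {n m : ℕ} {C : List Letter} {v : List DoubleLetter}

/-- A substitution that erases the letters outside `S` makes both pairs of swapped letters
commute. -/
def IsIndependent (S : List DoubleLetter) : Prop :=
  ¬ (left x ∈ S ∧ left y ∈ S) ∧ ¬ (right x ∈ S ∧ right y ∈ S)

theorem commute_of_eq_nil {α β : Type*} {S : List α} {ψ : α → List β} (hψ : ∀ g, g ∉ S → ψ g = [])
    {a b : α} (hab : ¬ (a ∈ S ∧ b ∈ S)) : ψ a ++ ψ b = ψ b ++ ψ a := by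
  by_cases ha : a ∈ S
  · simp [hψ b fun hb => hab ⟨ha, hb⟩]
  · simp [hψ a ha]

theorem pairProj_flatMap_eq_of_mem_entailedWords (hv : v ∈ entailedWords n m C)
    {S : List DoubleLetter} (hS : IsIndependent S) {ψ : DoubleLetter → List Letter}
    (hψ : ∀ g, g ∉ S → ψ g = []) {s s' : Letter} (hs : isSquared s = false)
    (hs' : isSquared s' = false) {pre post : List Letter}
    (hshape : pre ++ ((interlockedWord n m C).flatMap ψ ++ post) =
      shape n m (expand stdExponent C) [x, y]) :
    pairProj s s' (v.flatMap ψ) = pairProj s s' ((interlockedWord n m C).flatMap ψ) := by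
  have hstd := isAdmissible_stdExponent
  have hexpand := hshape.trans hstd.expand_shape_xy.symm
  obtain ⟨e, he, hve⟩ := hv ψ pre post (commute_of_eq_nil hψ hS.1) (commute_of_eq_nil hψ hS.2)
    ⟨stdExponent, hstd, hexpand⟩
  have hproj := congrArg (pairProj s s') hve
  rw [pairProj_expand_congr (e' := stdExponent) (by rw [he.eq_one _ hs, hstd.eq_one _ hs])
    (by rw [he.eq_one _ hs', hstd.eq_one _ hs']), ← hexpand] at hproj
  simpa only [pairProj_append, List.append_cancel_left_eq, List.append_cancel_right_eq] using hproj

theorem pairProj_eq_of_keep_eq (hv : v ∈ entailedWords n m C) {S pattern : List DoubleLetter}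
    (hS : IsIndependent S) (hkeep : keep S (interlockedWord n m C) = pattern)
    {ψ : DoubleLetter → List Letter} (hψ : ∀ g, g ∉ S → ψ g = []) {s s' : Letter} (hne : s ≠ s')
    (hs : isSquared s = false) (hs' : isSquared s' = false) {p q : DoubleLetter} (hp : p ∈ S)
    (hq : q ∈ S)
    (hcode : ∀ g ∈ S, pairProj s s' (ψ g) = if g = p then [s] else if g = q then [s'] else [])
    {pre post : List Letter}
    (hshape : pre ++ (pattern.flatMap ψ ++ post) = shape n m (expand stdExponent C) [x, y]) :
    pairProj p q v = pairProj p q pattern := by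
  have hcode' (g : DoubleLetter) :
      pairProj s s' (ψ g) = if g = p then [s] else if g = q then [s'] else [] := by
    by_cases hg : g ∈ S
    · exact hcode g hg
    · rw [hψ g hg, if_neg (ne_of_mem_of_not_mem hp hg).symm,
        if_neg (ne_of_mem_of_not_mem hq hg).symm, pairProj_nil]
  have hproj := pairProj_flatMap_eq_of_mem_entailedWords hv hS hψ hs hs'
    (by rw [flatMap_eq_flatMap_keep hψ, hkeep, hshape])
  rw [pairProj_flatMap, pairProj_flatMap] at hproj
  simp only [hcode'] at hproj
  rw [pairProj_eq_of_flatMap_ite_eq hne hproj, ← pairProj_keep hp hq, hkeep]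

theorem pairProj_eq_straddle (hv : v ∈ entailedWords n m C) {p σ : DoubleLetter} (hne : p ≠ σ)
    (hS : IsIndependent [p, σ]) (hkeep : keep [p, σ] (interlockedWord n m C) = [p, σ, p]) :
    pairProj p σ v = [p, σ, p] := by
  rw [pairProj_eq_of_keep_eq hv hS hkeep (p := p) (q := σ) (s := x) (s' := t)
    (ψ := fun g => if g = p then [x] else if g = σ then y :: t :: primedBlock n n else [])
    (pre := primedBlock 0 n) (post := expand stdExponent C ++ y :: tailWord m) ?_ (by simp)
    rfl rfl (by simp) (by simp) ?_ ?_]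
  · simp [pairProj_cons]
  · intro g hg
    simp_all
  · intro g hg
    obtain rfl | rfl : g = p ∨ g = σ := by simpa using hg
    · simp [pairProj_cons]
    · simp [hne.symm, pairProj_cons, pairProj_eq_nil]
  · simp [shape, hne.symm]

variable (hC : IsCore n m C) (hv : v ∈ entailedWords n m C)
include hC hv

theorem pairProj_eq_before {p τ σ : DoubleLetter} (hnodup : [p, τ, σ].Nodup)
    (hS : IsIndependent [p, τ, σ])
    (hkeep : keep [p, τ, σ] (interlockedWord n m C) = [p, τ, p, σ]) :
    pairProj p σ v = [p, p, σ] := by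
  have hnodup' := List.nodup_reverse.2 hnodup
  simp only [List.reverse_cons, List.reverse_nil, List.nil_append, List.cons_append,
    List.nodup_cons, List.mem_cons, List.not_mem_nil, or_false, not_or, List.nodup_nil,
    not_false_eq_true, and_true] at hnodup hnodup'
  obtain ⟨T, hT, hT₀⟩ := exists_tailWord_eq_ts_zero_cons hC.m_pos
  have hxT : x ∉ T := List.not_mem_of_not_mem_cons (hT ▸ x_notMem_tailWord)
  have hx : x ∉ expand stdExponent C := hC.x_notMem_expand
  have hts : ts 0 ∉ expand stdExponent C := hC.isSimple_notMem_expand rfl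
  rw [pairProj_eq_of_keep_eq hv hS hkeep (p := p) (q := σ) (s := x) (s' := ts 0)
    (ψ := fun g => if g = p then [x] else if g = τ then y :: t :: primedBlock n n else
      if g = σ then expand stdExponent C ++ y :: ts 0 :: T else [])
    (pre := primedBlock 0 n) (post := []) ?_ (by simp) rfl rfl (by simp) (by simp) ?_ ?_]
  · simp [pairProj_cons, hnodup, hnodup']
  · intro g hg
    simp_all
  · intro g hg
    obtain rfl | rfl | rfl : g = p ∨ g = τ ∨ g = σ := by simpa using hg
    · simp [pairProj_cons]
    · simp [hnodup, hnodup', pairProj_eq_nil]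
    · simp [hnodup', pairProj_cons, pairProj_append, pairProj_eq_nil, hx, hts, hxT, hT₀]
  · simp [shape, hnodup', hT]

theorem pairProj_eq_after {p τ σ : DoubleLetter} (hnodup : [p, τ, σ].Nodup)
    (hS : IsIndependent [p, τ, σ])
    (hkeep : keep [p, τ, σ] (interlockedWord n m C) = [σ, p, τ, p]) :
    pairProj p σ v = [σ, p, p] := by
  have hnodup' := List.nodup_reverse.2 hnodup
  simp only [List.reverse_cons, List.reverse_nil, List.nil_append, List.cons_append,
    List.nodup_cons, List.mem_cons, List.not_mem_nil, or_false, not_or, List.nodup_nil,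
    not_false_eq_true, and_true] at hnodup hnodup'
  have hn := hC.pos
  have htp : tp 0 ∉ primedBlock n n := by
    rw [tp_mem_primedBlock]
    omega
  have hprimed : pairProj x (tp 0) (primedBlock 0 n) = [tp 0] := by
    rw [pairProj_eq_replicate_right x_notMem_primedBlock, count_primedBlock,
      if_pos (tp_mem_primedBlock.2 (by omega)), List.replicate_one]
  rw [pairProj_eq_of_keep_eq hv hS hkeep (p := p) (q := σ) (s := x) (s' := tp 0)
    (ψ := fun g => if g = p then [x] else if g = τ then y :: t :: primedBlock n n else
      if g = σ then primedBlock 0 n else [])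
    (pre := []) (post := expand stdExponent C ++ y :: tailWord m) ?_ (by simp) rfl rfl (by simp)
    (by simp) ?_ ?_]
  · simp [pairProj_cons, hnodup, hnodup']
  · intro g hg
    simp_all
  · intro g hg
    obtain rfl | rfl | rfl : g = p ∨ g = τ ∨ g = σ := by simpa using hg
    · simp [pairProj_cons]
    · simp [hnodup, hnodup', pairProj_eq_nil, htp]
    · simp [hnodup', hprimed]
  · simp [shape, hnodup']

theorem pairProj_eq_aabb {p σ q τ : DoubleLetter} (hnodup : [p, σ, q, τ].Nodup)
    (hS : IsIndependent [p, σ, q, τ])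
    (hkeep : keep [p, σ, q, τ] (interlockedWord n m C) = [p, σ, p, q, τ, q]) :
    pairProj p q v = [p, p, q, q] := by
  have hnodup' := List.nodup_reverse.2 hnodup
  simp only [List.reverse_cons, List.reverse_nil, List.nil_append, List.cons_append,
    List.nodup_cons, List.mem_cons, List.not_mem_nil, or_false, not_or, List.nodup_nil,
    not_false_eq_true, and_true] at hnodup hnodup'
  obtain ⟨j, C', rfl⟩ := hC.head
  obtain ⟨R, hR⟩ := exists_tailWord_eq ((hC.zs_mem j).1 List.mem_cons_self)
  have hE : expand stdExponent (zs j :: C') = zs j :: expand stdExponent C' := expand_cons ..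
  have hj : zs j ∉ expand stdExponent C' := fun h =>
    (List.nodup_cons.1 hC.nodup).1 (mem_of_mem_expand h)
  have hx : x ∉ expand stdExponent C' :=
    List.not_mem_of_not_mem_cons (hE ▸ hC.x_notMem_expand)
  rw [pairProj_eq_of_keep_eq hv hS hkeep (p := p) (q := q) (s := x) (s' := zs j)
    (ψ := fun g => if g = p then [x] else if g = σ then y :: t :: primedBlock n n else
      if g = q then [zs j] else
      if g = τ then expand stdExponent C' ++ y :: (tailWord j ++ [ts j]) else [])
    (pre := primedBlock 0 n) (post := R) ?_ (by simp) rfl rfl (by simp) (by simp) ?_ ?_]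
  · simp [pairProj_cons, hnodup, hnodup']
  · intro g hg
    simp_all
  · intro g hg
    obtain rfl | rfl | rfl | rfl : g = p ∨ g = σ ∨ g = q ∨ g = τ := by simpa using hg
    · simp [pairProj_cons]
    · simp [hnodup, hnodup', pairProj_eq_nil]
    · simp [hnodup', pairProj_cons]
    · simp [hnodup', pairProj_eq_nil, hj, hx, zs_mem_tailWord]
  · simp [shape, hnodup', hE, hR]

theorem pairProj_eq_abab {p σ q τ : DoubleLetter} (hnodup : [p, σ, q, τ].Nodup)
    (hS : IsIndependent [p, σ, q, τ])
    (hkeep : keep [p, σ, q, τ] (interlockedWord n m C) = [p, σ, q, p, τ, q]) :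
    pairProj p q v = [p, q, p, q] := by
  have hnodup' := List.nodup_reverse.2 hnodup
  simp only [List.reverse_cons, List.reverse_nil, List.nil_append, List.cons_append,
    List.nodup_cons, List.mem_cons, List.not_mem_nil, or_false, not_or, List.nodup_nil,
    not_false_eq_true, and_true] at hnodup hnodup'
  obtain ⟨j, C', rfl⟩ := hC.last
  obtain ⟨R, hR⟩ := exists_tailWord_eq ((hC.zs_mem j).1 (by simp))
  have hE : expand stdExponent (C' ++ [zs j]) = expand stdExponent C' ++ [zs j] := expand_append ..
  have hj : zs j ∉ expand stdExponent C' := fun h =>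
    List.disjoint_of_nodup_append hC.nodup (mem_of_mem_expand h) List.mem_cons_self
  have hy : y ∉ expand stdExponent C' :=
    fun h => hC.y_notMem_expand (hE ▸ List.mem_append_left _ h)
  rw [pairProj_eq_of_keep_eq hv hS hkeep (p := p) (q := q) (s := y) (s' := zs j)
    (ψ := fun g => if g = p then [y] else
      if g = σ then t :: (primedBlock n n ++ x :: expand stdExponent C') else
      if g = q then [zs j] else if g = τ then tailWord j ++ [ts j] else [])
    (pre := primedBlock 0 n ++ [x]) (post := R) ?_ (by simp) rfl rfl (by simp) (by simp) ?_ ?_]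
  · simp [pairProj_cons, hnodup, hnodup']
  · intro g hg
    simp_all
  · intro g hg
    obtain rfl | rfl | rfl | rfl : g = p ∨ g = σ ∨ g = q ∨ g = τ := by simpa using hg
    · simp [pairProj_cons]
    · simp [hnodup, hnodup', pairProj_eq_nil, hj, hy]
    · simp [hnodup', pairProj_cons]
    · simp [hnodup', pairProj_eq_nil, zs_mem_tailWord]
  · simp [shape, hnodup', hE, hR]

end EntailedWords

section Outline

variable {n m : ℕ} {C : List Letter}

/-- The projection of the interlocked word onto the letters from which the links between the two
copies are read off: the letters `x`, `y`, `t`, `ts 0` and `zs j` of both copies, `tp (2 * n - 1)`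
of the left copy, `tp i` of the right copy, `cc` and `dd`. -/
def outline (n j i : ℕ) : List DoubleLetter :=
  [left x, left y, left t, right (tp i), cc, left (tp (2 * n - 1)), left x, right x, right y,
    left (zs j), left y, right t, right x, dd, cc, right (zs j), right y, right (ts 0),
    right (zs j), left (ts 0), left (zs j), dd]

section Blocks

variable {S : List DoubleLetter} {i j : ℕ} (hS : S ⊆ outline n j i) {L : List Letter}
  {ι : Letter → DoubleLetter}
include hS

theorem keep_map_eq_nil (h : ∀ l, ι l ∈ outline n j i → l ∉ L) : keep S (L.map ι) = [] :=
  keep_eq_nil fun g hg hgL => by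
    obtain ⟨l, hl, rfl⟩ := List.mem_map.1 hgL
    exact h l (hS hg) hl

theorem keep_map_eq_keep_singleton (hι : Function.Injective ι) {l : Letter} (hl : L.count l = 1)
    (h : ∀ l', ι l' ∈ outline n j i → l' ≠ l → l' ∉ L) : keep S (L.map ι) = keep S [ι l] :=
  keep_eq_keep_singleton (by rw [List.count_map_of_injective _ _ hι, hl]) fun g hg hgl hgL => by
    obtain ⟨l', hl', rfl⟩ := List.mem_map.1 hgL
    exact h l' (hS hg) (fun h => hgl (h ▸ rfl)) hl'

theorem keep_map_expand (hC : IsCore n m C) (hj : j < m) (hι : ι = left ∨ ι = right) :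
    keep S ((expand stdExponent C).map ι) = keep S [ι (zs j)] := by
  have hcount := hC.count_expand_core isAdmissible_stdExponent ((hC.zs_mem j).2 hj) rfl
  have hx : x ∉ expand stdExponent C := hC.x_notMem_expand
  have hy : y ∉ expand stdExponent C := hC.y_notMem_expand
  have ht : t ∉ expand stdExponent C := hC.isSimple_notMem_expand rfl
  have hts : ts 0 ∉ expand stdExponent C := hC.isSimple_notMem_expand rfl
  have htp (k : ℕ) : tp k ∉ expand stdExponent C := hC.isSimple_notMem_expand rfl
  rcases hι with rfl | rfl
  · exact keep_map_eq_keep_singleton hS left_injective hcount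
      (by simp [outline, hx, hy, ht, hts, htp])
  · exact keep_map_eq_keep_singleton hS right_injective hcount
      (by simp [outline, hx, hy, ht, hts, htp])

theorem keep_map_tail (hj : j < m) {T : List Letter} (hT : tailWord m = ts 0 :: T)
    (hT₀ : ts 0 ∉ T) (hι : ι = left ∨ ι = right) : keep S (T.map ι) = keep S [ι (zs j)] := by
  have hcount : T.count (zs j) = 1 := by
    have hcount := (count_tailWord m (zs j)).trans (if_pos (zs_mem_tailWord.2 hj))
    rw [hT, List.count_cons] at hcount
    simpa using hcount
  have hmem {l : Letter} (hl : l ∉ tailWord m) : l ∉ T := List.not_mem_of_not_mem_cons (hT ▸ hl)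
  rcases hι with rfl | rfl
  · exact keep_map_eq_keep_singleton hS left_injective hcount (by simp [outline, hmem, hT₀])
  · exact keep_map_eq_keep_singleton hS right_injective hcount (by simp [outline, hmem, hT₀])

end Blocks

theorem keep_interlockedWord (hC : IsCore n m C) {j : ℕ} (hj : j < m) {i : ℕ} (hi : i < n)
    {S : List DoubleLetter} (hS : S ⊆ outline n j i) :
    keep S (interlockedWord n m C) = keep S (outline n j i) := by
  obtain ⟨T, hT, hT₀⟩ := exists_tailWord_eq_ts_zero_cons hC.m_pos
  have hlast : ¬ 2 * n - 1 < n := by omega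
  have hfirst : ¬ n ≤ i := by omega
  have htp {a i : ℕ} (ha : a ≤ i ∧ i < a + n) : (primedBlock a n).count (tp i) = 1 := by
    rw [count_primedBlock, if_pos (tp_mem_primedBlock.2 ha)]
  have hprimedLeft : keep S ((primedBlock 0 n).map left) = [] :=
    keep_map_eq_nil hS (by simp [outline, tp_mem_primedBlock, hlast])
  have hprimedRight : keep S ((primedBlock 0 n).map right) = keep S [right (tp i)] :=
    keep_map_eq_keep_singleton hS right_injective (htp (by omega)) (by simp [outline])
  have hprimedLeft' : keep S ((primedBlock n n).map left) = keep S [left (tp (2 * n - 1))] :=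
    keep_map_eq_keep_singleton hS left_injective (htp (by omega)) (by simp [outline])
  have hprimedRight' : keep S ((primedBlock n n).map right) = [] :=
    keep_map_eq_nil hS (by simp [outline, tp_mem_primedBlock, hfirst])
  have hblocks : interlockedWord n m C = (primedBlock 0 n).map left ++ ([left x, left y, left t] ++
      ((primedBlock 0 n).map right ++ ([cc] ++ ((primedBlock n n).map left ++
      ([left x, right x, right y] ++ ((expand stdExponent C).map left ++ ([left y, right t] ++
      ((primedBlock n n).map right ++ ([right x, dd, cc] ++ ((expand stdExponent C).map right ++
      ([right y, right (ts 0)] ++ (T.map right ++ ([left (ts 0)] ++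
      (T.map left ++ [dd])))))))))))))) := by
    simp [interlock, hT]
  rw [hblocks]
  simp only [keep_append]
  rw [hprimedLeft, hprimedRight, hprimedLeft', hprimedRight', keep_map_expand hS hC hj (.inl rfl),
    keep_map_expand hS hC hj (.inr rfl), keep_map_tail hS hj hT hT₀ (.inl rfl),
    keep_map_tail hS hj hT hT₀ (.inr rfl)]
  simp only [List.nil_append, ← keep_append]
  rfl

theorem keep_interlockedWord_eq (hC : IsCore n m C) {j : ℕ} (hj : j < m) {i : ℕ} (hi : i < n)
    {S pattern : List DoubleLetter} (hS : S ⊆ pattern)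
    (hpattern : keep S (outline n j i) = pattern) :
    keep S (interlockedWord n m C) = pattern :=
  (keep_interlockedWord hC hj hi fun _ hg => (mem_keep.1 (hpattern ▸ hS hg)).1).trans hpattern

end Outline

section Projections

variable {n m : ℕ} {C : List Letter} (hC : IsCore n m C) {v : List DoubleLetter}
  (hv : v ∈ entailedWords n m C)
include hC hv

theorem pairProj_cc_left_tp_last :
    pairProj cc (left (tp (2 * n - 1))) v = [cc, left (tp (2 * n - 1)), cc] :=
  pairProj_eq_straddle hv (by simp) (by simp [IsIndependent])
    (keep_interlockedWord_eq hC hC.m_pos hC.pos (by simp) (by simp [outline, keep_cons]))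

theorem pairProj_cc_right_t : pairProj cc (right t) v = [cc, right t, cc] :=
  pairProj_eq_straddle hv (by simp) (by simp [IsIndependent])
    (keep_interlockedWord_eq hC hC.m_pos hC.pos (by simp) (by simp [outline, keep_cons]))

theorem pairProj_dd_right_ts_zero : pairProj dd (right (ts 0)) v = [dd, right (ts 0), dd] :=
  pairProj_eq_straddle hv (by simp) (by simp [IsIndependent])
    (keep_interlockedWord_eq hC hC.m_pos hC.pos (by simp) (by simp [outline, keep_cons]))

theorem pairProj_dd_left_ts_zero : pairProj dd (left (ts 0)) v = [dd, left (ts 0), dd] :=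
  pairProj_eq_straddle hv (by simp) (by simp [IsIndependent])
    (keep_interlockedWord_eq hC hC.m_pos hC.pos (by simp) (by simp [outline, keep_cons]))

theorem pairProj_dd_right_t : pairProj dd (right t) v = [right t, dd, dd] :=
  pairProj_eq_after hC hv (τ := right (ts 0)) (by simp) (by simp [IsIndependent])
    (keep_interlockedWord_eq hC hC.m_pos hC.pos (by simp) (by simp [outline, keep_cons]))

theorem pairProj_cc_right_tp {i : ℕ} (hi : i < n) :
    pairProj cc (right (tp i)) v = [right (tp i), cc, cc] :=
  pairProj_eq_after hC hv (τ := right t) (by simp) (by simp [IsIndependent])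
    (keep_interlockedWord_eq hC hC.m_pos hi (by simp) (by simp [outline, keep_cons]))

theorem pairProj_left_x_right_t : pairProj (left x) (right t) v = [left x, left x, right t] :=
  pairProj_eq_before hC hv (τ := left t) (by simp) (by simp [IsIndependent])
    (keep_interlockedWord_eq hC hC.m_pos hC.pos (by simp) (by simp [outline, keep_cons]))

theorem pairProj_left_y_right_t : pairProj (left y) (right t) v = [left y, left y, right t] :=
  pairProj_eq_before hC hv (τ := left t) (by simp) (by simp [IsIndependent])
    (keep_interlockedWord_eq hC hC.m_pos hC.pos (by simp) (by simp [outline, keep_cons]))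

theorem pairProj_right_x_left_tp_last :
    pairProj (right x) (left (tp (2 * n - 1))) v = [left (tp (2 * n - 1)), right x, right x] :=
  pairProj_eq_after hC hv (τ := right t) (by simp) (by simp [IsIndependent])
    (keep_interlockedWord_eq hC hC.m_pos hC.pos (by simp) (by simp [outline, keep_cons]))

theorem pairProj_right_y_left_tp_last :
    pairProj (right y) (left (tp (2 * n - 1))) v = [left (tp (2 * n - 1)), right y, right y] :=
  pairProj_eq_after hC hv (τ := right t) (by simp) (by simp [IsIndependent])
    (keep_interlockedWord_eq hC hC.m_pos hC.pos (by simp) (by simp [outline, keep_cons]))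

theorem pairProj_left_zs_right_t {j : ℕ} (hj : j < m) :
    pairProj (left (zs j)) (right t) v = [left (zs j), right t, left (zs j)] :=
  pairProj_eq_straddle hv (by simp) (by simp [IsIndependent])
    (keep_interlockedWord_eq hC hj hC.pos (by simp) (by simp [outline, keep_cons]))

theorem pairProj_left_zs_right_ts_zero {j : ℕ} (hj : j < m) :
    pairProj (left (zs j)) (right (ts 0)) v = [left (zs j), right (ts 0), left (zs j)] :=
  pairProj_eq_straddle hv (by simp) (by simp [IsIndependent])
    (keep_interlockedWord_eq hC hj hC.pos (by simp) (by simp [outline, keep_cons]))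

theorem pairProj_left_zs_left_tp_last {j : ℕ} (hj : j < m) :
    pairProj (left (zs j)) (left (tp (2 * n - 1))) v =
      [left (tp (2 * n - 1)), left (zs j), left (zs j)] :=
  pairProj_eq_after hC hv (τ := right t) (by simp) (by simp [IsIndependent])
    (keep_interlockedWord_eq hC hj hC.pos (by simp) (by simp [outline, keep_cons]))

theorem pairProj_right_zs_left_ts_zero {j : ℕ} (hj : j < m) :
    pairProj (right (zs j)) (left (ts 0)) v = [right (zs j), right (zs j), left (ts 0)] :=
  pairProj_eq_before hC hv (τ := right (ts 0)) (by simp) (by simp [IsIndependent])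
    (keep_interlockedWord_eq hC hj hC.pos (by simp) (by simp [outline, keep_cons]))

theorem pairProj_left_x_right_x :
    pairProj (left x) (right x) v = [left x, left x, right x, right x] :=
  pairProj_eq_aabb hC hv (σ := left t) (τ := right t) (by simp) (by simp [IsIndependent])
    (keep_interlockedWord_eq hC hC.m_pos hC.pos (by simp) (by simp [outline, keep_cons]))

theorem pairProj_left_x_right_y :
    pairProj (left x) (right y) v = [left x, left x, right y, right y] :=
  pairProj_eq_aabb hC hv (σ := left t) (τ := right t) (by simp) (by simp [IsIndependent])
    (keep_interlockedWord_eq hC hC.m_pos hC.pos (by simp) (by simp [outline, keep_cons]))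

theorem pairProj_right_x_dd : pairProj (right x) dd v = [right x, right x, dd, dd] :=
  pairProj_eq_aabb hC hv (σ := right t) (τ := left (ts 0)) (by simp) (by simp [IsIndependent])
    (keep_interlockedWord_eq hC hC.m_pos hC.pos (by simp) (by simp [outline, keep_cons]))

theorem pairProj_cc_right_zs {j : ℕ} (hj : j < m) :
    pairProj cc (right (zs j)) v = [cc, cc, right (zs j), right (zs j)] :=
  pairProj_eq_aabb hC hv (σ := right t) (τ := right (ts 0)) (by simp) (by simp [IsIndependent])
    (keep_interlockedWord_eq hC hj hC.pos (by simp) (by simp [outline, keep_cons]))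

theorem pairProj_left_y_right_x :
    pairProj (left y) (right x) v = [left y, right x, left y, right x] :=
  pairProj_eq_abab hC hv (σ := left t) (τ := right t) (by simp) (by simp [IsIndependent])
    (keep_interlockedWord_eq hC hC.m_pos hC.pos (by simp) (by simp [outline, keep_cons]))

theorem pairProj_left_y_right_y :
    pairProj (left y) (right y) v = [left y, right y, left y, right y] :=
  pairProj_eq_abab hC hv (σ := left t) (τ := right t) (by simp) (by simp [IsIndependent])
    (keep_interlockedWord_eq hC hC.m_pos hC.pos (by simp) (by simp [outline, keep_cons]))

theorem pairProj_cc_dd : pairProj cc dd v = [cc, dd, cc, dd] :=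
  pairProj_eq_abab hC hv (σ := right t) (τ := left (ts 0)) (by simp) (by simp [IsIndependent])
    (keep_interlockedWord_eq hC hC.m_pos hC.pos (by simp) (by simp [outline, keep_cons]))

end Projections

section HasCopy

variable {n m : ℕ} {C : List Letter} {v : List DoubleLetter} {ι : Letter → DoubleLetter}
  {e : Letter → ℕ}

/-- The word `v`, restricted to the letters `ι l`, is a copy of the word of shape `C` with exponents
`e`, up to the order of `ι x` and `ι y`. -/
structure HasCopy (n m : ℕ) (C : List Letter) (v : List DoubleLetter) (ι : Letter → DoubleLetter)
    (e : Letter → ℕ) : Prop where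
  isAdmissible : IsAdmissible e
  injective : Function.Injective ι
  pairProj_eq : ∀ p q, ¬ (p = x ∧ q = y) → ¬ (p = y ∧ q = x) →
    pairProj (ι p) (ι q) v = (pairProj p q (expand e (shape n m C [x, y]))).map ι

theorem exists_hasCopy_left (hC : IsCore n m C) (hv : v ∈ entailedWords n m C) :
    ∃ e, HasCopy n m C v left e := by
  obtain ⟨e, he, heq⟩ := isEmbeddedCopy_left.exists_pairProj_eq_expand hC hv
  exact ⟨e, he, left_injective, heq⟩

theorem exists_hasCopy_right (hC : IsCore n m C) (hv : v ∈ entailedWords n m C) :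
    ∃ e, HasCopy n m C v right e := by
  obtain ⟨e, he, heq⟩ := isEmbeddedCopy_right.exists_pairProj_eq_expand hC hv
  exact ⟨e, he, right_injective, heq⟩

namespace HasCopy

theorem count (h : HasCopy n m C v ι e) (p : Letter) :
    v.count (ι p) = e p * (shape n m C [x, y]).count p := by
  have hcount := congrArg (List.count (ι p)) (h.pairProj_eq p p (by rintro ⟨rfl, hxy⟩; cases hxy)
    (by rintro ⟨rfl, hxy⟩; cases hxy))
  rwa [List.count_map_of_injective _ _ h.injective, count_pairProj_left, count_pairProj_left,
    count_expand] at hcount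

theorem mem_iff (h : HasCopy n m C v ι e) {p : Letter} : ι p ∈ v ↔ p ∈ shape n m C [x, y] := by
  rw [← List.count_pos_iff, ← List.count_pos_iff, h.count]
  exact Nat.mul_pos_iff_of_pos_left (h.isAdmissible.one_le p)

theorem liesAt (h : HasCopy n m C v ι e) (hC : IsCore n m C) {σ p : Letter}
    (hσ : isSimple σ = true) (hmem : σ ∈ shape n m C [x, y]) {r : Position}
    (hp : LiesAt (expand e (shape n m C [x, y])) σ p r) : LiesAt v (ι σ) (ι p) r := by
  have hproj := h.pairProj_eq σ p (by rintro ⟨rfl, -⟩; cases hσ) (by rintro ⟨rfl, -⟩; cases hσ)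
  exact .of_pairProj hproj
    ((hp.pairProj (hC.count_expand_of_isSimple h.isAdmissible hσ hmem)).map h.injective)

theorem isSeparated (h : HasCopy n m C v ι e) (hC : IsCore n m C) {S : DoubleLetter → Prop}
    (hS : ∀ σ, isSimple σ = true → S (ι σ)) {p q : Letter}
    (hsep : IsSeparated (isSimple · = true) (expand e (shape n m C [x, y])) p q) :
    IsSeparated S v (ι p) (ι q) := by
  obtain ⟨σ, r, r', hσ, hmem, hp, hq, hr⟩ := hsep
  have hmem := mem_of_mem_expand hmem
  exact ⟨ι σ, r, r', hS σ hσ, h.mem_iff.2 hmem, h.liesAt hC hσ hmem hp, h.liesAt hC hσ hmem hq, hr⟩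

end HasCopy

end HasCopy

theorem t_mem_shape {n m : ℕ} {C X : List Letter} : t ∈ shape n m C X := by
  simp [shape]

namespace IsAdmissible

variable {e : Letter → ℕ}

theorem mem_expand (he : IsAdmissible e) {L : List Letter} {l : Letter} (hl : l ∈ L) :
    l ∈ expand e L := by
  rw [← List.count_pos_iff, count_expand]
  exact Nat.mul_pos (he.one_le l) (List.count_pos_iff.2 hl)

theorem exists_pairProj_y_eq_append (he : IsAdmissible e) {n m : ℕ}
    {C : List Letter} {p : Letter} (hp : p ∉ tailWord m) :
    ∃ W, pairProj y p (expand e (shape n m C [x, y])) = W ++ [y] := by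
  have hshape : shape n m (expand e C) [x, y] = (primedBlock 0 n ++ ([x, y] ++
      (t :: (primedBlock n n ++ (x :: expand e C))))) ++ (y :: tailWord m) := by
    simp [shape]
  rw [he.expand_shape_xy, hshape, pairProj_append, pairProj_cons, if_pos (Or.inl rfl),
    pairProj_eq_nil y_notMem_tailWord hp]
  exact ⟨_, rfl⟩

end IsAdmissible

section Separation

variable {n m : ℕ} {C : List Letter}

namespace IsCore

variable (hC : IsCore n m C)
include hC

theorem zs_mem_shape {j : ℕ} : zs j ∈ shape n m C [x, y] ↔ j < m := by
  simp [← List.count_pos_iff, hC.count_shape, Nat.pos_iff_ne_zero]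

theorem zp_mem_shape {i : ℕ} : zp i ∈ shape n m C [x, y] ↔ i < 2 * n := by
  simp [← List.count_pos_iff, hC.count_shape, Nat.pos_iff_ne_zero]

theorem ts_mem_shape {j : ℕ} : ts j ∈ shape n m C [x, y] ↔ j < m := by
  simp [← List.count_pos_iff, hC.count_shape, Nat.pos_iff_ne_zero]

theorem tp_mem_shape {i : ℕ} : tp i ∈ shape n m C [x, y] ↔ i < 2 * n := by
  simp [← List.count_pos_iff, hC.count_shape, Nat.pos_iff_ne_zero]

theorem tp_last_mem_shape : tp (2 * n - 1) ∈ shape n m C [x, y] :=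
  hC.tp_mem_shape.2 (by have := hC.pos; omega)

variable {e : Letter → ℕ} (he : IsAdmissible e)
include he

theorem isSeparated_zs_zs {i j : ℕ} (hij : i < j) (hj : j < m) :
    IsSeparated (isSimple · = true) (expand e (shape n m C [x, y])) (zs i) (zs j) := by
  have hi := hC.liesAt_ts_zs he hj (hij.trans hj)
  have hj' := hC.liesAt_ts_zs he hj hj
  rw [if_pos hij] at hi
  rw [if_neg (lt_irrefl j)] at hj'
  exact ⟨ts j, _, _, rfl, he.mem_expand (hC.ts_mem_shape.2 hj), hi, hj', by simp⟩

theorem isSeparated_zp_zp {i j : ℕ} (hij : i < j) (hj : j < 2 * n) :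
    IsSeparated (isSimple · = true) (expand e (shape n m C [x, y])) (zp i) (zp j) :=
  ⟨tp i, _, _, rfl, he.mem_expand (hC.tp_mem_shape.2 (hij.trans hj)),
    hC.liesAt_tp_zp_straddle he (hij.trans hj), hC.liesAt_tp_zp_after he (hij.trans hj) hij,
    by simp⟩

theorem isSeparated_zs {i : ℕ} (hi : i < m) {q : Letter} (hq : isSimple q = false)
    (hz : ∀ j, q ≠ zs j) :
    IsSeparated (isSimple · = true) (expand e (shape n m C [x, y])) (zs i) q := by
  have hzs := hC.liesAt_ts_zs he hC.m_pos hi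
  rw [if_neg (Nat.not_lt_zero i)] at hzs
  exact ⟨ts 0, _, _, rfl, he.mem_expand (hC.ts_mem_shape.2 hC.m_pos), hzs,
    hC.liesAt_ts_before he hC.m_pos hq hz, by simp⟩

theorem isSeparated_zp {i : ℕ} (hi : i < 2 * n) {q : Letter} (hq : q = x ∨ q = y) :
    IsSeparated (isSimple · = true) (expand e (shape n m C [x, y])) (zp i) q := by
  by_cases hin : i < n
  · exact ⟨tp i, _, _, rfl, he.mem_expand (hC.tp_mem_shape.2 hi),
      hC.liesAt_tp_zp_straddle he hi, hC.liesAt_tp_after_of_lt he hin hq, by simp⟩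
  · refine ⟨t, _, _, rfl, he.mem_expand t_mem_shape,
      hC.liesAt_t_after he rfl (by simp) (by simp) fun j hj hij => ?_,
      hC.liesAt_t_straddle he (by tauto), by simp⟩
    injection hij with hij
    omega

theorem isSeparated_ys {i : ℕ} {q : Letter} (hq : q = x ∨ q = y ∨ ∃ j < 2 * n, q = zp j) :
    IsSeparated (isSimple · = true) (expand e (shape n m C [x, y])) (ys i) q :=
  ⟨tp (2 * n - 1), _, _, rfl, he.mem_expand hC.tp_last_mem_shape,
    hC.liesAt_tp_last_after he rfl (by simp) (by simp) (by simp),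
    hC.liesAt_tp_last_straddle he hq, by simp⟩

theorem isSeparated_or {p q : Letter} (hpq : p ≠ q) (hp : isSimple p = false)
    (hq : isSimple q = false) (hpmem : p ∈ shape n m C [x, y]) (hqmem : q ∈ shape n m C [x, y]) :
    IsSeparated (isSimple · = true) (expand e (shape n m C [x, y])) p q ∨
      (p = x ∧ q = y ∨ p = y ∧ q = x) ∨ ∃ i j, p = ys i ∧ q = ys j := by
  cases p <;> cases q <;> simp only [isSimple, reduceCtorEq] at hp hq
  case x.x | y.y => exact absurd rfl hpq
  case x.y | y.x => exact .inr (.inl (by simp))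
  case ys.ys i j => exact .inr (.inr ⟨i, j, rfl, rfl⟩)
  case zs.zs i j =>
    rcases lt_or_gt_of_ne fun hij => hpq (congrArg zs hij) with hij | hij
    · exact .inl (hC.isSeparated_zs_zs he hij (hC.zs_mem_shape.1 hqmem))
    · exact .inl (hC.isSeparated_zs_zs he hij (hC.zs_mem_shape.1 hpmem)).symm
  case zp.zp i j =>
    rcases lt_or_gt_of_ne fun hij => hpq (congrArg zp hij) with hij | hij
    · exact .inl (hC.isSeparated_zp_zp he hij (hC.zp_mem_shape.1 hqmem))
    · exact .inl (hC.isSeparated_zp_zp he hij (hC.zp_mem_shape.1 hpmem)).symm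
  case zs.x | zs.y | zs.ys | zs.zp =>
    exact .inl (hC.isSeparated_zs he (hC.zs_mem_shape.1 hpmem) rfl (by simp))
  case x.zs | y.zs | ys.zs | zp.zs =>
    exact .inl (hC.isSeparated_zs he (hC.zs_mem_shape.1 hqmem) rfl (by simp)).symm
  case zp.x | zp.y => exact .inl (hC.isSeparated_zp he (hC.zp_mem_shape.1 hpmem) (by simp))
  case x.zp | y.zp => exact .inl (hC.isSeparated_zp he (hC.zp_mem_shape.1 hqmem) (by simp)).symm
  case ys.zp => exact .inl (hC.isSeparated_ys he (by simp [hC.zp_mem_shape.1 hqmem]))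
  case zp.ys => exact .inl (hC.isSeparated_ys he (by simp [hC.zp_mem_shape.1 hpmem])).symm
  case ys.x | ys.y => exact .inl (hC.isSeparated_ys he (by simp))
  case x.ys | y.ys => exact .inl (hC.isSeparated_ys he (by simp)).symm

end IsCore

theorem HasCopy.eq_xy_of_linked {v : List DoubleLetter} {ι : Letter → DoubleLetter}
    {e : Letter → ℕ} (h : HasCopy n m C v ι e) (hC : IsCore n m C) {S : DoubleLetter → Prop}
    (hS : ∀ σ, isSimple σ = true → S (ι σ)) {p q : Letter} (hpq : p ≠ q)
    (hp : isSimple p = false) (hq : isSimple q = false) (hl : Linked S v (ι p) (ι q)) :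
    p = x ∧ q = y ∨ p = y ∧ q = x := by
  rcases hC.isSeparated_or h.isAdmissible hpq hp hq (h.mem_iff.1 hl.mem_left)
    (h.mem_iff.1 hl.symm.mem_left) with hsep | hxy | ⟨i, j, rfl, rfl⟩
  · exact absurd hl (h.isSeparated hC hS hsep).not_linked
  · exact hxy
  · have hne := h.injective.ne hpq
    have hproj := h.pairProj_eq (ys i) (ys j) (by simp) (by simp)
    obtain ⟨a, b, hys | hys⟩ := hC.pairProj_ys_ys h.isAdmissible fun hij => hpq (congrArg ys hij)
    · rw [hys, List.map_append, List.map_replicate, List.map_replicate] at hproj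
      exact absurd hl (not_linked_of_pairProj hne hproj)
    · rw [hys, List.map_append, List.map_replicate, List.map_replicate, pairProj_comm] at hproj
      exact absurd hl.symm (not_linked_of_pairProj hne.symm hproj)

end Separation

/-- The letters that occur once in the interlocked word. -/
def IsOnce : DoubleLetter → Prop
  | left l => isSimple l = true
  | right l => isSimple l = true
  | _ => False

section DoubleSeparation

variable {n m : ℕ} {C : List Letter} (hC : IsCore n m C) {v : List DoubleLetter}
  (hv : v ∈ entailedWords n m C)
include hC hv

theorem right_t_mem : right t ∈ v := by
  obtain ⟨e, h⟩ := exists_hasCopy_right hC hv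
  exact h.mem_iff.2 t_mem_shape

theorem right_ts_zero_mem : right (ts 0) ∈ v := by
  obtain ⟨e, h⟩ := exists_hasCopy_right hC hv
  exact h.mem_iff.2 (hC.ts_mem_shape.2 hC.m_pos)

theorem left_ts_zero_mem : left (ts 0) ∈ v := by
  obtain ⟨e, h⟩ := exists_hasCopy_left hC hv
  exact h.mem_iff.2 (hC.ts_mem_shape.2 hC.m_pos)

theorem left_tp_last_mem : left (tp (2 * n - 1)) ∈ v := by
  obtain ⟨e, h⟩ := exists_hasCopy_left hC hv
  exact h.mem_iff.2 hC.tp_last_mem_shape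

theorem liesAt_right_t_left {l : Letter} (hl : isSimple l = false) (hz : ∀ j, l ≠ zs j) :
    LiesAt v (right t) (left l) .before := by
  obtain ⟨e, h⟩ := exists_hasCopy_left hC hv
  have hy := liesAt_before_of_pairProj (by simp) (pairProj_left_y_right_t hC hv)
  by_cases hlx : l = x
  · exact hlx ▸ liesAt_before_of_pairProj (by simp) (pairProj_left_x_right_t hC hv)
  by_cases hly : l = y
  · exact hly ▸ hy
  have hltail : l ∉ tailWord m := fun hmem => by
    obtain ⟨i, -, rfl | rfl⟩ := mem_tailWord.1 hmem
    · cases hl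
    · exact hz i rfl
  obtain ⟨W, hW⟩ := h.isAdmissible.exists_pairProj_y_eq_append hltail
  have hproj := h.pairProj_eq y l (by simp) (by simp [hlx])
  rw [hW, List.map_append] at hproj
  exact liesAt_before_of_pairProj_eq_append (by simp) (by simpa using hly) hproj hy

theorem isSeparated_left_right {l l' : Letter} (hl : isSimple l = false) (hl' : isSimple l' = false)
    (hmem : left l ∈ v) : IsSeparated IsOnce v (left l) (right l') := by
  obtain ⟨e, h⟩ := exists_hasCopy_left hC hv
  obtain ⟨e', h'⟩ := exists_hasCopy_right hC hv
  have liesAt_t {r : Position} (hr : LiesAt (expand e' (shape n m C [x, y])) t l' r) :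
      LiesAt v (right t) (right l') r := h'.liesAt hC rfl t_mem_shape hr
  by_cases hz : ∃ j, l = zs j
  · obtain ⟨j, rfl⟩ := hz
    have hj := hC.zs_mem_shape.1 (h.mem_iff.1 hmem)
    by_cases hz' : ∃ j, l' = zs j
    · obtain ⟨j', rfl⟩ := hz'
      exact ⟨right t, _, _, rfl, right_t_mem hC hv,
        liesAt_straddle_of_pairProj (by simp) (pairProj_left_zs_right_t hC hv hj),
        liesAt_t (hC.liesAt_t_after h'.isAdmissible rfl (by simp) (by simp) (by simp)), by simp⟩
    · push Not at hz'
      exact ⟨right (ts 0), _, _, rfl, right_ts_zero_mem hC hv,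
        liesAt_straddle_of_pairProj (by simp) (pairProj_left_zs_right_ts_zero hC hv hj),
        h'.liesAt hC rfl (hC.ts_mem_shape.2 hC.m_pos)
          (hC.liesAt_ts_before h'.isAdmissible hC.m_pos hl' hz'), by simp⟩
  push Not at hz
  refine ⟨right t, .before, ?_⟩
  by_cases hxyz : l' = x ∨ l' = y ∨ ∃ i < n, l' = zp i
  · exact ⟨.straddle, rfl, right_t_mem hC hv, liesAt_right_t_left hC hv hl hz,
      liesAt_t (hC.liesAt_t_straddle h'.isAdmissible hxyz), by simp⟩
  · push Not at hxyz
    exact ⟨.after, rfl, right_t_mem hC hv, liesAt_right_t_left hC hv hl hz,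
      liesAt_t (hC.liesAt_t_after h'.isAdmissible hl' hxyz.1 hxyz.2.1 hxyz.2.2), by simp⟩

theorem isSeparated_left_cc {l : Letter} (hl : isSimple l = false) (hmem : left l ∈ v) :
    IsSeparated IsOnce v (left l) cc := by
  obtain ⟨e, h⟩ := exists_hasCopy_left hC hv
  by_cases hz : ∃ j, l = zs j
  · obtain ⟨j, rfl⟩ := hz
    have hj := hC.zs_mem_shape.1 (h.mem_iff.1 hmem)
    exact ⟨left (tp (2 * n - 1)), _, _, rfl, left_tp_last_mem hC hv,
      liesAt_after_of_pairProj (by simp) (pairProj_left_zs_left_tp_last hC hv hj),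
      liesAt_straddle_of_pairProj (by simp) (pairProj_cc_left_tp_last hC hv), by simp⟩
  · push Not at hz
    exact ⟨right t, _, _, rfl, right_t_mem hC hv, liesAt_right_t_left hC hv hl hz,
      liesAt_straddle_of_pairProj (by simp) (pairProj_cc_right_t hC hv), by simp⟩

theorem isSeparated_left_dd {l : Letter} (hl : isSimple l = false) (hmem : left l ∈ v) :
    IsSeparated IsOnce v (left l) dd := by
  obtain ⟨e, h⟩ := exists_hasCopy_left hC hv
  have hdd := liesAt_after_of_pairProj (by simp) (pairProj_dd_right_t hC hv)
  by_cases hz : ∃ j, l = zs j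
  · obtain ⟨j, rfl⟩ := hz
    exact ⟨right t, _, _, rfl, right_t_mem hC hv, liesAt_straddle_of_pairProj (by simp)
      (pairProj_left_zs_right_t hC hv (hC.zs_mem_shape.1 (h.mem_iff.1 hmem))), hdd, by simp⟩
  · push Not at hz
    exact ⟨right t, _, _, rfl, right_t_mem hC hv, liesAt_right_t_left hC hv hl hz, hdd, by simp⟩

theorem isSeparated_right_cc {l : Letter} (hl : isSimple l = false) :
    IsSeparated IsOnce v (right l) cc := by
  obtain ⟨e, h⟩ := exists_hasCopy_right hC hv
  have hcc := liesAt_straddle_of_pairProj (by simp) (pairProj_cc_left_tp_last hC hv)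
  by_cases hxyz : l = x ∨ l = y ∨ ∃ i < n, l = zp i
  · obtain rfl | rfl | ⟨i, hi, rfl⟩ := hxyz
    · exact ⟨left (tp (2 * n - 1)), _, _, rfl, left_tp_last_mem hC hv,
        liesAt_after_of_pairProj (by simp) (pairProj_right_x_left_tp_last hC hv), hcc, by simp⟩
    · exact ⟨left (tp (2 * n - 1)), _, _, rfl, left_tp_last_mem hC hv,
        liesAt_after_of_pairProj (by simp) (pairProj_right_y_left_tp_last hC hv), hcc, by simp⟩
    · have hi' : i < 2 * n := by omega
      have htp := hC.tp_mem_shape.2 hi'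
      exact ⟨right (tp i), _, _, rfl, h.mem_iff.2 htp,
        h.liesAt hC rfl htp (hC.liesAt_tp_zp_straddle h.isAdmissible hi'),
        liesAt_after_of_pairProj (by simp) (pairProj_cc_right_tp hC hv hi), by simp⟩
  · push Not at hxyz
    exact ⟨right t, _, _, rfl, right_t_mem hC hv, h.liesAt hC rfl t_mem_shape
      (hC.liesAt_t_after h.isAdmissible hl hxyz.1 hxyz.2.1 hxyz.2.2),
      liesAt_straddle_of_pairProj (by simp) (pairProj_cc_right_t hC hv), by simp⟩

theorem isSeparated_right_dd {l : Letter} (hl : isSimple l = false) (hmem : right l ∈ v) :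
    IsSeparated IsOnce v (right l) dd := by
  obtain ⟨e, h⟩ := exists_hasCopy_right hC hv
  by_cases hz : ∃ j, l = zs j
  · obtain ⟨j, rfl⟩ := hz
    exact ⟨left (ts 0), _, _, rfl, left_ts_zero_mem hC hv, liesAt_before_of_pairProj (by simp)
      (pairProj_right_zs_left_ts_zero hC hv (hC.zs_mem_shape.1 (h.mem_iff.1 hmem))),
      liesAt_straddle_of_pairProj (by simp) (pairProj_dd_left_ts_zero hC hv), by simp⟩
  · push Not at hz
    exact ⟨right (ts 0), _, _, rfl, right_ts_zero_mem hC hv,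
      h.liesAt hC rfl (hC.ts_mem_shape.2 hC.m_pos)
        (hC.liesAt_ts_before h.isAdmissible hC.m_pos hl hz),
      liesAt_straddle_of_pairProj (by simp) (pairProj_dd_right_ts_zero hC hv), by simp⟩

theorem isSeparated_cc_dd : IsSeparated IsOnce v cc dd :=
  ⟨right t, _, _, rfl, right_t_mem hC hv,
    liesAt_straddle_of_pairProj (by simp) (pairProj_cc_right_t hC hv),
    liesAt_after_of_pairProj (by simp) (pairProj_dd_right_t hC hv), by simp⟩

theorem eq_xy_of_linked {p q : DoubleLetter} (hpq : p ≠ q) (hp : ¬ IsOnce p) (hq : ¬ IsOnce q)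
    (hl : Linked IsOnce v p q) :
    (p = left x ∧ q = left y ∨ p = left y ∧ q = left x) ∨
      (p = right x ∧ q = right y ∨ p = right y ∧ q = right x) := by
  obtain ⟨e, h⟩ := exists_hasCopy_left hC hv
  obtain ⟨e', h'⟩ := exists_hasCopy_right hC hv
  have hsep {p q : DoubleLetter} (hsep : IsSeparated IsOnce v p q) (hl : Linked IsOnce v p q) :
      False := hsep.not_linked hl
  have hpv := hl.mem_left
  have hqv := hl.symm.mem_left
  rcases p with l | l | _ | _ <;> rcases q with l' | l' | _ | _ <;>
    simp only [IsOnce, Bool.not_eq_true, not_false_eq_true] at hp hq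
  · have hxy := h.eq_xy_of_linked hC (fun σ hσ => hσ) (fun heq => hpq (by rw [heq])) hp hq hl
    exact .inl (by simpa using hxy)
  · exact (hsep (isSeparated_left_right hC hv hp hq hpv) hl).elim
  · exact (hsep (isSeparated_left_cc hC hv hp hpv) hl).elim
  · exact (hsep (isSeparated_left_dd hC hv hp hpv) hl).elim
  · exact (hsep (isSeparated_left_right hC hv hq hp hqv) hl.symm).elim
  · have hxy := h'.eq_xy_of_linked hC (fun σ hσ => hσ) (fun heq => hpq (by rw [heq])) hp hq hl
    exact .inr (by simpa using hxy)
  · exact (hsep (isSeparated_right_cc hC hv hp) hl).elim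
  · exact (hsep (isSeparated_right_dd hC hv hp hpv) hl).elim
  · exact (hsep (isSeparated_left_cc hC hv hq hqv) hl.symm).elim
  · exact (hsep (isSeparated_right_cc hC hv hq) hl.symm).elim
  · exact absurd rfl hpq
  · exact (hsep (isSeparated_cc_dd hC hv) hl).elim
  · exact (hsep (isSeparated_left_dd hC hv hq hqv) hl.symm).elim
  · exact (hsep (isSeparated_right_dd hC hv hq hqv) hl.symm).elim
  · exact (hsep (isSeparated_cc_dd hC hv) hl.symm).elim
  · exact absurd rfl hpq

end DoubleSeparation

section FlatMap

variable {α β : Type*}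

theorem count_mul_count_le_count_flatMap [DecidableEq α] [DecidableEq β] (φ : α → List β)
    (L : List α) (g : α) (p : β) : L.count g * (φ g).count p ≤ (L.flatMap φ).count p := by
  induction L with
  | nil => simp
  | cons a L ih =>
    rw [List.flatMap_cons, List.count_append, List.count_cons]
    by_cases hag : a = g
    · subst hag
      simp only [beq_self_eq_true, if_true, add_mul, one_mul]
      omega
    · simp only [beq_iff_eq, hag, if_false, add_zero]
      omega

theorem exists_eq_append_of_two_le_count [DecidableEq α] {L : List α} {g : α}
    (h : 2 ≤ L.count g) : ∃ L₀ L₁ L₂, L = L₀ ++ g :: (L₁ ++ g :: L₂) := by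
  obtain ⟨L₀, R, rfl, hL₀⟩ :=
    List.eq_append_cons_of_mem (List.count_pos_iff.1 (by omega : 0 < L.count g))
  rw [List.count_append, List.count_eq_zero.2 hL₀, List.count_cons_self] at h
  obtain ⟨L₁, L₂, rfl⟩ := List.append_of_mem (List.count_pos_iff.1 (by omega : 0 < R.count g))
  exact ⟨L₀, L₁, L₂, rfl⟩

end FlatMap

section Images

variable {n m : ℕ} {C : List Letter} {v : List DoubleLetter}

namespace HasCopy

variable {ι : Letter → DoubleLetter} {e : Letter → ℕ} (h : HasCopy n m C v ι e)
  (hC : IsCore n m C)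
include h hC

theorem pairProj_x_zs {j : ℕ} (hj : j < m) :
    pairProj (ι x) (ι (zs j)) v = [ι x, ι x, ι (zs j), ι (zs j)] := by
  rw [h.pairProj_eq x (zs j) (by simp) (by simp), hC.pairProj_x_zs h.isAdmissible hj]
  rfl

theorem pairProj_y_zs {j : ℕ} (hj : j < m) :
    pairProj (ι y) (ι (zs j)) v = [ι y, ι (zs j), ι y, ι (zs j)] := by
  rw [h.pairProj_eq y (zs j) (by simp) (by simp), hC.pairProj_y_zs h.isAdmissible hj]
  rfl

theorem count_x : v.count (ι x) = 2 := by
  rw [h.count, h.isAdmissible.eq_one x rfl]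
  simp [hC.count_shape]

theorem count_y : v.count (ι y) = 2 := by
  rw [h.count, h.isAdmissible.eq_one y rfl]
  simp [hC.count_shape]

theorem count_le_one_of_isSimple {l : Letter} (hl : isSimple l = true) : v.count (ι l) ≤ 1 := by
  by_cases hmem : l ∈ shape n m C [x, y]
  · rw [h.count, h.isAdmissible.eq_one l (isSquared_eq_false_of_isSimple hl), one_mul,
      hC.count_shape_of_isSimple hl hmem]
  · simp [List.count_eq_zero.2 (mt h.mem_iff.1 hmem)]

theorem count_x_prefix_eq_two {L R : List DoubleLetter} (hv : v = L ++ R)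
    (hy : L.count (ι y) = 2) : L.count (ι x) = 2 := by
  have hxz := count_prefix_of_aabb (h.injective.ne (by simp)) (h.pairProj_x_zs hC hC.m_pos) hv
  have hyz := count_prefix_of_abab (h.injective.ne (by simp)) (h.pairProj_y_zs hC hC.m_pos) hv
  omega

end HasCopy

theorem count_le_one_of_isOnce (hC : IsCore n m C) (hv : v ∈ entailedWords n m C)
    {p : DoubleLetter} (hp : IsOnce p) : v.count p ≤ 1 := by
  obtain ⟨e, h⟩ := exists_hasCopy_left hC hv
  obtain ⟨e', h'⟩ := exists_hasCopy_right hC hv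
  rcases p with l | l | _ | _
  · exact h.count_le_one_of_isSimple hC hp
  · exact h'.count_le_one_of_isSimple hC hp
  · exact hp.elim
  · exact hp.elim

variable {φ : DoubleLetter → List DoubleLetter} {u : List DoubleLetter} (hu : u.flatMap φ <:+: v)

include hu in
theorem count_mul_count_le_count (g p : DoubleLetter) :
    u.count g * (φ g).count p ≤ v.count p :=
  (count_mul_count_le_count_flatMap φ u g p).trans (hu.sublist.count_le p)

include hu in
theorem image_eq_singleton {g p : DoubleLetter} (hg : 2 ≤ u.count g) (hp : p ∈ φ g)
    (hcount : v.count p ≤ 2) (heq : ∀ q ∈ φ g, q = p) : φ g = [p] := by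
  have hpos := List.length_pos_of_mem hp
  have hmul := (Nat.mul_le_mul_right _ hg).trans (count_mul_count_le_count hu g p)
  rw [List.count_eq_length.2 fun q hq => (heq q hq).symm] at hmul
  rw [List.eq_replicate_of_mem heq, show (φ g).length = 1 by omega, List.replicate_one]

variable (hC : IsCore n m C) (hv : v ∈ entailedWords n m C)
include hC hv hu

theorem not_isOnce_of_mem_image {g p : DoubleLetter} (hg : 2 ≤ u.count g) (hp : p ∈ φ g) :
    ¬ IsOnce p := fun h => by
  have hmul := (Nat.mul_le_mul hg (List.count_pos_iff.2 hp)).trans (count_mul_count_le_count hu g p)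
  have := count_le_one_of_isOnce hC hv h
  omega

theorem linked_of_mem_image {g : DoubleLetter} (hg : 2 ≤ u.count g) {p q : DoubleLetter}
    (hp : p ∈ φ g) (hq : q ∈ φ g) : Linked IsOnce v p q := by
  have hS : ∀ r ∈ φ g, ¬ IsOnce r := fun r => not_isOnce_of_mem_image hu hC hv hg
  obtain ⟨pre, post, rfl⟩ := hu
  obtain ⟨u₀, u₁, u₂, rfl⟩ := exists_eq_append_of_two_le_count hg
  refine ⟨pre ++ u₀.flatMap φ, φ g, u₁.flatMap φ, φ g, u₂.flatMap φ ++ post, ?_, ⟨hp, hq, hp, hq⟩,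
    hS, hS⟩
  simp [List.flatMap_append, List.flatMap_cons]

omit hv in
theorem HasCopy.zs_mem_image {ι : Letter → DoubleLetter} {e : Letter → ℕ}
    (h : HasCopy n m C v ι e) {g : DoubleLetter} (hg : 2 ≤ u.count g) (hx : ι x ∈ φ g)
    (hy : ι y ∈ φ g) : ι (zs 0) ∈ φ g := by
  obtain ⟨pre, post, rfl⟩ := hu
  obtain ⟨u₀, u₁, u₂, rfl⟩ := exists_eq_append_of_two_le_count hg
  have hbefore : pre ++ (u₀ ++ g :: (u₁ ++ g :: u₂)).flatMap φ ++ post =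
      (pre ++ u₀.flatMap φ ++ φ g ++ u₁.flatMap φ) ++ (φ g ++ (u₂.flatMap φ ++ post)) := by
    simp [List.flatMap_append, List.flatMap_cons]
  have hafter := hbefore.trans (List.append_assoc _ (φ g) _).symm
  by_contra hz
  have hcx := h.count_x hC
  have hcy := h.count_y hC
  have hxz := count_prefix_of_aabb (h.injective.ne (by simp)) (h.pairProj_x_zs hC hC.m_pos) hbefore
  have hyz := count_prefix_of_abab (h.injective.ne (by simp)) (h.pairProj_y_zs hC hC.m_pos) hafter
  have hx := List.count_pos_iff.2 hx
  have hy := List.count_pos_iff.2 hy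
  have hz := List.count_eq_zero.2 hz
  rw [hbefore] at hcx hcy
  simp only [List.count_append] at hcx hcy hxz hyz
  omega

theorem eq_of_mem_image {g : DoubleLetter} (hg : 2 ≤ u.count g) :
    ∀ p ∈ φ g, ∀ q ∈ φ g, p = q := by
  have not_mem_of_x_mem {ι : Letter → DoubleLetter} {e : Letter → ℕ} (h : HasCopy n m C v ι e)
      (hι : ι = left ∨ ι = right) (hx : ι x ∈ φ g) : ι y ∉ φ g := fun hy => by
    have hz := h.zs_mem_image hu hC hg hx hy
    have hxz := eq_xy_of_linked hC hv (h.injective.ne (by simp))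
      (not_isOnce_of_mem_image hu hC hv hg hx) (not_isOnce_of_mem_image hu hC hv hg hz)
      (linked_of_mem_image hu hC hv hg hx hz)
    rcases hι with rfl | rfl <;> simp at hxz
  obtain ⟨e, h⟩ := exists_hasCopy_left hC hv
  obtain ⟨e', h'⟩ := exists_hasCopy_right hC hv
  intro p hp q hq
  by_contra hpq
  rcases eq_xy_of_linked hC hv hpq (not_isOnce_of_mem_image hu hC hv hg hp)
    (not_isOnce_of_mem_image hu hC hv hg hq) (linked_of_mem_image hu hC hv hg hp hq) with
    (⟨rfl, rfl⟩ | ⟨rfl, rfl⟩) | (⟨rfl, rfl⟩ | ⟨rfl, rfl⟩)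
  · exact not_mem_of_x_mem h (.inl rfl) hp hq
  · exact not_mem_of_x_mem h (.inl rfl) hq hp
  · exact not_mem_of_x_mem h' (.inr rfl) hp hq
  · exact not_mem_of_x_mem h' (.inr rfl) hq hp

section SwappedPair

variable {ξ η : DoubleLetter} {X u₀ u₁ M u₂ : List DoubleLetter}
  (hsplit : u = (u₀ ++ (X ++ u₁)) ++ ξ :: (M ++ η :: u₂)) (hX : X.Perm [ξ, η])
include hsplit hX

omit hu hC hv in
theorem two_le_count_of_swappedPair : 2 ≤ u.count ξ ∧ 2 ≤ u.count η := by
  have hξ : 0 < X.count ξ := List.count_pos_iff.2 (hX.mem_iff.2 (by simp))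
  have hη : 0 < X.count η := List.count_pos_iff.2 (hX.mem_iff.2 (by simp))
  simp only [hsplit, List.count_append, List.count_cons, beq_self_eq_true, if_true]
  omega

theorem linked_of_swappedPair (hM : ∀ g ∈ M, 2 ≤ u.count g) {p q : DoubleLetter}
    (hp : p ∈ φ ξ) (hq : q ∈ φ η) : Linked IsOnce v p q := by
  obtain ⟨hξ, hη⟩ := two_le_count_of_swappedPair hsplit hX
  have hS {g : DoubleLetter} (hg : 2 ≤ u.count g) : ∀ r ∈ φ g, ¬ IsOnce r :=
    fun r => not_isOnce_of_mem_image hu hC hv hg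
  have hSX : ∀ g ∈ X, 2 ≤ u.count g := fun g hg => by
    obtain rfl | rfl : g = ξ ∨ g = η := by simpa using hX.mem_iff.1 hg
    · exact hξ
    · exact hη
  have hSM : ∀ g ∈ ξ :: (M ++ [η]), 2 ≤ u.count g := fun g hg => by
    simp only [List.mem_cons, List.mem_append, List.not_mem_nil, or_false] at hg
    obtain rfl | hg | rfl := hg
    · exact hξ
    · exact hM g hg
    · exact hη
  obtain ⟨pre, post, hv'⟩ := hu
  refine ⟨pre ++ u₀.flatMap φ, X.flatMap φ, u₁.flatMap φ, (ξ :: (M ++ [η])).flatMap φ,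
    u₂.flatMap φ ++ post, ?_, ⟨?_, ?_, ?_, ?_⟩, fun r hr => ?_, fun r hr => ?_⟩
  · rw [← hv', hsplit]
    simp [List.flatMap_append, List.flatMap_cons]
  · exact List.mem_flatMap.2 ⟨ξ, hX.mem_iff.2 (by simp), hp⟩
  · exact List.mem_flatMap.2 ⟨η, hX.mem_iff.2 (by simp), hq⟩
  · simp [hp]
  · simp [hq]
  · obtain ⟨g, hg, hr⟩ := List.mem_flatMap.1 hr
    exact hS (hSX g hg) r hr
  · obtain ⟨g, hg, hr⟩ := List.mem_flatMap.1 hr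
    exact hS (hSM g hg) r hr

omit hv in
theorem HasCopy.not_mem_image_of_y_mem {ι : Letter → DoubleLetter} {e : Letter → ℕ}
    (h : HasCopy n m C v ι e) (hy : ι y ∈ φ ξ) : ι x ∉ φ η := fun hx => by
  obtain ⟨pre, post, hv⟩ := hu
  have hξX : 0 < X.count ξ := List.count_pos_iff.2 (hX.mem_iff.2 (by simp))
  have hprefix : v = (pre ++ u₀.flatMap φ ++ X.flatMap φ ++ u₁.flatMap φ ++ φ ξ) ++
      (M.flatMap φ ++ (φ η ++ (u₂.flatMap φ ++ post))) := by
    rw [← hv, hsplit]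
    simp [List.flatMap_append, List.flatMap_cons]
  have hcx := h.count_x hC
  have hcy := h.count_y hC
  have hyξ := List.count_pos_iff.2 hy
  have hxη := List.count_pos_iff.2 hx
  have hyX := (Nat.mul_le_mul hξX hyξ).trans (count_mul_count_le_count_flatMap φ X ξ (ι y))
  have hxy := h.count_x_prefix_eq_two hC hprefix
  rw [hprefix] at hcx hcy
  simp only [List.count_append] at hcx hcy hxy
  have := hxy (by omega)
  omega

/-- Letters `p` of `φ ξ` and `q` of `φ η` are linked. Hence they are `ι x` and `ι y` for one of the
two copies unless they always coincide, in which case both images are powers of the same letter. -/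
theorem commute_or_image_eq (hM : ∀ g ∈ M, 2 ≤ u.count g) :
    φ ξ ++ φ η = φ η ++ φ ξ ∨ ∃ ι, (ι = left ∨ ι = right) ∧ φ ξ = [ι x] ∧ φ η = [ι y] := by
  by_cases hξ : φ ξ = []
  · exact .inl (by simp [hξ])
  by_cases hη : φ η = []
  · exact .inl (by simp [hη])
  obtain ⟨p, hp⟩ := List.exists_mem_of_ne_nil _ hξ
  obtain ⟨q, hq⟩ := List.exists_mem_of_ne_nil _ hη
  obtain ⟨hcξ, hcη⟩ := two_le_count_of_swappedPair hsplit hX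
  have heqp : ∀ r ∈ φ ξ, r = p := fun r hr => eq_of_mem_image hu hC hv hcξ r hr p hp
  have heqq : ∀ r ∈ φ η, r = q := fun r hr => eq_of_mem_image hu hC hv hcη r hr q hq
  by_cases hpq : p = q
  · subst hpq
    rw [List.eq_replicate_of_mem heqp, List.eq_replicate_of_mem heqq]
    exact .inl (by simp [List.replicate_append_replicate, add_comm])
  have eq_singleton {ι : Letter → DoubleLetter} {e : Letter → ℕ} (h : HasCopy n m C v ι e)
      (hpx : p = ι x) (hqy : q = ι y) : φ ξ = [ι x] ∧ φ η = [ι y] := by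
    subst hpx hqy
    exact ⟨image_eq_singleton hu hcξ hp (h.count_x hC).le heqp,
      image_eq_singleton hu hcη hq (h.count_y hC).le heqq⟩
  obtain ⟨e, h⟩ := exists_hasCopy_left hC hv
  obtain ⟨e', h'⟩ := exists_hasCopy_right hC hv
  rcases eq_xy_of_linked hC hv hpq (not_isOnce_of_mem_image hu hC hv hcξ hp)
    (not_isOnce_of_mem_image hu hC hv hcη hq)
    (linked_of_swappedPair hu hC hv hsplit hX hM hp hq) with
    (⟨hpx, hqy⟩ | ⟨rfl, rfl⟩) | (⟨hpx, hqy⟩ | ⟨rfl, rfl⟩)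
  · exact .inr ⟨left, .inl rfl, eq_singleton h hpx hqy⟩
  · exact absurd hq (h.not_mem_image_of_y_mem hu hC hsplit hX hp)
  · exact .inr ⟨right, .inr rfl, eq_singleton h' hpx hqy⟩
  · exact absurd hq (h'.not_mem_image_of_y_mem hu hC hsplit hX hp)

end SwappedPair

end Images

theorem two_le_count_of_mem {α : Type*} [DecidableEq α] {A M B : List α} {ξ η g : α} (hg : g ∈ M)
    (h : g ∈ A ∨ g ∈ B ∨ 2 ≤ M.count g) : 2 ≤ (A ++ ξ :: (M ++ η :: B)).count g := by
  have hM := List.count_pos_iff.2 hg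
  simp only [List.count_append, List.count_cons]
  rcases h with h | h | h
  · have := List.count_pos_iff.2 h
    omega
  · have := List.count_pos_iff.2 h
    omega
  · omega

section Splits

variable {n m : ℕ} {C : List Letter}

/-- The part of the interlocked word between the first occurrences of `x` and `y` in the left copy
and the second occurrence of `x` in that copy. -/
def leftMiddle (n : ℕ) : List DoubleLetter :=
  left t :: ((primedBlock 0 n).map right ++ (cc :: (primedBlock n n).map left))

/-- The part of the interlocked word after the second occurrence of `y` in the left copy. -/
def leftEnd (n m : ℕ) (C : List Letter) : List DoubleLetter :=
  right t :: ((primedBlock n n).map right ++ (right x :: dd :: cc ::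
    ((expand stdExponent C).map right ++ (right y :: ((tailWord m).map right ++
    ((tailWord m).map left ++ [dd]))))))

/-- The part of the interlocked word between the first occurrences of `x` and `y` in the right copy
and the second occurrence of `x` in that copy. -/
def rightMiddle (n : ℕ) (C : List Letter) : List DoubleLetter :=
  (expand stdExponent C).map left ++ (left y :: right t :: (primedBlock n n).map right)

theorem interlock_eq_left (X Y : List DoubleLetter) : interlock n m C X Y =
    ((primedBlock 0 n).map left ++ (X ++ leftMiddle n)) ++ left x ::
      ((Y ++ (expand stdExponent C).map left) ++ left y :: leftEnd n m C) := by
  simp [interlock, leftMiddle, leftEnd]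

theorem interlock_eq_right (X Y : List DoubleLetter) : interlock n m C X Y =
    (((primedBlock 0 n).map left ++ (X ++ (leftMiddle n ++ [left x]))) ++ (Y ++ rightMiddle n C)) ++
      right x :: (([dd, cc] ++ (expand stdExponent C).map right) ++ right y ::
      ((tailWord m).map right ++ ((tailWord m).map left ++ [dd]))) := by
  simp [interlock, leftMiddle, rightMiddle]

namespace IsCore

variable (hC : IsCore n m C)
include hC

theorem zp_mem_expand {i : ℕ} (hi : i < 2 * n) : zp i ∈ expand stdExponent C :=
  isAdmissible_stdExponent.mem_expand ((hC.zp_mem i).2 hi)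

theorem zs_mem_expand {j : ℕ} (hj : j < m) : zs j ∈ expand stdExponent C :=
  isAdmissible_stdExponent.mem_expand ((hC.zs_mem j).2 hj)

theorem cases_of_mem_expand {l : Letter} (hl : l ∈ expand stdExponent C) :
    (∃ j < m, l = zs j) ∨ (∃ i < 2 * n, l = zp i) ∨ (expand stdExponent C).count l = 2 := by
  have hlC := mem_of_mem_expand hl
  cases l with
  | x => exact absurd hlC hC.x_notMem
  | y => exact absurd hlC hC.y_notMem
  | t => exact absurd hlC (hC.isSimple_notMem _ rfl)
  | ts i => exact absurd hlC (hC.isSimple_notMem _ rfl)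
  | tp i => exact absurd hlC (hC.isSimple_notMem _ rfl)
  | zs j => exact .inl ⟨j, (hC.zs_mem j).1 hlC, rfl⟩
  | zp i => exact .inr (.inl ⟨i, (hC.zp_mem i).1 hlC, rfl⟩)
  | ys i =>
    refine .inr (.inr ?_)
    rw [count_expand, hC.count, if_pos hlC]
    rfl

theorem cases_of_count_eq_one {ι : Letter → DoubleLetter} (hι : ι.Injective) {N : List DoubleLetter}
    {g : DoubleLetter} (hg : (N ++ (expand stdExponent C).map ι).count g = 1) :
    g ∈ N ∨ (∃ j < m, g = ι (zs j)) ∨ ∃ i < 2 * n, g = ι (zp i) := by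
  rcases List.mem_append.1 (List.count_pos_iff.1 (hg.symm ▸ Nat.one_pos)) with hN | hmap
  · exact .inl hN
  obtain ⟨l, hl, rfl⟩ := List.mem_map.1 hmap
  rcases hC.cases_of_mem_expand hl with ⟨j, hj, rfl⟩ | ⟨i, hi, rfl⟩ | hcount
  · exact .inr (.inl ⟨j, hj, rfl⟩)
  · exact .inr (.inr ⟨i, hi, rfl⟩)
  · rw [List.count_append, List.count_map_of_injective _ _ hι] at hg
    omega

end IsCore

theorem zp_mem_primedBlock_or {i : ℕ} (hi : i < 2 * n) :
    zp i ∈ primedBlock 0 n ∨ zp i ∈ primedBlock n n := by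
  rw [zp_mem_primedBlock, zp_mem_primedBlock]
  omega

theorem left_zp_mem (X : List DoubleLetter) {i : ℕ} (hi : i < 2 * n) :
    left (zp i) ∈ (primedBlock 0 n).map left ++ (X ++ leftMiddle n) := by
  rcases zp_mem_primedBlock_or hi with h | h <;> simp [leftMiddle, h]

theorem right_zp_mem (X Y : List DoubleLetter) {i : ℕ} (hi : i < 2 * n) :
    right (zp i) ∈ ((primedBlock 0 n).map left ++ (X ++ (leftMiddle n ++ [left x]))) ++
      (Y ++ rightMiddle n C) := by
  rcases zp_mem_primedBlock_or hi with h | h <;> simp [leftMiddle, rightMiddle, h]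

theorem left_zs_mem_leftEnd {j : ℕ} (hj : j < m) : left (zs j) ∈ leftEnd n m C := by
  simp [leftEnd, zs_mem_tailWord, hj]

variable (hC : IsCore n m C) {X Y : List DoubleLetter} {g : DoubleLetter}
include hC

theorem two_le_count_interlock_left (hY : Y.Perm [right x, right y])
    (hg : g ∈ Y ++ (expand stdExponent C).map left) : 2 ≤ (interlock n m C X Y).count g := by
  rw [interlock_eq_left]
  refine two_le_count_of_mem hg ?_
  rcases List.mem_append.1 hg with hgY | hgC
  · obtain rfl | rfl : g = right x ∨ g = right y := by simpa using hY.mem_iff.1 hgY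
    · exact .inr (.inl (by simp [leftEnd]))
    · exact .inr (.inl (by simp [leftEnd]))
  · obtain ⟨l, hl, rfl⟩ := List.mem_map.1 hgC
    rcases hC.cases_of_mem_expand hl with ⟨j, hj, rfl⟩ | ⟨i, hi, rfl⟩ | hcount
    · exact .inr (.inl (left_zs_mem_leftEnd hj))
    · exact .inl (left_zp_mem X hi)
    · refine .inr (.inr ?_)
      rw [List.count_append, List.count_map_of_injective _ _ left_injective]
      omega

theorem two_le_count_interlock_right (hg : g ∈ [dd, cc] ++ (expand stdExponent C).map right) :
    2 ≤ (interlock n m C X Y).count g := by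
  rw [interlock_eq_right]
  refine two_le_count_of_mem hg ?_
  rcases List.mem_append.1 hg with hglink | hgC
  · obtain rfl | rfl : g = dd ∨ g = cc := by simpa using hglink
    · exact .inr (.inl (by simp))
    · exact .inl (by simp [leftMiddle])
  · obtain ⟨l, hl, rfl⟩ := List.mem_map.1 hgC
    rcases hC.cases_of_mem_expand hl with ⟨j, hj, rfl⟩ | ⟨i, hi, rfl⟩ | hcount
    · exact .inr (.inl (by simp [zs_mem_tailWord, hj]))
    · exact .inl (right_zp_mem X Y hi)
    · refine .inr (.inr ?_)
      rw [List.count_append, List.count_map_of_injective _ _ right_injective]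
      omega

end Splits

section Occurrences

variable {α β : Type*} [DecidableEq α] {v S T R : List α} {a b p : α}

theorem mem_of_pairProj_eq_cons {q : α} {L : List α} (h : pairProj p q v = q :: L)
    (hpq : p ≠ q) (hv : v = S ++ R) (hp : p ∈ S) : q ∈ S := by
  by_contra hq
  rw [hv, pairProj_append, pairProj_eq_replicate_left hq] at h
  obtain ⟨k, hk⟩ := Nat.exists_eq_add_of_lt (List.count_pos_iff.2 hp)
  rw [hk, zero_add, List.replicate_succ, List.cons_append] at h
  exact hpq (List.cons.inj h).1

section Prefixes

variable (hv : v = S ++ [a] ++ T ++ [b] ++ R)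
include hv

theorem count_eq_zero_of_aabb_of_abab (ha : a ∈ S) (hb : b ∈ S) (hap : a ≠ p) (hbp : b ≠ p)
    (hproj : pairProj a p v = [a, a, p, p]) (hproj' : pairProj b p v = [b, p, b, p]) :
    S.count p = 0 ∧ T.count p = 1 := by
  have hSa := count_prefix_of_aabb hap hproj (L := S ++ [a]) (R := T ++ [b] ++ R) (by simp [hv])
  have hS := count_prefix_of_aabb hap hproj (L := S) (R := [a] ++ T ++ [b] ++ R) (by simp [hv])
  have hTb := count_prefix_of_abab hbp hproj' hv
  have hT := count_prefix_of_abab hbp hproj' (L := S ++ [a] ++ T) (R := [b] ++ R) (by simp [hv])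
  have hpa : [a].count p = 0 := by simp [hap]
  have hpb : [b].count p = 0 := by simp [hbp]
  have ha := List.count_pos_iff.2 ha
  have hb := List.count_pos_iff.2 hb
  simp only [List.count_append, List.count_singleton_self] at hS hSa hT hTb
  omega

theorem count_eq_one_of_abba_of_abab (ha : a ∈ S) (hb : b ∈ S) (hap : a ≠ p) (hbp : b ≠ p)
    (hproj : pairProj p a v = [p, a, a, p]) (hproj' : pairProj p b v = [p, b, p, b]) :
    T.count p = 1 ∧ R.count p = 0 := by
  have hSa := count_prefix_of_abba hap.symm hproj (L := S ++ [a]) (R := T ++ [b] ++ R)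
    (by simp [hv])
  have hS := count_prefix_of_abba hap.symm hproj (L := S) (R := [a] ++ T ++ [b] ++ R)
    (by simp [hv])
  have hTb := count_prefix_of_abab hbp.symm hproj' hv
  have hvp := count_prefix_of_abab hbp.symm hproj' (R := []) (hv.trans (List.append_nil _).symm)
  have hpa : [a].count p = 0 := by simp [hap]
  have hpb : [b].count p = 0 := by simp [hbp]
  have ha := List.count_pos_iff.2 ha
  have hb := List.count_pos_iff.2 hb
  simp only [List.count_append, List.count_singleton_self] at hS hSa hTb hvp
  omega

theorem count_eq_one_of_abab_of_abba (ha : a ∈ S) (hb : b ∈ S) (hap : a ≠ p) (hbp : b ≠ p)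
    (hproj : pairProj a p v = [a, p, a, p]) (hproj' : pairProj b p v = [b, p, p, b]) :
    T.count p = 1 ∧ R.count p = 0 := by
  have hSa := count_prefix_of_abab hap hproj (L := S ++ [a]) (R := T ++ [b] ++ R) (by simp [hv])
  have hS := count_prefix_of_abab hap hproj (L := S) (R := [a] ++ T ++ [b] ++ R) (by simp [hv])
  have hTb := count_prefix_of_abba hbp hproj' hv
  have hvp := count_prefix_of_abba hbp hproj' (R := []) (hv.trans (List.append_nil _).symm)
  have hpa : [a].count p = 0 := by simp [hap]
  have hpb : [b].count p = 0 := by simp [hbp]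
  have ha := List.count_pos_iff.2 ha
  have hb := List.count_pos_iff.2 hb
  simp only [List.count_append, List.count_singleton_self] at hS hSa hTb hvp
  omega

end Prefixes

variable [DecidableEq β] {φ : β → List α} {A M B : List β} {ξ η g : β}

omit [DecidableEq α] [DecidableEq β] in
theorem exists_eq_of_flatMap_infix (hu : (A ++ ξ :: (M ++ η :: B)).flatMap φ <:+: v)
    (hξ : φ ξ = [a]) (hη : φ η = [b]) : ∃ S R, v = S ++ [a] ++ M.flatMap φ ++ [b] ++ R ∧
      A.flatMap φ <:+ S ∧ B.flatMap φ <+: R := by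
  obtain ⟨pre, post, hv⟩ := hu
  refine ⟨pre ++ A.flatMap φ, B.flatMap φ ++ post, ?_, List.suffix_append .., List.prefix_append ..⟩
  rw [← hv, ← hξ, ← hη]
  simp [List.flatMap_append, List.flatMap_cons]

theorem exists_mem_of_count_flatMap_eq_one (h : (M.flatMap φ).count p = 1) :
    ∃ g, M.count g = 1 ∧ p ∈ φ g := by
  obtain ⟨g, hg, hp⟩ := List.mem_flatMap.1 (List.count_pos_iff.1 (h.symm ▸ Nat.one_pos))
  have hmul := (Nat.mul_le_mul_left _ (List.count_pos_iff.2 hp)).trans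
    (count_mul_count_le_count_flatMap φ M g p)
  have := List.count_pos_iff.2 hg
  exact ⟨g, by omega, hp⟩

end Occurrences

section Covered

variable {n m : ℕ} {C : List Letter}

/-- Letters that occur once between the second occurrences of `left x` and `left y`, and not before
them, in all entailed words. If a substitution maps letters `ξ` and `η` to `left x` and `left y`,
then these letters lie in the images of letters between `ξ` and `η`. -/
def leftCovered (m : ℕ) : Finset DoubleLetter :=
  insert (right x) (insert (right y) ((Finset.range m).image fun j => left (zs j)))

/-- Letters that occur once between the second occurrences of `right x` and `right y`, and not after
them, in all entailed words. -/
def rightCovered (n : ℕ) : Finset DoubleLetter :=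
  insert cc ((Finset.range (2 * n)).image fun i => right (zp i))

theorem card_leftCovered (m : ℕ) : (leftCovered m).card = m + 2 := by
  rw [leftCovered, Finset.card_insert_of_notMem (by simp), Finset.card_insert_of_notMem (by simp),
    Finset.card_image_of_injective _ fun i j h => by simpa using h, Finset.card_range]

theorem card_rightCovered (n : ℕ) : (rightCovered n).card = 2 * n + 1 := by
  rw [rightCovered, Finset.card_insert_of_notMem (by simp),
    Finset.card_image_of_injective _ fun i j h => by simpa using h, Finset.card_range]

variable (hC : IsCore n m C) {v : List DoubleLetter} (hv : v ∈ entailedWords n m C)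
  {p : DoubleLetter}
include hC hv

theorem pairProj_left_of_mem_leftCovered (hp : p ∈ leftCovered m) :
    pairProj (left x) p v = [left x, left x, p, p] ∧
      pairProj (left y) p v = [left y, p, left y, p] := by
  obtain ⟨e, h⟩ := exists_hasCopy_left hC hv
  simp only [leftCovered, Finset.mem_insert, Finset.mem_image, Finset.mem_range] at hp
  obtain rfl | rfl | ⟨j, hj, rfl⟩ := hp
  · exact ⟨pairProj_left_x_right_x hC hv, pairProj_left_y_right_x hC hv⟩
  · exact ⟨pairProj_left_x_right_y hC hv, pairProj_left_y_right_y hC hv⟩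
  · exact ⟨h.pairProj_x_zs hC hj, h.pairProj_y_zs hC hj⟩

section RightPair

variable {S T R : List DoubleLetter} (hsplit : v = S ++ [right x] ++ T ++ [right y] ++ R)
  (hx : right x ∈ S) (hy : right y ∈ S)
include hsplit hx hy

theorem count_cc_eq_one : T.count cc = 1 ∧ R.count cc = 0 := by
  obtain ⟨e, h⟩ := exists_hasCopy_right hC hv
  have hprefix : v = S ++ ([right x] ++ T ++ [right y] ++ R) := by simp [hsplit]
  have hcc : cc ∈ S := mem_of_pairProj_eq_cons
    ((pairProj_comm ..).trans (pairProj_cc_left_tp_last hC hv)) (by simp) hprefix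
    (mem_of_pairProj_eq_cons (pairProj_right_x_left_tp_last hC hv) (by simp) hprefix hx)
  have hdd := count_prefix_of_aabb (by simp) (pairProj_right_x_dd hC hv) hprefix
  have hccdd := count_prefix_of_abab (by simp) (pairProj_cc_dd hC hv) hprefix
  have hzs := count_prefix_of_abab (by simp) (h.pairProj_y_zs hC hC.m_pos) hsplit
  have hcczs := count_prefix_of_aabb (by simp) (pairProj_cc_right_zs hC hv hC.m_pos) hsplit
  have hccv := count_prefix_of_abab (by simp) (pairProj_cc_dd hC hv) (R := [])
    (hsplit.trans (List.append_nil _).symm)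
  have hcountx := h.count_x hC
  rw [hsplit] at hcountx
  have hcc := List.count_pos_iff.2 hcc
  have hy := List.count_pos_iff.2 hy
  have hccx : [right x].count cc = 0 := rfl
  have hccy : [right y].count cc = 0 := rfl
  simp only [List.count_append, List.count_singleton_self] at hcountx hdd hccdd hzs hcczs hccv
  omega

theorem count_right_zp_eq_one {i : ℕ} (hi : i < 2 * n) :
    T.count (right (zp i)) = 1 ∧ R.count (right (zp i)) = 0 := by
  obtain ⟨e, h⟩ := exists_hasCopy_right hC hv
  have hprojx := h.pairProj_eq x (zp i) (by simp) (by simp)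
  have hprojy := h.pairProj_eq y (zp i) (by simp) (by simp)
  rw [hC.pairProj_x_zp h.isAdmissible hi] at hprojx
  rw [hC.pairProj_y_zp h.isAdmissible hi] at hprojy
  split_ifs at hprojx hprojy
  · rw [pairProj_comm] at hprojx hprojy
    exact count_eq_one_of_abba_of_abab hsplit hx hy (by simp) (by simp) hprojx hprojy
  · exact count_eq_one_of_abab_of_abba hsplit hx hy (by simp) (by simp) hprojx hprojy

end RightPair

variable {φ : DoubleLetter → List DoubleLetter} {A M B : List DoubleLetter} {ξ η : DoubleLetter}
  (hu : (A ++ ξ :: (M ++ η :: B)).flatMap φ <:+: v) (hξA : ξ ∈ A) (hηA : η ∈ A)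
include hu hξA hηA

theorem exists_mem_image_of_mem_leftCovered (hξ : φ ξ = [left x]) (hη : φ η = [left y])
    (hp : p ∈ leftCovered m) : ∃ g, M.count g = 1 ∧ g ∉ A ∧ p ∈ φ g := by
  obtain ⟨S, R, hsplit, hAS, -⟩ := exists_eq_of_flatMap_infix hu hξ hη
  have mem_S {g q : DoubleLetter} (hg : g ∈ A) (hq : q ∈ φ g) : q ∈ S :=
    hAS.subset (List.mem_flatMap.2 ⟨g, hg, hq⟩)
  obtain ⟨hprojx, hprojy⟩ := pairProj_left_of_mem_leftCovered hC hv hp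
  obtain ⟨hS, hM⟩ := count_eq_zero_of_aabb_of_abab hsplit (mem_S hξA (by simp [hξ]))
    (mem_S hηA (by simp [hη])) (by rintro rfl; simp [leftCovered] at hp)
    (by rintro rfl; simp [leftCovered] at hp) hprojx hprojy
  obtain ⟨g, hg, hpg⟩ := exists_mem_of_count_flatMap_eq_one hM
  exact ⟨g, hg, fun hgA => List.count_eq_zero.1 hS (mem_S hgA hpg), hpg⟩

theorem exists_mem_image_of_mem_rightCovered (hξ : φ ξ = [right x]) (hη : φ η = [right y])
    (hp : p ∈ rightCovered n) : ∃ g, M.count g = 1 ∧ g ∉ B ∧ p ∈ φ g := by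
  obtain ⟨S, R, hsplit, hAS, hBR⟩ := exists_eq_of_flatMap_infix hu hξ hη
  have hx : right x ∈ S := hAS.subset (List.mem_flatMap.2 ⟨ξ, hξA, by simp [hξ]⟩)
  have hy : right y ∈ S := hAS.subset (List.mem_flatMap.2 ⟨η, hηA, by simp [hη]⟩)
  have hcount : (M.flatMap φ).count p = 1 ∧ R.count p = 0 := by
    simp only [rightCovered, Finset.mem_insert, Finset.mem_image, Finset.mem_range] at hp
    obtain rfl | ⟨i, hi, rfl⟩ := hp
    · exact count_cc_eq_one hC hv hsplit hx hy
    · exact count_right_zp_eq_one hC hv hsplit hx hy hi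
  obtain ⟨g, hg, hpg⟩ := exists_mem_of_count_flatMap_eq_one hcount.1
  exact ⟨g, hg, fun hgB => List.count_eq_zero.1 hcount.2
    (hBR.subset (List.mem_flatMap.2 ⟨g, hgB, hpg⟩)), hpg⟩

end Covered

theorem eq_of_append_comm {α : Type*} {L K : List α} (hL : ∀ a ∈ L, ∀ b ∈ L, a = b)
    (hK : ∀ a ∈ K, ∀ b ∈ K, a = b) (hcomm : L ++ K = K ++ L) {a b : α} (ha : a ∈ L)
    (hb : b ∈ K) : a = b := by
  obtain ⟨a', L, rfl⟩ := List.exists_cons_of_ne_nil (List.ne_nil_of_mem ha)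
  obtain ⟨b', K, rfl⟩ := List.exists_cons_of_ne_nil (List.ne_nil_of_mem hb)
  rw [hL a ha a' List.mem_cons_self, hK b hb b' List.mem_cons_self]
  exact (List.cons.inj hcomm).1

theorem card_insert_image_range_le {α : Type*} [DecidableEq α] (a : α) (f : ℕ → α) (k : ℕ) :
    (insert a ((Finset.range k).image f)).card ≤ k + 1 :=
  (Finset.card_insert_le _ _).trans <|
    Nat.succ_le_succ (Finset.card_image_le.trans (Finset.card_range k).le)

section Rigidity

variable {n m : ℕ} {C : List Letter} (hC : IsCore n m C) {v : List DoubleLetter}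
  (hv : v ∈ entailedWords n m C) {φ : DoubleLetter → List DoubleLetter} {X Y : List DoubleLetter}
  (hX : X.Perm [left x, left y]) (hY : Y.Perm [right x, right y])
  (hu : (interlock n m C X Y).flatMap φ <:+: v)
include hC hv hX hY hu

theorem not_image_left_eq_right (hx : φ (left x) = [right x]) (hy : φ (left y) = [right y]) :
    False := by
  have hmem : left x ∈ X ∧ left y ∈ X := by simp [hX.mem_iff]
  have hcard : (rightCovered n).card ≤
      ((Finset.range (2 * n)).image fun i => left (zp i)).card :=
    Finset.card_le_card_of_forall_subsingleton (fun p g => p ∈ φ g) (fun p hp => ?_) fun g hg => ?_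
  · rw [card_rightCovered] at hcard
    have hle := Finset.card_image_le (s := Finset.range (2 * n)) (f := fun i => left (zp i))
    rw [Finset.card_range] at hle
    omega
  · rw [interlock_eq_left] at hu
    obtain ⟨g, hg, hgB, hpg⟩ := exists_mem_image_of_mem_rightCovered hC hv hu (by simp [hmem])
      (by simp [hmem]) hx hy hp
    refine ⟨g, ?_, hpg⟩
    rcases hC.cases_of_count_eq_one left_injective hg with hgY | ⟨j, hj, rfl⟩ | ⟨i, hi, rfl⟩
    · refine absurd ?_ hgB
      obtain rfl | rfl : g = right x ∨ g = right y := by simpa using hY.mem_iff.1 hgY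
      all_goals simp [leftEnd]
    · exact absurd (left_zs_mem_leftEnd hj) hgB
    · simpa using hi
  · obtain ⟨i, hi, rfl⟩ := Finset.mem_image.1 hg
    have hcount := two_le_count_interlock_left hC (X := X) hY (g := left (zp i))
      (by simp [hC.zp_mem_expand (Finset.mem_range.1 hi)])
    exact fun p hp q hq => eq_of_mem_image hu hC hv hcount p hp.2 q hq.2

omit hX in
theorem not_image_right_eq_left (hx : φ (right x) = [left x]) (hy : φ (right y) = [left y]) :
    False := by
  have hmem : right x ∈ Y ∧ right y ∈ Y := by simp [hY.mem_iff]
  have hcard : (leftCovered m).card ≤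
      (insert dd ((Finset.range m).image fun j => right (zs j))).card :=
    Finset.card_le_card_of_forall_subsingleton (fun p g => p ∈ φ g) (fun p hp => ?_) fun g hg => ?_
  · rw [card_leftCovered] at hcard
    have hle := card_insert_image_range_le dd (fun j => right (zs j)) m
    omega
  · rw [interlock_eq_right] at hu
    obtain ⟨g, hg, hgA, hpg⟩ := exists_mem_image_of_mem_leftCovered hC hv hu (by simp [hmem])
      (by simp [hmem]) hx hy hp
    refine ⟨g, ?_, hpg⟩
    rcases hC.cases_of_count_eq_one right_injective hg with hglink | ⟨j, hj, rfl⟩ | ⟨i, hi, rfl⟩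
    · obtain rfl | rfl : g = dd ∨ g = cc := by simpa using hglink
      · simp
      · exact absurd (by simp [leftMiddle]) hgA
    · simpa using hj
    · exact absurd (right_zp_mem X Y hi) hgA
  · have hcount : 2 ≤ (interlock n m C X Y).count g := two_le_count_interlock_right hC <| by
      simp only [Finset.mem_insert, Finset.mem_image, Finset.mem_range] at hg
      obtain rfl | ⟨j, hj, rfl⟩ := hg
      · simp
      · simp [hC.zs_mem_expand hj]
    exact fun p hp q hq => eq_of_mem_image hu hC hv hcount p hp.2 q hq.2

theorem commute_or_image_left_eq : φ (left x) ++ φ (left y) = φ (left y) ++ φ (left x) ∨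
    φ (left x) = [left x] ∧ φ (left y) = [left y] := by
  rcases commute_or_image_eq hu hC hv (interlock_eq_left X Y) hX
    (fun g hg => two_le_count_interlock_left hC hY hg) with hcomm | ⟨ι, rfl | rfl, himage⟩
  · exact .inl hcomm
  · exact .inr himage
  · exact (not_image_left_eq_right hC hv hX hY hu himage.1 himage.2).elim

omit hX in
theorem commute_or_image_right_eq : φ (right x) ++ φ (right y) = φ (right y) ++ φ (right x) ∨
    φ (right x) = [right x] ∧ φ (right y) = [right y] := by
  rcases commute_or_image_eq hu hC hv (interlock_eq_right X Y) hY
    (fun g hg => two_le_count_interlock_right hC hg) with hcomm | ⟨ι, rfl | rfl, himage⟩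
  · exact .inl hcomm
  · exact (not_image_right_eq_left hC hv hY hu himage.1 himage.2).elim
  · exact .inr himage

/-- If `right x` and `right y` had commuting images, these would be powers of one letter, so that
the `m + 1` letters `right x` and `left (zs j)` would have to cover `m + 2` letters. -/
theorem image_right_eq (hx : φ (left x) = [left x]) (hy : φ (left y) = [left y]) :
    φ (right x) = [right x] ∧ φ (right y) = [right y] := by
  refine (commute_or_image_right_eq hC hv hY hu).resolve_left fun hcomm => ?_
  have hmem : left x ∈ X ∧ left y ∈ X := by simp [hX.mem_iff]
  have eq_of_mem {g : DoubleLetter} (hg : g ∈ Y ++ (expand stdExponent C).map left) :=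
    eq_of_mem_image hu hC hv (two_le_count_interlock_left hC hY hg)
  have hx_eq := eq_of_mem (g := right x) (by simp [hY.mem_iff])
  have hy_eq := eq_of_mem (g := right y) (by simp [hY.mem_iff])
  have hcard : (leftCovered m).card ≤
      (insert (right x) ((Finset.range m).image fun j => left (zs j))).card :=
    Finset.card_le_card_of_forall_subsingleton
      (fun p g => p ∈ φ g ∨ g = right x ∧ p ∈ φ (right y)) (fun p hp => ?_) fun g hg => ?_
  · rw [card_leftCovered] at hcard
    have hle := card_insert_image_range_le (right x) (fun j => left (zs j)) m
    omega
  · rw [interlock_eq_left] at hu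
    obtain ⟨g, hg, hgA, hpg⟩ := exists_mem_image_of_mem_leftCovered hC hv hu (by simp [hmem])
      (by simp [hmem]) hx hy hp
    rcases hC.cases_of_count_eq_one left_injective hg with hgY | ⟨j, hj, rfl⟩ | ⟨i, hi, rfl⟩
    · refine ⟨right x, by simp, ?_⟩
      obtain rfl | rfl : g = right x ∨ g = right y := by simpa using hY.mem_iff.1 hgY
      · exact .inl hpg
      · exact .inr ⟨rfl, hpg⟩
    · exact ⟨left (zs j), by simpa using hj, .inl hpg⟩
    · exact absurd (left_zp_mem X hi) hgA
  · simp only [Finset.mem_insert, Finset.mem_image, Finset.mem_range] at hg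
    obtain rfl | ⟨j, hj, rfl⟩ := hg
    · rintro p ⟨-, hp⟩ q ⟨-, hq⟩
      rcases hp with hp | ⟨-, hp⟩ <;> rcases hq with hq | ⟨-, hq⟩
      · exact hx_eq p hp q hq
      · exact eq_of_append_comm hx_eq hy_eq hcomm hp hq
      · exact (eq_of_append_comm hx_eq hy_eq hcomm hq hp).symm
      · exact hy_eq p hp q hq
    · rintro p ⟨-, hp⟩ q ⟨-, hq⟩
      simp only [reduceCtorEq, false_and, or_false] at hp hq
      exact eq_of_mem (by simp [hC.zs_mem_expand hj]) p hp q hq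

end Rigidity

theorem toList_lift {Γ Δ : Type*} (φ : Γ → FreeMonoid Δ) (a : FreeMonoid Γ) :
    (FreeMonoid.lift φ a).toList = a.toList.flatMap fun g => (φ g).toList := by
  induction a using FreeMonoid.inductionOn' with
  | one => rfl
  | of_mul g a ih =>
    rw [map_mul, FreeMonoid.toList_mul, ih]
    rfl

theorem closedUnder_preimage_toList {Γ Δ : Type*} {K : Set (List Γ)} {a b : List Δ}
    (h : ∀ (φ : Δ → List Γ) (pre post : List Γ),
      pre ++ a.flatMap φ ++ post ∈ K ↔ pre ++ b.flatMap φ ++ post ∈ K) :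
    ClosedUnder (FreeMonoid.toList ⁻¹' K) (FreeMonoid.ofList a) (FreeMonoid.ofList b) :=
  fun φ p s => by
    simpa only [Set.mem_preimage, FreeMonoid.toList_mul, toList_lift, FreeMonoid.toList_ofList]
      using h (fun g => (φ g).toList) p.toList s.toList

theorem flatMap_eq_of_perm_pair {α β : Type*} {f : α → List β} {ξ η : α} {X X' : List α}
    (hX : X.Perm [ξ, η]) (hX' : X'.Perm [ξ, η]) (hf : f ξ ++ f η = f η ++ f ξ) :
    X.flatMap f = X'.flatMap f := by
  rcases List.perm_pair.1 hX with rfl | rfl <;> rcases List.perm_pair.1 hX' with rfl | rfl <;>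
    simp [hf]

theorem flatMap_append_comm_of_or {α β : Type*} {φ : α → List α} {ψ : α → List β} {ξ η : α}
    (hφ : φ ξ ++ φ η = φ η ++ φ ξ ∨ φ ξ = [ξ] ∧ φ η = [η]) (hψ : ψ ξ ++ ψ η = ψ η ++ ψ ξ) :
    (φ ξ).flatMap ψ ++ (φ η).flatMap ψ = (φ η).flatMap ψ ++ (φ ξ).flatMap ψ := by
  rcases hφ with hcomm | ⟨hξ, hη⟩
  · rw [← List.flatMap_append, hcomm, List.flatMap_append]
  · simpa [hξ, hη] using hψ

theorem pairProj_eq_of_occurrences {α : Type*} [DecidableEq α] {p q : α} (hpq : p ≠ q)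
    {a b c d : List α} (hp : (a ++ p :: q :: (b ++ p :: (c ++ q :: d))).count p = 2)
    (hq : (a ++ p :: q :: (b ++ p :: (c ++ q :: d))).count q = 2) :
    pairProj p q (a ++ p :: q :: (b ++ p :: (c ++ q :: d))) = [p, q, p, q] := by
  simp only [List.count_append, List.count_cons, beq_self_eq_true, beq_iff_eq, hpq, hpq.symm,
    if_true, if_false] at hp hq
  have hnil (L : List α) (hpL : L.count p = 0) (hqL : L.count q = 0) : pairProj p q L = [] :=
    pairProj_eq_nil (List.count_eq_zero.1 hpL) (List.count_eq_zero.1 hqL)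
  simp only [pairProj_append, pairProj_cons, true_or, or_true, if_true]
  rw [hnil a (by omega) (by omega), hnil b (by omega) (by omega), hnil c (by omega) (by omega),
    hnil d (by omega) (by omega)]
  rfl

section Languages

variable {n m : ℕ} {C : List Letter}

theorem flatMap_interlock_congr {β : Type*} {φ : DoubleLetter → List β}
    {X X' Y Y' : List DoubleLetter} (hX : X.flatMap φ = X'.flatMap φ)
    (hY : Y.flatMap φ = Y'.flatMap φ) :
    (interlock n m C X Y).flatMap φ = (interlock n m C X' Y').flatMap φ := by
  simp [interlock, List.flatMap_append, List.flatMap_cons, hX, hY]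

theorem mem_entailedWords_of_flatMap_eq {v v' : List DoubleLetter} (hv : v ∈ entailedWords n m C)
    (h : ∀ ψ : DoubleLetter → List Letter,
      ψ (left x) ++ ψ (left y) = ψ (left y) ++ ψ (left x) →
      ψ (right x) ++ ψ (right y) = ψ (right y) ++ ψ (right x) → v.flatMap ψ = v'.flatMap ψ) :
    v' ∈ entailedWords n m C := fun ψ pre post hleft hright hmem =>
  h ψ hleft hright ▸ hv ψ pre post hleft hright hmem

theorem interlock_mem_entailedWords {X Y : List DoubleLetter} (hX : X.Perm [left x, left y])
    (hY : Y.Perm [right x, right y]) : interlock n m C X Y ∈ entailedWords n m C :=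
  mem_entailedWords_of_flatMap_eq (v := interlockedWord n m C) (fun _ _ _ _ _ hmem => hmem)
    fun _ hleft hright => flatMap_interlock_congr (flatMap_eq_of_perm_pair (.refl _) hX hleft)
      (flatMap_eq_of_perm_pair (.refl _) hY hright)

/-- The entailed words in whose right copy the first occurrences of `x` and `y` have been swapped.
By `closedUnder_rightNonstandard`, its syntactic monoid allows swapping the left pair. -/
def rightNonstandard (n m : ℕ) (C : List Letter) : Set (List DoubleLetter) :=
  {v ∈ entailedWords n m C | v.flatMap rightPart ∉ shapeClass n m C}

/-- The entailed words in whose left copy the first occurrences of `x` and `y` have not been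
swapped. By `closedUnder_leftStandard`, its syntactic monoid allows swapping the right pair. -/
def leftStandard (n m : ℕ) (C : List Letter) : Set (List DoubleLetter) :=
  {v ∈ entailedWords n m C | v.flatMap leftPart ∈ shapeClass n m C}

section Swap

variable (hC : IsCore n m C) {X X' Y Y' : List DoubleLetter}
  (hX : X.Perm [left x, left y]) (hX' : X'.Perm [left x, left y])
  (hY : Y.Perm [right x, right y]) (hY' : Y'.Perm [right x, right y])
  {φ : DoubleLetter → List DoubleLetter} {pre post : List DoubleLetter}
include hC hY

include hX hX' in
theorem flatMap_swap_left_eq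
    (hv : pre ++ (interlock n m C X Y).flatMap φ ++ post ∈ entailedWords n m C)
    {ψ : DoubleLetter → List Letter} (hψ : ψ (left x) ++ ψ (left y) = ψ (left y) ++ ψ (left x)) :
    (pre ++ (interlock n m C X Y).flatMap φ ++ post).flatMap ψ =
      (pre ++ (interlock n m C X' Y).flatMap φ ++ post).flatMap ψ := by
  have hcomm := flatMap_append_comm_of_or
    (commute_or_image_left_eq hC hv hX hY (List.infix_append ..)) hψ
  simp only [List.flatMap_append, List.flatMap_assoc]
  rw [flatMap_interlock_congr (flatMap_eq_of_perm_pair hX hX' hcomm) rfl]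

include hY' in
theorem flatMap_swap_right_eq
    (hv : pre ++ (interlock n m C X Y).flatMap φ ++ post ∈ entailedWords n m C)
    {ψ : DoubleLetter → List Letter}
    (hψ : ψ (right x) ++ ψ (right y) = ψ (right y) ++ ψ (right x)) :
    (pre ++ (interlock n m C X Y).flatMap φ ++ post).flatMap ψ =
      (pre ++ (interlock n m C X Y').flatMap φ ++ post).flatMap ψ := by
  have hcomm := flatMap_append_comm_of_or
    (commute_or_image_right_eq hC hv hY (List.infix_append ..)) hψ
  simp only [List.flatMap_append, List.flatMap_assoc]
  rw [flatMap_interlock_congr rfl (flatMap_eq_of_perm_pair hY hY' hcomm)]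

include hX hX' in
theorem swap_left_mem_rightNonstandard
    (h : pre ++ (interlock n m C X Y).flatMap φ ++ post ∈ rightNonstandard n m C) :
    pre ++ (interlock n m C X' Y).flatMap φ ++ post ∈ rightNonstandard n m C :=
  ⟨mem_entailedWords_of_flatMap_eq h.1 fun _ hleft _ => flatMap_swap_left_eq hC hX hX' hY h.1 hleft,
    flatMap_swap_left_eq hC hX hX' hY h.1 (ψ := rightPart) rfl ▸ h.2⟩

include hY' in
theorem swap_right_mem_leftStandard
    (h : pre ++ (interlock n m C X Y).flatMap φ ++ post ∈ leftStandard n m C) :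
    pre ++ (interlock n m C X Y').flatMap φ ++ post ∈ leftStandard n m C :=
  ⟨mem_entailedWords_of_flatMap_eq h.1 fun _ _ hright => flatMap_swap_right_eq hC hY hY' h.1 hright,
    flatMap_swap_right_eq hC hY hY' h.1 (ψ := leftPart) rfl ▸ h.2⟩

include hX hX' in
theorem closedUnder_rightNonstandard :
    ClosedUnder (FreeMonoid.toList ⁻¹' rightNonstandard n m C)
      (FreeMonoid.ofList (interlock n m C X Y)) (FreeMonoid.ofList (interlock n m C X' Y)) :=
  closedUnder_preimage_toList fun _ _ _ =>
    ⟨swap_left_mem_rightNonstandard hC hX hX' hY, swap_left_mem_rightNonstandard hC hX' hX hY⟩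

include hY' in
theorem closedUnder_leftStandard :
    ClosedUnder (FreeMonoid.toList ⁻¹' leftStandard n m C)
      (FreeMonoid.ofList (interlock n m C X Y)) (FreeMonoid.ofList (interlock n m C X Y')) :=
  closedUnder_preimage_toList fun _ _ _ =>
    ⟨swap_right_mem_leftStandard hC hY hY', swap_right_mem_leftStandard hC hY' hY⟩

end Swap

section Intersection

variable (hC : IsCore n m C)
include hC

theorem rightPart_mem_shapeClass {v : List DoubleLetter} (hv : v ∈ entailedWords n m C)
    (hxy : pairProj (right x) (right y) v = [right x, right y, right x, right y]) :
    v.flatMap rightPart ∈ shapeClass n m C := by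
  obtain ⟨e, he⟩ := exists_hasCopy_right hC hv
  refine ⟨e, he.isAdmissible, eq_of_pairProj_eq fun p q =>
    right_injective.list_map ?_⟩
  have hproj := (isEmbeddedCopy_right (n := n) (m := m) (C := C)).pairProj_eq_map
    (f := fun l => [l]) (p := p) (q := q) (fun _ => rfl) v
  simp only [List.flatMap_singleton'] at hproj
  rw [← hproj]
  by_cases hpq : p = x ∧ q = y
  · rw [hpq.1, hpq.2, hxy, hC.pairProj_x_y he.isAdmissible]
    rfl
  by_cases hqp : p = y ∧ q = x
  · rw [hqp.1, hqp.2, pairProj_comm, hxy, pairProj_comm, hC.pairProj_x_y he.isAdmissible]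
    rfl
  exact he.pairProj_eq p q hpq hqp

theorem commute_of_mem_rightNonstandard {φ : DoubleLetter → List DoubleLetter}
    {pre post X : List DoubleLetter} (hX : X.Perm [left x, left y])
    (h : pre ++ (interlock n m C X [right x, right y]).flatMap φ ++ post ∈
      rightNonstandard n m C) :
    φ (left x) ++ φ (left y) = φ (left y) ++ φ (left x) := by
  have hinfix := List.infix_append pre ((interlock n m C X [right x, right y]).flatMap φ) post
  refine (commute_or_image_left_eq hC h.1 hX (.refl _) hinfix).resolve_right ?_
  rintro ⟨hleftx, hlefty⟩
  obtain ⟨hrightx, hrighty⟩ := image_right_eq hC h.1 hX (.refl _) hinfix hleftx hlefty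
  obtain ⟨e, he⟩ := exists_hasCopy_right hC h.1
  have hv : pre ++ (interlock n m C X [right x, right y]).flatMap φ ++ post =
      (pre ++ ((primedBlock 0 n).map left ++ (X ++ (leftMiddle n ++ [left x]))).flatMap φ) ++
      right x :: right y :: ((rightMiddle n C).flatMap φ ++ right x ::
      ((dd :: cc :: (expand stdExponent C).map right).flatMap φ ++ right y ::
      (((tailWord m).map right ++ ((tailWord m).map left ++ [dd])).flatMap φ ++ post))) := by
    rw [interlock_eq_right]
    simp [List.flatMap_append, List.flatMap_cons, hrightx, hrighty]
  refine h.2 (rightPart_mem_shapeClass hC h.1 ?_)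
  have hcount_x := he.count_x hC
  have hcount_y := he.count_y hC
  rw [hv] at hcount_x hcount_y ⊢
  exact pairProj_eq_of_occurrences (by simp) hcount_x hcount_y

theorem closedUnder_rightNonstandard_inter_leftStandard :
    ClosedUnder (FreeMonoid.toList ⁻¹' rightNonstandard n m C ∩
        FreeMonoid.toList ⁻¹' leftStandard n m C)
      (FreeMonoid.ofList (interlockedWord n m C))
      (FreeMonoid.ofList (interlock n m C [left y, left x] [right x, right y])) := by
  rw [← Set.preimage_inter]
  refine closedUnder_preimage_toList fun φ pre post => ?_
  have hswap : [left y, left x].Perm [left x, left y] := .swap ..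
  have heq (hcomm : φ (left x) ++ φ (left y) = φ (left y) ++ φ (left x)) :
      (interlockedWord n m C).flatMap φ =
        (interlock n m C [left y, left x] [right x, right y]).flatMap φ :=
    flatMap_interlock_congr (flatMap_eq_of_perm_pair (.refl _) hswap hcomm) rfl
  constructor <;> intro h
  · rwa [← heq (commute_of_mem_rightNonstandard hC (.refl _) h.1)]
  · rwa [heq (commute_of_mem_rightNonstandard hC hswap h.1)]

theorem shape_y_x_notMem_shapeClass {e : Letter → ℕ} :
    shape n m (expand e C) [y, x] ∉ shapeClass n m C := by
  rintro ⟨e', he', h⟩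
  have hproj := hC.pairProj_x_y he'
  rw [← h] at hproj
  rw [shape, pairProj_append, pairProj_eq_nil (by simp) (by simp)] at hproj
  simp [pairProj_cons] at hproj

theorem interlock_mem_rightNonstandard_inter_leftStandard :
    interlock n m C [left x, left y] [right y, right x] ∈
      rightNonstandard n m C ∩ leftStandard n m C := by
  have hmem : interlock n m C [left x, left y] [right y, right x] ∈ entailedWords n m C :=
    interlock_mem_entailedWords (.refl _) (.swap ..)
  refine ⟨⟨hmem, ?_⟩, hmem, ?_⟩
  · rw [rightPart_interlock _ _ rfl]
    exact shape_y_x_notMem_shapeClass hC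
  · rw [leftPart_interlock _ _ rfl]
    exact ⟨stdExponent, isAdmissible_stdExponent, isAdmissible_stdExponent.expand_shape_xy.symm⟩

theorem interlock_notMem_leftStandard {Y : List DoubleLetter} (hY : Y.flatMap leftPart = []) :
    interlock n m C [left y, left x] Y ∉ leftStandard n m C := fun h => by
  have hmem := h.2
  rw [leftPart_interlock _ _ hY] at hmem
  exact shape_y_x_notMem_shapeClass hC hmem

end Intersection

end Languages

theorem mul_mul_mem_of_reesCon {S : Type} [Monoid S] {W : Set S} {u v : S} (h : reesCon W u v)
    {p s : S} (hu : p * u * s ∈ W) : p * v * s ∈ W := by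
  rcases h with rfl | ⟨hnotMem, -⟩
  · exact hu
  · exact absurd ⟨_, hu, p, s, rfl⟩ hnotMem

theorem SatisfiesOver.mul_lift_mul_mem {Γ : Type*} {α : Con Word} {W : Set α.Quotient}
    {a b : FreeMonoid Γ} (h : SatisfiesOver (MAlpha α W) a b) {ψ : Γ → Word} {p s : Word}
    (ha : ((p * FreeMonoid.lift ψ a * s : Word) : α.Quotient) ∈ W) :
    ((p * FreeMonoid.lift ψ b * s : Word) : α.Quotient) ∈ W := by
  have hlift := h fun g => ((ψ g : α.Quotient) : (reesCon W).Quotient)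
  have hmap (c : FreeMonoid Γ) : FreeMonoid.lift
      (fun g => ((ψ g : α.Quotient) : (reesCon W).Quotient)) c =
        ((FreeMonoid.lift ψ c : α.Quotient) : (reesCon W).Quotient) :=
    (FreeMonoid.hom_map_lift ((reesCon W).mk'.comp α.mk') ψ c).symm
  rw [hmap, hmap, Con.eq] at hlift
  exact mul_mul_mem_of_reesCon (p := (p : α.Quotient)) (s := (s : α.Quotient)) hlift ha

namespace IsCore

variable {n m : ℕ} {C : List Letter} (hC : IsCore n m C) {e : Letter → ℕ} (he : IsAdmissible e)
include hC he

theorem mem_shapeClass_of_satisfiesOver {Γ : Type*} {a b : FreeMonoid Γ}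
    (h : SatisfiesOver (MAlpha gamma'
      {((FreeMonoid.ofList (expand e (shape n m C [x, y])) : Word) : gamma'.Quotient)}) a b)
    {ψ : Γ → List Letter} {pre post : List Letter}
    (ha : pre ++ a.toList.flatMap ψ ++ post ∈ shapeClass n m C) :
    pre ++ b.toList.flatMap ψ ++ post ∈ shapeClass n m C := by
  have hmem (c : FreeMonoid Γ) : pre ++ c.toList.flatMap ψ ++ post ∈ shapeClass n m C ↔
      ((FreeMonoid.ofList pre * FreeMonoid.lift (fun g => FreeMonoid.ofList (ψ g)) c *
        FreeMonoid.ofList post : Word) : gamma'.Quotient) ∈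
        ({((FreeMonoid.ofList (expand e (shape n m C [x, y])) : Word) : gamma'.Quotient)} :
          Set gamma'.Quotient) := by
    rw [Set.mem_singleton_iff, Con.eq, ← FreeMonoid.ofList_toList (FreeMonoid.lift _ c),
      toList_lift]
    exact (hC.gamma'_iff he _).symm
  exact (hmem b).2 (h.mul_lift_mul_mem ((hmem a).1 ha))

theorem mem_entailedWords_of_satisfiesOver {a b : FreeMonoid DoubleLetter}
    (h : SatisfiesOver (MAlpha gamma'
      {((FreeMonoid.ofList (expand e (shape n m C [x, y])) : Word) : gamma'.Quotient)}) a b)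
    (ha : a.toList ∈ entailedWords n m C) : b.toList ∈ entailedWords n m C := by
  simp only [entailedWords, Set.mem_ofPred_eq, ← List.append_assoc] at ha ⊢
  exact fun ψ pre post hleft hright hmem =>
    hC.mem_shapeClass_of_satisfiesOver he h (ha ψ pre post hleft hright hmem)

theorem flatMap_mem_shapeClass_of_satisfiesOver {Γ : Type*} {a b : FreeMonoid Γ}
    (h : SatisfiesOver (MAlpha gamma'
      {((FreeMonoid.ofList (expand e (shape n m C [x, y])) : Word) : gamma'.Quotient)}) a b)
    {ψ : Γ → List Letter} (ha : a.toList.flatMap ψ ∈ shapeClass n m C) :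
    b.toList.flatMap ψ ∈ shapeClass n m C := by
  simpa using hC.mem_shapeClass_of_satisfiesOver he h (pre := []) (post := []) (by simpa using ha)

theorem isSaturated_rightNonstandard : IsSaturated (MAlpha gamma'
    {((FreeMonoid.ofList (expand e (shape n m C [x, y])) : Word) : gamma'.Quotient)})
    (FreeMonoid.toList ⁻¹' rightNonstandard n m C) := fun _ _ h ha =>
  ⟨hC.mem_entailedWords_of_satisfiesOver he h ha.1, fun hb =>
    ha.2 (hC.flatMap_mem_shapeClass_of_satisfiesOver he h.symm hb)⟩

theorem isSaturated_leftStandard : IsSaturated (MAlpha gamma'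
    {((FreeMonoid.ofList (expand e (shape n m C [x, y])) : Word) : gamma'.Quotient)})
    (FreeMonoid.toList ⁻¹' leftStandard n m C) := fun _ _ h ha =>
  ⟨hC.mem_entailedWords_of_satisfiesOver he h ha.1,
    hC.flatMap_mem_shapeClass_of_satisfiesOver he h ha.2⟩

theorem not_isModularLattice_varGamma' : ¬ IsModularLattice
    (Set.Iic (varGamma' (FreeMonoid.ofList (expand e (shape n m C [x, y]))))) := by
  have hX : [left y, left x].Perm [left x, left y] := .swap ..
  have hY : [right y, right x].Perm [right x, right y] := .swap ..
  exact not_isModularLattice_of_languages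
    (hC.isSaturated_rightNonstandard he) (hC.isSaturated_leftStandard he)
    (closedUnder_rightNonstandard hC (.refl _) hX (.refl _))
    (closedUnder_rightNonstandard hC (.refl _) hX hY)
    (closedUnder_leftStandard hC (.refl _) hY) (closedUnder_leftStandard hC (.refl _) hY)
    (closedUnder_rightNonstandard_inter_leftStandard hC)
    (interlock_mem_rightNonstandard_inter_leftStandard hC)
    fun h => interlock_notMem_leftStandard hC rfl h.2

end IsCore

section Words

theorem prod_ofFn_ofList {α : Type*} {k : ℕ} (g : Fin k → List α) :
    (List.ofFn fun i => FreeMonoid.ofList (g i)).prod =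
      FreeMonoid.ofList ((List.finRange k).flatMap g) := by
  rw [List.flatMap_def, FreeMonoid.ofList_flatten, List.map_map, List.ofFn_eq_map]
  rfl

theorem flatMap_finRange_eq_interleave {α : Type*} (f g : ℕ → α) (a k : ℕ) :
    ((List.finRange k).flatMap fun i : Fin k => [f (a + i), g (a + i)]) = interleave f g a k := by
  rw [interleave, List.range'_eq_map_range, ← List.map_coe_finRange_eq_range, List.flatMap_map,
    List.flatMap_map]

theorem flatMap_finRange_singleton {α : Type*} {k : ℕ} (f : Fin k → α) :
    ((List.finRange k).flatMap fun i => [f i]) = List.ofFn f := by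
  rw [List.ofFn_eq_map, List.map_eq_flatMap]

theorem flatMap_finRange_pair {α : Type*} {k : ℕ} (f : Fin (2 * k) → α) :
    ((List.finRange k).flatMap fun i : Fin k => [f ⟨2 * i, by omega⟩, f ⟨2 * i + 1, by omega⟩]) =
      List.ofFn f := by
  rw [List.ofFn_mul', List.ofFn_eq_map, List.flatMap_def]
  simp only [List.ofFn_succ, List.ofFn_zero, Fin.val_zero, Fin.val_succ, add_zero, zero_add]

theorem ofFn_perm_map_range {α : Type*} {k : ℕ} (f : ℕ → α) (π : Equiv.Perm (Fin k)) :
    (List.ofFn fun i => f (π i)).Perm ((List.range k).map f) := by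
  rw [← List.map_coe_finRange_eq_range, List.map_map, ← List.ofFn_eq_map]
  exact π.ofFn_comp_perm fun i => f i

theorem cHead_eq (n : ℕ) : cHead n =
    FreeMonoid.ofList (primedBlock 0 n ++ ([x, y] ++ (t :: (primedBlock n n ++ [x])))) := by
  have hblock (a : ℕ) : (List.ofFn fun i : Fin n => ltr (zp (a + i)) * ltr (tp (a + i))).prod =
      FreeMonoid.ofList (primedBlock a n) :=
    (prod_ofFn_ofList fun i : Fin n => [zp (a + i), tp (a + i)]).trans
      (congrArg _ (flatMap_finRange_eq_interleave zp tp a n))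
  have hblock₀ := hblock 0
  simp only [zero_add] at hblock₀
  rw [cHead, hblock₀, hblock]
  simp only [FreeMonoid.ofList_append, FreeMonoid.ofList_cons, FreeMonoid.ofList_nil, mul_assoc,
    mul_one]

theorem cTail_eq (m : ℕ) : cTail m = FreeMonoid.ofList (tailWord m) := by
  have h := flatMap_finRange_eq_interleave ts zs 0 m
  simp only [zero_add] at h
  rw [tailWord, ← h, ← prod_ofFn_ofList]
  rfl

theorem mul_prod_ofFn_mul_eq {n m k : ℕ} {f : Fin k → Word} (g : Fin k → List Letter)
    (hf : ∀ i, f i = FreeMonoid.ofList (expand stdExponent (g i))) (j : ℕ) :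
    cHead n * (List.ofFn f).prod * (ltr (zs j) * ltr y) * cTail m = FreeMonoid.ofList
      (expand stdExponent (shape n m ((List.finRange k).flatMap g ++ [zs j]) [x, y])) := by
  have hexpand : (List.finRange k).flatMap (fun i => expand stdExponent (g i)) =
      expand stdExponent ((List.finRange k).flatMap g) := List.flatMap_assoc.symm
  have hzs : expand stdExponent [zs j] = [zs j] := rfl
  rw [funext hf, prod_ofFn_ofList, hexpand, cHead_eq, cTail_eq,
    isAdmissible_stdExponent.expand_shape_xy, expand_append, hzs]
  simp only [shape, FreeMonoid.ofList_append, FreeMonoid.ofList_cons, FreeMonoid.ofList_nil,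
    mul_assoc, mul_one]

theorem isCore_of_perm {n m k : ℕ} {C : List Letter} (hn : 1 ≤ n)
    (hC : C.Perm ((List.range m).map zs ++
      ((List.range k).map ys ++ (List.range (2 * n)).map zp)))
    (hhead : ∃ j C', C = zs j :: C') (hlast : ∃ j C', C = C' ++ [zs j]) : IsCore n m C where
  pos := hn
  nodup := by
    have hzs := (List.nodup_range (n := m)).map fun _ _ => zs.inj
    have hys := (List.nodup_range (n := k)).map fun _ _ => ys.inj
    have hzp := (List.nodup_range (n := 2 * n)).map fun _ _ => zp.inj
    refine hC.nodup_iff.2 (hzs.append (hys.append hzp ?_) ?_) <;> simp [List.disjoint_left]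
  zs_mem j := by simp [hC.mem_iff]
  zp_mem i := by simp [hC.mem_iff]
  x_notMem := by simp [hC.mem_iff]
  y_notMem := by simp [hC.mem_iff]
  isSimple_notMem l hl := by cases l <;> simp_all [hC.mem_iff, isSimple]
  head := hhead
  last := hlast

theorem isCore_of_blocks {n m k : ℕ} (hn : 1 ≤ n) (hk : 1 ≤ k) (π : Equiv.Perm (Fin (m + 1)))
    (τ : Equiv.Perm (Fin (2 * n))) {g zsPart zpPart : Fin k → List Letter}
    (hg : ∀ i, (g i).Perm (zsPart i ++ ([ys i] ++ zpPart i)))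
    (hzs : (List.finRange k).flatMap zsPart = List.ofFn fun i : Fin m => zs (π i.castSucc))
    (hzp : (List.finRange k).flatMap zpPart = List.ofFn fun i => zp (τ i))
    (hhead : ∀ i, ∃ j L, g i = zs j :: L) :
    IsCore n (m + 1) ((List.finRange k).flatMap g ++ [zs (π (Fin.last m))]) := by
  refine isCore_of_perm (k := k) hn ?_ ?_ ⟨_, _, rfl⟩
  · have hys : ((List.finRange k).flatMap fun i : Fin k => [ys i]) = (List.range k).map ys := by
      rw [flatMap_finRange_singleton, List.ofFn_eq_map, ← List.map_coe_finRange_eq_range,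
        List.map_map]
      rfl
    have hsplit : ((List.finRange k).flatMap g).Perm
        ((List.ofFn fun i : Fin m => zs (π i.castSucc)) ++
          ((List.range k).map ys ++ List.ofFn fun i => zp (τ i))) := by
      rw [← hzs, ← hys, ← hzp]
      exact (List.Perm.flatMap_left _ fun i _ => hg i).trans <|
        (List.flatMap_append_perm ..).symm.trans ((List.flatMap_append_perm ..).symm.append_left _)
    have hlast : (List.ofFn fun i : Fin m => zs (π i.castSucc)) ++ [zs (π (Fin.last m))] =
        List.ofFn fun i => zs (π i) := by
      rw [List.ofFn_succ', List.concat_eq_append]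
    refine (hsplit.append_right _).trans ?_
    rw [List.append_assoc]
    refine (List.perm_append_comm.append_left _).trans ?_
    rw [← List.append_assoc, hlast]
    exact (ofFn_perm_map_range zs π).append ((ofFn_perm_map_range zp τ).append_left _)
  · obtain ⟨k, rfl⟩ := Nat.exists_eq_add_of_le' hk
    obtain ⟨j, L, h⟩ := hhead 0
    exact ⟨j, _, by rw [List.finRange_succ, List.flatMap_cons, h, List.cons_append,
      List.cons_append]⟩

theorem not_isModularLattice_varGamma'_of_blocks {n m k : ℕ} (hn : 1 ≤ n) (hk : 1 ≤ k)
    (π : Equiv.Perm (Fin (m + 1))) (τ : Equiv.Perm (Fin (2 * n))) {f : Fin k → Word}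
    {g zsPart zpPart : Fin k → List Letter}
    (hf : ∀ i, f i = FreeMonoid.ofList (expand stdExponent (g i)))
    (hg : ∀ i, (g i).Perm (zsPart i ++ ([ys i] ++ zpPart i)))
    (hzs : (List.finRange k).flatMap zsPart = List.ofFn fun i : Fin m => zs (π i.castSucc))
    (hzp : (List.finRange k).flatMap zpPart = List.ofFn fun i => zp (τ i))
    (hhead : ∀ i, ∃ j L, g i = zs j :: L) :
    ¬ IsModularLattice (Set.Iic (varGamma' (cHead n * (List.ofFn f).prod *
      (ltr (zs (π (Fin.last m))) * ltr y) * cTail (m + 1)))) := by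
  rw [mul_prod_ofFn_mul_eq g hf]
  exact (isCore_of_blocks hn hk π τ hg hzs hzp hhead).not_isModularLattice_varGamma'
    isAdmissible_stdExponent

variable {n : ℕ} (hn : 1 ≤ n)
include hn

theorem not_isModularLattice_c1 (π : Equiv.Perm (Fin (4 * n + 1))) (τ : Equiv.Perm (Fin (2 * n))) :
    ¬ IsModularLattice (Set.Iic (varGamma' (c1 n π τ))) := by
  refine not_isModularLattice_varGamma'_of_blocks hn (by omega) π τ
    (g := fun i => [zs (π ⟨2 * i, by omega⟩), ys i, zs (π ⟨2 * i + 1, by omega⟩), zp (τ i)])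
    (zsPart := fun i => [zs (π ⟨2 * i, by omega⟩), zs (π ⟨2 * i + 1, by omega⟩)])
    (zpPart := fun i => [zp (τ i)]) (fun _ => rfl) (fun _ => .cons _ (.swap ..)) ?_
    (flatMap_finRange_singleton _) fun _ => ⟨_, _, rfl⟩
  have hcast : 4 * n = 2 * (2 * n) := by omega
  rw [List.ofFn_congr hcast]
  exact flatMap_finRange_pair fun i => zs (π (i.cast hcast.symm).castSucc)

theorem not_isModularLattice_c2 (π : Equiv.Perm (Fin (n + 1))) (τ : Equiv.Perm (Fin (2 * n))) :
    ¬ IsModularLattice (Set.Iic (varGamma' (c2 n π τ))) :=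
  not_isModularLattice_varGamma'_of_blocks hn hn π τ
    (g := fun i => [zs (π i.castSucc), zp (τ ⟨2 * i, by omega⟩), ys i,
      zp (τ ⟨2 * i + 1, by omega⟩)])
    (zsPart := fun i => [zs (π i.castSucc)])
    (zpPart := fun i => [zp (τ ⟨2 * i, by omega⟩), zp (τ ⟨2 * i + 1, by omega⟩)])
    (fun _ => rfl) (fun _ => .cons _ (.swap ..)) (flatMap_finRange_singleton _)
    (flatMap_finRange_pair fun i => zp (τ i)) fun _ => ⟨_, _, rfl⟩

theorem not_isModularLattice_c3 (π : Equiv.Perm (Fin (2 * n + 1))) (τ : Equiv.Perm (Fin (2 * n))) :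
    ¬ IsModularLattice (Set.Iic (varGamma' (c3 n π τ))) :=
  not_isModularLattice_varGamma'_of_blocks hn (by omega) π τ
    (g := fun i => [zs (π i.castSucc), zp (τ i), ys i])
    (zsPart := fun i => [zs (π i.castSucc)]) (zpPart := fun i => [zp (τ i)])
    (fun _ => rfl) (fun _ => .cons _ (.swap ..)) (flatMap_finRange_singleton _)
    (flatMap_finRange_singleton _) fun _ => ⟨_, _, rfl⟩

theorem not_isModularLattice_c4 (π : Equiv.Perm (Fin (2 * n + 1))) (τ : Equiv.Perm (Fin (2 * n))) :
    ¬ IsModularLattice (Set.Iic (varGamma' (c4 n π τ))) :=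
  not_isModularLattice_varGamma'_of_blocks hn (by omega) π τ
    (g := fun i => [zs (π i.castSucc), ys i, zp (τ i)])
    (zsPart := fun i => [zs (π i.castSucc)]) (zpPart := fun i => [zp (τ i)])
    (fun _ => rfl) (fun _ => .refl _) (flatMap_finRange_singleton _)
    (flatMap_finRange_singleton _) fun _ => ⟨_, _, rfl⟩

end Words

end MonVar

/-- For each variety `V` below, `Set.Iic V` is the lattice of all subvarieties of `V`. -/
theorem mainTheorem11 (n : ℕ) (hn : 1 ≤ n)
    (π₁ : Equiv.Perm (Fin (4 * n + 1))) (π₂ : Equiv.Perm (Fin (n + 1)))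
    (π₃ π₄ : Equiv.Perm (Fin (2 * n + 1))) (τ : Equiv.Perm (Fin (2 * n))) :
    ¬ IsModularLattice (Set.Iic (MonVar.varGamma' (MonVar.c1 n π₁ τ))) ∧
    ¬ IsModularLattice (Set.Iic (MonVar.varGamma' (MonVar.c2 n π₂ τ))) ∧
    ¬ IsModularLattice (Set.Iic (MonVar.varGamma' (MonVar.c3 n π₃ τ))) ∧
    ¬ IsModularLattice (Set.Iic (MonVar.varGamma' (MonVar.c4 n π₄ τ))) :=
  ⟨MonVar.not_isModularLattice_c1 hn π₁ τ, MonVar.not_isModularLattice_c2 hn π₂ τ,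
    MonVar.not_isModularLattice_c3 hn π₃ τ, MonVar.not_isModularLattice_c4 hn π₄ τ⟩
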